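/- \textbf{Theorem (Monolithic CONSENSUS-RecSplit).} Let $n=2^d$ with $d\ge 1$, let $\varepsilon\in[\frac1n,1]$, and let $S$ be a set of $n$ keys from a universe $U$. Consider the balanced binary splitting tree with $n$ leaves: level $\ell\in\{0,\dots,d-1\}$ has $2^\ell$ nodes $v$, each responsible for $n_\ell=2^{d-\ell}$ keys and each equipped with hash functions $f_{v,s}:U\to\{0,1\}$ indexed by seeds $s\in\{0,1\}^w$, where all bits $f_{v,s}(x)$ are independent and uniform. A seed $s$ is successful at $v$ if $f_{v,s}$ splits the keys arriving at $v$ perfectly in half; a fresh seed is successful with probability $p(n_\ell)=\binom{n_\ell}{n_\ell/2}2^{-n_\ell}$. \emph{Data structure.} The levels are processed from top to bottom. On level $\ell$, with $N=2^\ell$ nodes and $\varepsilon_\ell=\min(1,\varepsilon n_\ell^{3/4})$, let $L_i=\lceil \varepsilon_\ell i+i\log_2(1/p(n_\ell))\rceil$ and $\ell_i=L_i-L_{i-1}$. The (full) CONSENSUS algorithm determines by depth-first search with backtracking, in lexicographic order, a bitstring $M_\ell=\sigma_0\sigma_1\cdots\sigma_N$ with $|\sigma_0|=w$ and $|\sigma_i|=\ell_i$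 such that, for each $i$, the $w$-bit suffix $S_i$ of $\sigma_0\cdots\sigma_i$ is a successful seed for the $i$-th node of the level; it is aborted after a polynomial number $n^{\lambda}$ of steps, one step being the test of one seed. If the search fails on some level, the whole construction is restarted with fresh independent hash functions. The data structure is the bitstring consisting of the number of restarts, in unary, followed by $M_0,\dots,M_{d-1}$. A query for $x$ starts at the root, on each level reads the seed $S_i$ of the current node (which is found at offset $L_i$ in $M_\ell$), applies the hash function it identifies to $x$, moves to the corresponding child, and finally returns the index of the leaf reached. \emph{Cost model.} One unit of time for a hash evaluation, for computing an offset $L_i$, for reading a word of $w=O(\log n)$ bits, for a search or backtracking step, for moving a key, and for writing or reading in unary one bit; testing a seed at a node takes one hash evaluation for each key arriving there. The hash functions themselves, $n$ and $\varepsilon$ are available for free. \emph{Claim.} Write $\mathrm{OPT}_{\mathrm{MPHF}}$ for $n\log_2 e$ or, if $U$ is finite with $|U|\ge c_0n^2$, for the information-theoretic optimum, i.e. $\log_2$ of the least number of functions $U\to[n]$ such that each $n$-subset of $U$ is mapped bijectively by at least one of them. (The claim holds with either value.) For all constants $c,c_0>0$ one can choose $w=\Theta(\log n)$ and a constant $\lambda$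 such that the following holds, with implied constants that depend only on $c$ and $c_0$. \begin{enumerate} \item The construction terminates almost surely, and whenever it terminates, the resulting query function restricted to $S$ is a bijection $S\to\{0,\dots,n-1\}$, i.e. a minimal perfect hash function for $S$. \item The expected construction time, including restarts, is $O(\max(n^{3/2},n/\varepsilon))$. \item The space is at most $\mathrm{OPT}_{\mathrm{MPHF}}+O(\varepsilon n+\log^2 n)$ bits and each query takes time $O(\log n)$. Both bounds hold in expectation, and with probability at least $1-n^{-c}$ no restart is needed and both bounds hold in the worst case (over all queries). \end{enumerate} -/

import Mathlib

open MeasureTheory ProbabilityTheory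

namespace RecSplit

/-! ## Bitstrings -/

/-- The `k` low-order bits of `x`, most significant bit first. -/
def toBits : ℕ → ℕ → List Bool
  | 0, _ => []
  | k + 1, x => x.testBit k :: toBits k x

/-- The number whose binary representation, most significant bit first, is the given bitstring. -/
def ofBits (l : List Bool) : ℕ := l.foldl (fun acc b => 2 * acc + b.toNat) 0

/-! ## The full CONSENSUS algorithm

Parameters: the number `N` of Bernoulli families, the word size `w`, the lengths `len i` (in bits)
of the seed fragments `σ i`, the outcomes `B i s` of the trial of seed `s` in family `i`, and the
time `cost i` it takes to inspect one trial of family `i` (`1 ≤ i ≤ N`). -/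

inductive Status where
  | running
  | success
  | failure

/-- A state of the depth first search: the seed fragments, the current layer, and the time spent. -/
structure State where
  σ : ℕ → ℕ
  layer : ℕ
  status : Status
  time : ℕ

/-- The index `σ 0 ∘ σ 1 ∘ … ∘ σ i` of a tree node, obtained by concatenating binary
representations (with `len j` bits for `σ j`, `1 ≤ j ≤ i`). -/
def concat (len σ : ℕ → ℕ) : ℕ → ℕ
  | 0 => σ 0
  | i + 1 => concat len σ i * 2 ^ len (i + 1) + σ (i + 1)

/-- The seed `S i`: the `w`-bit suffix of `σ 0 ∘ … ∘ σ i`. -/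
def seed (w : ℕ) (len σ : ℕ → ℕ) (i : ℕ) : ℕ := concat len σ i % 2 ^ w

/-- The loop `while i > 0 and σ i = 2 ^ len i - 1 do i := i - 1`. -/
def backtrack (len σ : ℕ → ℕ) : ℕ → ℕ
  | 0 => 0
  | i + 1 => if σ (i + 1) + 1 = 2 ^ len (i + 1) then backtrack len σ i else i + 1

/-- One iteration of the main loop, which inspects exactly one Bernoulli trial. It is charged the
time for inspecting that trial, one unit, and one unit for each iteration of the backtracking
loop. -/
def step (N w : ℕ) (len : ℕ → ℕ) (B : ℕ → ℕ → Bool) (cost : ℕ → ℕ) (s : State) : State :=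
  match s.status with
  | .success => s
  | .failure => s
  | .running =>
    let i := s.layer
    if B i (seed w len s.σ i) = true then
      if i = N then
        { s with status := .success, time := s.time + cost i + 1 }
      else
        { σ := Function.update s.σ (i + 1) 0
          layer := i + 1
          status := .running
          time := s.time + cost i + 1 }
    else
      let j := backtrack len s.σ i
      let t := s.time + cost i + 1 + (i - j)
      if 0 < j then
        { σ := Function.update s.σ j (s.σ j + 1), layer := j, status := .running, time := t }
      else if s.σ 0 + 1 < 2 ^ w then
        { σ := Function.update (Function.update s.σ 0 (s.σ 0 + 1)) 1 0
          layer := 1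
          status := .running
          time := t }
      else
        { s with status := .failure, time := t }

/-- The run of the full CONSENSUS algorithm, aborted after `limit` steps. -/
def consensus (N w limit : ℕ) (len : ℕ → ℕ) (B : ℕ → ℕ → Bool) (cost : ℕ → ℕ) : State :=
  (step N w len B cost)^[limit] { σ := fun _ => 0, layer := 1, status := .running, time := 1 }

/-- The bitstring `M`: `σ 0` in `w` bits, followed by `σ i` in `len i` bits for `i = 1, …, N`. -/
def encode (N w : ℕ) (len σ : ℕ → ℕ) : List Bool :=
  toBits w (σ 0) ++ (List.range N).flatMap (fun j => toBits (len (j + 1)) (σ (j + 1)))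

/-! ## Parameters of the levels of the splitting tree

The tree has `2 ^ d` leaves, level `l < d` has `2 ^ l` nodes with `2 ^ (d - l)` keys each. -/

/-- The probability that a random function to `{0, 1}` splits `m` keys perfectly in half. -/
noncomputable def splitProb (m : ℕ) : ℝ := (m.choose (m / 2) : ℝ) / 2 ^ m

/-- The overhead parameter `min (1, ε m ^ (3/4))` of the level with `m = 2 ^ (d - l)` keys per
node. -/
noncomputable def levelEps (d : ℕ) (ε : ℝ) (l : ℕ) : ℝ :=
  min 1 (ε * ((2 : ℝ) ^ (d - l)) ^ (3 / 4 : ℝ))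

/-- The total length in bits of the first `i` seed fragments `σ 1, …, σ i` of level `l`. -/
noncomputable def prefixLen (d : ℕ) (ε : ℝ) (l i : ℕ) : ℕ :=
  ⌈levelEps d ε l * i + i * Real.logb 2 (1 / splitProb (2 ^ (d - l)))⌉₊

/-- The length in bits of the `i`-th seed fragment of level `l`, `1 ≤ i ≤ 2 ^ l`. -/
noncomputable def fragLen (d : ℕ) (ε : ℝ) (l i : ℕ) : ℕ :=
  prefixLen d ε l i - prefixLen d ε l (i - 1)

/-! ## Monolithic CONSENSUS-RecSplit -/

/-- Inputs of the random bits that constitute the splitting hash functions: (number of the attempt,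
level of the node, number of the node within its level, seed, key). -/
abbrev HashIndex (U : Type*) := ℕ × ℕ × ℕ × ℕ × U

variable {U : Type*}

/-- State of the top-down construction: the node that each key has reached, the bitstring written
so far, whether no level has failed so far, and the time spent. -/
structure BuildState (U : Type*) where
  node : U → ℕ
  bits : List Bool
  ok : Bool
  time : ℕ

/-- The keys of `S` that arrive at node `i` of the current level. -/
def bucket (S : Finset U) (node : U → ℕ) (i : ℕ) : Finset U := S.filter (fun x => node x = i)

/-- Does the splitting hash function with seed `s` split the keys arriving at node `i` of level `l`
perfectly in half? -/
def splits (S : Finset U) (H : HashIndex U → Bool) (a l : ℕ) (node : U → ℕ) (i s : ℕ) : Bool :=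
  decide (2 * ((bucket S node i).filter (fun x => H (a, l, i, s, x) = true)).card
    = (bucket S node i).card)

/-- The CONSENSUS run for level `l`. Family `i + 1` belongs to node `i`, and testing one seed there
takes one hash evaluation for each key at that node. -/
noncomputable def levelRun (d κ lim : ℕ) (ε : ℝ) (S : Finset U) (H : HashIndex U → Bool)
    (a l : ℕ) (node : U → ℕ) : State :=
  consensus (2 ^ l) (κ * d) (2 ^ (lim * d)) (fragLen d ε l)
    (fun i s => splits S H a l node (i - 1) s) (fun i => (bucket S node (i - 1)).card)

/-- The `a`-th construction attempt after `l` levels. The word size is `κ * d` and each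
CONSENSUS run is aborted after `2 ^ (lim * d)` steps. Charged are, besides the CONSENSUS runs, one
unit per key for the initialisation, one unit per node of each level for computing the fragment
lengths, and for each completed level two units per key for hashing it and moving it to its child
node and one unit per bit of output. -/
noncomputable def build (d κ lim : ℕ) (ε : ℝ) (S : Finset U) (H : HashIndex U → Bool) (a : ℕ) :
    ℕ → BuildState U
  | 0 => { node := fun _ => 0, bits := [], ok := true, time := S.card + 1 }
  | l + 1 =>
    let b := build d κ lim ε S H a l
    if b.ok = true then
      let r := levelRun d κ lim ε S H a l b.node
      match r.status with
      | .success =>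
        let M := encode (2 ^ l) (κ * d) (fragLen d ε l) r.σ
        { node := fun x =>
            2 * b.node x
              + (H (a, l, b.node x, seed (κ * d) (fragLen d ε l) r.σ (b.node x + 1), x)).toNat
          bits := b.bits ++ M
          ok := true
          time := b.time + 2 ^ l + r.time + 2 * S.card + M.length }
      | _ => { b with ok := false, time := b.time + 2 ^ l + r.time }
    else b

/-- The `a`-th construction attempt, which uses its own hash functions. -/
noncomputable def attempt (d κ lim : ℕ) (ε : ℝ) (S : Finset U) (H : HashIndex U → Bool) (a : ℕ) :
    BuildState U :=
  build d κ lim ε S H a d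

/-- The number of failed attempts before the first successful one. -/
noncomputable def restarts (d κ lim : ℕ) (ε : ℝ) (S : Finset U) (H : HashIndex U → Bool) : ℕ :=
  sInf {a | (attempt d κ lim ε S H a).ok = true}

/-- The data structure: a bitstring consisting of the number of restarts in unary and the
bitstrings of all levels from top to bottom. -/
noncomputable def dataStructure (d κ lim : ℕ) (ε : ℝ) (S : Finset U) (H : HashIndex U → Bool) :
    List Bool :=
  let a := restarts d κ lim ε S H
  List.replicate a true ++ false :: (attempt d κ lim ε S H a).bits

open Classical in
/-- The total time of all attempts up to and including the first successful one (infinite if there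
is none). -/
noncomputable def constructionTime (d κ lim : ℕ) (ε : ℝ) (S : Finset U) (H : HashIndex U → Bool) :
    ENNReal :=
  ∑' a : ℕ, if ∀ b < a, (attempt d κ lim ε S H b).ok = false
    then ((attempt d κ lim ε S H a).time : ENNReal) else 0

/-- State of a query after some levels: where in the bitstring the part for the next level starts,
the node reached, and the time spent. -/
structure QueryState where
  pos : ℕ
  node : ℕ
  time : ℕ

/-- The query algorithm after `l` levels, given the bitstring `D` and the key `x`. Decoding the
unary number `a` takes `a + 1` units. Each level takes five: computing the offset of the seed,
reading a `κ * d`-bit word there, hashing the key, moving to the child node, and computing where the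
next level starts. -/
noncomputable def queryState (d κ : ℕ) (ε : ℝ) (H : HashIndex U → Bool) (D : List Bool) (x : U) :
    ℕ → QueryState
  | 0 =>
    let a := (D.takeWhile id).length
    { pos := a + 1, node := 0, time := a + 1 }
  | l + 1 =>
    let a := (D.takeWhile id).length
    let q := queryState d κ ε H D x l
    let s := ofBits ((D.drop (q.pos + prefixLen d ε l (q.node + 1))).take (κ * d))
    { pos := q.pos + (κ * d + prefixLen d ε l (2 ^ l))
      node := 2 * q.node + (H (a, l, q.node, s, x)).toNat
      time := q.time + 5 }

/-- The value returned by the query: the index of the leaf that is reached. -/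
noncomputable def query (d κ : ℕ) (ε : ℝ) (H : HashIndex U → Bool) (D : List Bool) (x : U) : ℕ :=
  (queryState d κ ε H D x d).node

/-- The time taken by the query. -/
noncomputable def queryTime (d κ : ℕ) (ε : ℝ) (H : HashIndex U → Bool) (D : List Bool) (x : U) :
    ℕ :=
  (queryState d κ ε H D x d).time

/-! ## The space lower bound for minimal perfect hash functions -/

/-- The information-theoretic optimum: the binary logarithm of the least number of functions
`U → [n]` such that every `n`-subset of the universe `U` is mapped bijectively by one of them. -/
noncomputable def optMPHF (U : Type*) (n : ℕ) : ℝ :=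
  Real.logb 2 (sInf {k : ℕ | ∃ F : Set (U → Fin n), F.Finite ∧ F.ncard = k ∧
    ∀ S : Finset U, S.card = n → ∃ f ∈ F, Set.InjOn f (S : Set U)} : ℕ)

/-- `opt` is an admissible value of the space lower bound: `n log₂ e`, for every universe, or the
information-theoretic optimum, for finite universes with at least `c₀ n ^ 2` keys. -/
def IsOptMPHF (c₀ : ℝ) (U : Type*) (n : ℕ) (opt : ℝ) : Prop :=
  opt = n * Real.logb 2 (Real.exp 1) ∨
    (Finite U ∧ c₀ * (n : ℝ) ^ 2 ≤ (Nat.card U : ℝ) ∧ opt = optMPHF U n)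

end RecSplit

namespace RecSplit

open scoped ENNReal

/-! ## Functions of finitely many independent bits -/

section Bits

variable {ι Ω α : Type*} [MeasurableSpace Ω] {P : Measure Ω} {h : ι → Ω → Bool}

/-! One level. The search traverses a forest in which a node of layer `j` is a choice of `σ 0, …, σ
(j+1)`. A node passes its trial with probability `p` and then has about `2 ^ ε_ℓ / p` children, so
the nodes with successful ancestors form a slightly supercritical branching process, and a node has
a successful leaf below it with probability of order `p * ε_ℓ` (`survival_step`; the ceilings in
`L_i` telescope and cost a factor of at most 2). Depth-first search inspects more than `k` nodes of
a layer only if there is no successful leaf below the first `k` (`dies_of_lt_card_visitTimes`). This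
has probability about `(1 - c * p * ε_ℓ) ^ k`, and the geometric series leaves `O(1 / (p * ε_ℓ))`
expected inspections per layer.

The obstacle is that a seed is only a `w`-bit suffix: nodes that agree modulo `2 ^ w` share a trial,
so the branching process is not truly independent. The analysis follows only the first `K` nodes of
each layer (`evolve`), with `K` polynomial in `n`. The cap costs a negligible extinction probability
(`prob_dies_le`), and the surviving nodes have distinct trials except with negligible probability
(`prob_collision_le`): if two nodes collide, the recent ancestors of the right one have all
succeeded, and these successes have no influence on the left one, so each candidate pair costs a
factor `p ^ s`. `stepBound` combines these events into a pointwise bound on the number of steps. It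
is also at least the step limit whenever the search does not succeed (`limit_le_stepBound`), so a
single expectation bound controls both the time and, by Markov's inequality, the failure
probability.

All levels. A successful seed halves its bucket exactly, so bucket sizes are deterministic. With the
bits of earlier levels frozen (`lintegral_freeze`), the trials of a level are independent with the
required probability. With `m` keys per node, `1 / p = O(√m)`, and the exponent `3/4` in `ε_ℓ` lies
strictly between `1/2` and `1`: above `1/2` makes the time contributions `n * m ^ (1/2 - 3/4) / ε`
summable to `O(n / ε)`, below `1` makes the space overheads `ε * n * m ^ (3/4 - 1)` summable to `O(ε
* n)`. The cases `ε_ℓ = 1` contribute `n * √m`, which sums to `O(n ^ (3/2))`. Attempts read disjoint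
hash bits, so restarts are dominated by a geometric variable.

Space. The terms `2 ^ l * log₂ (1 / p)` telescope to `log₂ (n ^ n / n!)` (`sum_seedInfo`); the words
`σ 0` and the roundings add `O(log² n)`. This is at most `n * log₂ e`. It is within a constant of
the information-theoretic optimum, because a function `U → [n]` is injective on at most `(|U| / n) ^
n` of the `n`-subsets (`perfectHashBits_le_opt`). -/

lemma exists_factor_of_dependsOn {Q : (ι → Bool) → α} {I : Finset ι}
    (hQ : DependsOn Q (I : Set ι)) :
    ∃ Q' : (I → Bool) → α, ∀ β : ι → Bool, Q β = Q' (fun i => β i) := by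
  classical
  refine ⟨fun g => Q (fun k => if hk : k ∈ I then g ⟨k, hk⟩ else false), fun β => hQ ?_⟩
  intro k hk
  have : k ∈ I := by simpa using hk
  simp [this]

lemma measurable_of_dependsOn [MeasurableSpace α] (hm : ∀ k, Measurable (h k))
    {Q : (ι → Bool) → α} {I : Finset ι} (hQ : DependsOn Q (I : Set ι)) :
    Measurable (fun ω => Q (fun k => h k ω)) := by
  obtain ⟨Q', hQ'⟩ := exists_factor_of_dependsOn hQ
  simp_rw [hQ']
  exact (Measurable.of_discrete (f := Q')).comp
    (measurable_pi_lambda _ fun i => hm i)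

lemma measurableSet_of_dependsOn (hm : ∀ k, Measurable (h k))
    {E : (ι → Bool) → Prop} {I : Finset ι} (hE : DependsOn E (I : Set ι)) :
    MeasurableSet {ω | E (fun k => h k ω)} :=
  measurableSet_setOfPred.2 (measurable_of_dependsOn hm hE)

lemma indepFun_of_dependsOn {γ : Type*} [MeasurableSpace α] [MeasurableSpace γ]
    (hm : ∀ k, Measurable (h k)) (hi : iIndepFun h P)
    {Q : (ι → Bool) → α} {R : (ι → Bool) → γ} {I J : Finset ι}
    (hQ : DependsOn Q (I : Set ι)) (hR : DependsOn R (J : Set ι)) (hIJ : Disjoint I J) :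
    IndepFun (fun ω => Q (fun k => h k ω)) (fun ω => R (fun k => h k ω)) P := by
  obtain ⟨Q', hQ'⟩ := exists_factor_of_dependsOn hQ
  obtain ⟨R', hR'⟩ := exists_factor_of_dependsOn hR
  simp_rw [hQ', hR']
  exact (hi.indepFun_finset I J hIJ hm).comp (Measurable.of_discrete (f := Q'))
    (Measurable.of_discrete (f := R'))

/-- If `Z` and `f z` are functions of disjoint sets of independent bits, then expectations of
`f Z` can be bounded by first bounding the expectation of `f z` for fixed `z`. -/
lemma lintegral_freeze [Countable α] (hm : ∀ k, Measurable (h k)) (hi : iIndepFun h P)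
    {Z : (ι → Bool) → α} {I : Finset ι} (hZ : DependsOn Z (I : Set ι))
    {f : α → (ι → Bool) → ℝ≥0∞} {J : α → Finset ι}
    (hf : ∀ z, DependsOn (f z) (J z : Set ι)) (hIJ : ∀ z, Disjoint I (J z))
    {g : α → ℝ≥0∞} (hg : ∀ z, ∫⁻ ω, f z (fun k => h k ω) ∂P ≤ g z) :
    ∫⁻ ω, f (Z (fun k => h k ω)) (fun k => h k ω) ∂P
      ≤ ∫⁻ ω, g (Z (fun k => h k ω)) ∂P := by
  classical
  let _ : MeasurableSpace α := ⊤
  have hdecomp : ∀ F : α → ℝ≥0∞, ∀ z₀ : α, F z₀ = ∑' z, (if z₀ = z then 1 else 0) * F z := by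
    intro F z₀
    rw [tsum_eq_single z₀ (by intro b hb; simp [hb.symm])]
    simp
  have hZm : Measurable (fun ω => Z (fun k => h k ω)) := measurable_of_dependsOn hm hZ
  have hind : ∀ z, Measurable (fun ω => if Z (fun k => h k ω) = z then (1 : ℝ≥0∞) else 0) := by
    intro z
    exact (Measurable.of_discrete (f := fun y : α => if y = z then (1 : ℝ≥0∞) else 0)).comp hZm
  -- Splitting by the countably many values of `Z` turns both integrands into sums of products; in
  -- the first, the two factors of each product read disjoint sets of bits.
  have e1 : ∀ ω, f (Z (fun k => h k ω)) (fun k => h k ω)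
      = ∑' z, (if Z (fun k => h k ω) = z then 1 else 0) * f z (fun k => h k ω) := fun ω =>
    hdecomp (fun z => f z (fun k => h k ω)) _
  have e2 : ∀ ω, g (Z (fun k => h k ω))
      = ∑' z, (if Z (fun k => h k ω) = z then 1 else 0) * g z := fun ω => hdecomp g _
  simp_rw [e1, e2]
  rw [lintegral_tsum, lintegral_tsum]
  · refine ENNReal.tsum_le_tsum fun z => ?_
    rw [lintegral_mul_const _ (hind z)]
    have hi' : IndepFun (fun ω => if Z (fun k => h k ω) = z then (1 : ℝ≥0∞) else 0)
        (fun ω => f z (fun k => h k ω)) P :=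
      indepFun_of_dependsOn hm hi (Q := fun β => if Z β = z then (1 : ℝ≥0∞) else 0)
        (fun x y hxy => by simp only [hZ hxy]) (hf z) (hIJ z)
    rw [lintegral_mul_eq_lintegral_mul_lintegral_of_indepFun'' (hind z).aemeasurable
      (measurable_of_dependsOn hm (hf z)).aemeasurable hi']
    gcongr
    exact hg z
  · exact fun z => ((hind z).mul_const _).aemeasurable
  · exact fun z => ((hind z).mul (measurable_of_dependsOn hm (hf z))).aemeasurable

/-- The version of `lintegral_freeze` for events. -/
lemma prob_freeze [Countable α] (hm : ∀ k, Measurable (h k)) (hi : iIndepFun h P)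
    {Z : (ι → Bool) → α} {I : Finset ι} (hZ : DependsOn Z (I : Set ι))
    {E : α → (ι → Bool) → Prop} {J : α → Finset ι}
    (hE : ∀ z, DependsOn (E z) (J z : Set ι)) (hIJ : ∀ z, Disjoint I (J z))
    {g : α → ℝ≥0∞} (hg : ∀ z, P {ω | E z (fun k => h k ω)} ≤ g z) :
    P {ω | E (Z (fun k => h k ω)) (fun k => h k ω)} ≤ ∫⁻ ω, g (Z (fun k => h k ω)) ∂P := by
  classical
  have hmE : ∀ z, MeasurableSet {ω | E z (fun k => h k ω)} := fun z =>
    measurableSet_of_dependsOn hm (hE z)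
  have hmZ : ∀ z, MeasurableSet {ω | Z (fun k => h k ω) = z} := fun z =>
    measurableSet_of_dependsOn hm (E := fun β => Z β = z) (I := I) (fun x y hxy => by simp only [hZ hxy])
  have hms : MeasurableSet {ω | E (Z (fun k => h k ω)) (fun k => h k ω)} := by
    have : {ω | E (Z (fun k => h k ω)) (fun k => h k ω)} =
        ⋃ z, {ω | Z (fun k => h k ω) = z} ∩ {ω | E z (fun k => h k ω)} := by
      ext ω; simp
    rw [this]
    exact MeasurableSet.iUnion fun z => (hmZ z).inter (hmE z)
  rw [← lintegral_indicator_one hms]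
  refine (le_of_eq ?_).trans (lintegral_freeze hm hi hZ
    (f := fun z β => if E z β then 1 else 0) (J := J)
    (fun z x y hxy => by simp only [hE z hxy]) hIJ (g := g) fun z => ?_)
  · congr 1 with ω
  · refine (le_of_eq ?_).trans (hg z)
    rw [← lintegral_indicator_one (hmE z)]
    congr 1 with ω

lemma prob_all_true (hi : iIndepFun h P) {p : ℝ≥0∞} (D : Finset ι)
    (hp : ∀ k ∈ D, P {ω | h k ω = true} = p) :
    P {ω | ∀ k ∈ D, h k ω = true} = p ^ D.card := by
  have := hi.meas_biInter (S := D) (s := fun k => {ω | h k ω = true})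
    (fun k _ => ⟨{true}, trivial, by ext; simp⟩)
  rw [Finset.prod_congr rfl hp, Finset.prod_const] at this
  rw [← this]
  congr 1
  ext; simp

/-- If the event `E` forces all bits in `D` to be `true`, and `G` holds whenever `E` does after a
change of the bits in `D`, then `E` is by a factor `p ^ |D|` less likely than `G`. -/
lemma prob_le_pow_mul (hm : ∀ k, Measurable (h k)) (hi : iIndepFun h P) {p : ℝ≥0∞}
    {E G : (ι → Bool) → Prop} {I : Finset ι} (hE : DependsOn E (I : Set ι)) (D : Finset ι)
    (hp : ∀ k ∈ D, P {ω | h k ω = true} = p)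
    (hD : ∀ β, E β → ∀ k ∈ D, β k = true)
    (hG : ∀ β β', E β → (∀ k ∉ D, β k = β' k) → G β') :
    P {ω | E (fun k => h k ω)} ≤ p ^ D.card * P {ω | G (fun k => h k ω)} := by
  classical
  -- Reading the bits of `D` as `true` makes `E'` independent of those bits. `E` entails `E'`
  -- together with all of `D` being `true`, and `E'` entails `G` by `hG`.
  set E' : (ι → Bool) → Prop := fun β => E (fun k => if k ∈ D then true else β k) with hE'
  have hE'd : DependsOn E' ((I \ D : Finset ι) : Set ι) := by
    intro x y hxy
    apply hE
    intro k hk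
    by_cases hkD : k ∈ D
    · simp [hkD]
    · simp only [hkD, if_false]
      exact hxy k (by simpa [hkD] using hk)
  have hDd : DependsOn (fun β : ι → Bool => ∀ k ∈ D, β k = true) (D : Set ι) := by
    intro x y hxy
    simp only [eq_iff_iff]
    exact forall₂_congr fun k hk => by rw [hxy k (by simpa using hk)]
  have hind := indepFun_of_dependsOn hm hi hDd hE'd (Finset.disjoint_sdiff)
  have hsub : {ω | E (fun k => h k ω)} ⊆
      {ω | ∀ k ∈ D, h k ω = true} ∩ {ω | E' (fun k => h k ω)} := by
    intro ω hω
    refine ⟨fun k hk => hD _ hω k hk, ?_⟩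
    have : (fun k => if k ∈ D then true else h k ω) = fun k => h k ω := by
      funext k
      split_ifs with hk
      · exact (hD _ hω k hk).symm
      · rfl
    show E (fun k => if k ∈ D then true else h k ω)
    rw [this]
    exact hω
  calc P {ω | E (fun k => h k ω)}
      ≤ P ({ω | ∀ k ∈ D, h k ω = true} ∩ {ω | E' (fun k => h k ω)}) := measure_mono hsub
    _ = P {ω | ∀ k ∈ D, h k ω = true} * P {ω | E' (fun k => h k ω)} := by
        have := hind.measure_inter_preimage_eq_mul {True} {True} trivial trivial
        simpa [Set.preimage, Set.ofPred_and] using this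
    _ ≤ p ^ D.card * P {ω | G (fun k => h k ω)} := by
        rw [prob_all_true hi D hp]
        gcongr
        intro hω
        exact hG _ _ hω (fun k hk => by simp [hk])

/-- Functions of pairwise disjoint finite blocks of independent bits are independent. -/
lemma iIndepFun_blocks {κ : Type*} [IsProbabilityMeasure P] (hm : ∀ k, Measurable (h k))
    (hi : iIndepFun h P)
    {Q : κ → (ι → Bool) → Bool} {J : κ → Finset ι}
    (hQ : ∀ k, DependsOn (Q k) (J k : Set ι))
    (hJ : ∀ k k', k ≠ k' → Disjoint (J k) (J k')) :
    iIndepFun (fun k ω => Q k (fun i => h i ω)) P := by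
  classical
  rw [iIndepFun_iff_measure_inter_preimage_eq_mul]
  intro S sets _
  induction S using Finset.induction_on with
  | empty => simp
  | insert a S ha ih =>
    rw [Finset.prod_insert ha, ← ih (by simp), Finset.set_biInter_insert]
    have hR : DependsOn (fun β : ι → Bool => ∀ k ∈ S, Q k β ∈ sets k)
        ((S.biUnion J : Finset ι) : Set ι) := by
      intro x y hxy
      simp only [eq_iff_iff]
      refine forall₂_congr fun k hk => ?_
      rw [hQ k (x := x) (y := y)]
      intro i hi
      exact hxy i (by simp only [Finset.coe_biUnion, Set.mem_iUnion]; exact ⟨k, hk, hi⟩)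
    have hd : Disjoint (J a) (S.biUnion J) := by
      rw [Finset.disjoint_biUnion_right]
      intro k hk
      exact hJ a k (by rintro rfl; exact ha hk)
    have := (indepFun_of_dependsOn hm hi (hQ a) hR hd).measure_inter_preimage_eq_mul
      (sets a) {True} trivial trivial
    convert! this using 3
    · ext ω; simp
    · ext ω; simp

end Bits

/-! ## Layers of the search tree

Nodes of a layer are natural numbers; node `x` of layer `j` has the children
`x * 2 ^ e j, …, (x + 1) * 2 ^ e j - 1` in layer `j + 1`, and its trial is the bit `β (j, x % M)`. -/

section Layers

variable (M K : ℕ) (e : ℕ → ℕ)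

/-- The nodes in `X` with a successful trial. -/
def good (β : ℕ × ℕ → Bool) (j : ℕ) (X : Finset ℕ) : Finset ℕ :=
  X.filter (fun x => β (j, x % M) = true)

/-- The nodes with a parent in `X`. -/
def children (a : ℕ) (X : Finset ℕ) : Finset ℕ :=
  X.biUnion (fun x => (Finset.range (2 ^ a)).image (fun y => x * 2 ^ a + y))

/-- The `k` smallest elements of `X`. -/
def smallest (k : ℕ) (X : Finset ℕ) : Finset ℕ :=
  X.filter (fun x => (X.filter (· < x)).card < k)

/-- The first `K` children of successful nodes in `X`. -/
def nextLayer (β : ℕ × ℕ → Bool) (j : ℕ) (X : Finset ℕ) : Finset ℕ :=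
  smallest K (children (e j) (good M β j X))

/-- The nodes in layer `i + r` reached from the set `Y` of nodes in layer `i`. -/
def evolve (β : ℕ × ℕ → Bool) (i : ℕ) (Y : Finset ℕ) : ℕ → Finset ℕ
  | 0 => Y
  | r + 1 => nextLayer M K e β (i + r) (evolve β i Y r)

/-- No two nodes in `X` share a trial. -/
def Distinct (X : Finset ℕ) : Prop := Set.InjOn (· % M) (X : Set ℕ)

/-- All ancestors of the node `x` of layer `j` are successful. -/
def Alive (β : ℕ × ℕ → Bool) : ℕ → ℕ → Prop
  | 0, _ => True
  | j + 1, x => Alive β j (x / 2 ^ e j) ∧ β (j, x / 2 ^ e j % M) = true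

/-- The exponent of the number of descendants that a node in layer `i` has in layer `i + r`. -/
def depth (i r : ℕ) : ℕ := ∑ t ∈ Finset.range r, e (i + t)

variable {M K e}

lemma mem_good {β : ℕ × ℕ → Bool} {j x : ℕ} {X : Finset ℕ} :
    x ∈ good M β j X ↔ x ∈ X ∧ β (j, x % M) = true := Finset.mem_filter

lemma mem_children {a y : ℕ} {X : Finset ℕ} : y ∈ children a X ↔ y / 2 ^ a ∈ X := by
  simp only [children, Finset.mem_biUnion, Finset.mem_image, Finset.mem_range]
  constructor
  · rintro ⟨x, hx, z, hz, rfl⟩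
    rwa [mul_comm, Nat.mul_add_div (by positivity), Nat.div_eq_of_lt hz, add_zero]
  · intro h
    exact ⟨_, h, y % 2 ^ a, Nat.mod_lt _ (by positivity), Nat.div_add_mod' y (2 ^ a)⟩

lemma card_children {a : ℕ} {X : Finset ℕ} : (children a X).card = 2 ^ a * X.card := by
  rw [children, Finset.card_biUnion]
  · rw [Finset.sum_congr rfl (g := fun _ => 2 ^ a), Finset.sum_const, smul_eq_mul, mul_comm]
    intro x _
    rw [Finset.card_image_of_injective _ (add_right_injective _), Finset.card_range]
  · intro x _ y _ hxy
    rw [Function.onFun, Finset.disjoint_left]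
    intro z hz hz'
    simp only [Finset.mem_image, Finset.mem_range] at hz hz'
    obtain ⟨u, hu, rfl⟩ := hz
    obtain ⟨v, hv, h⟩ := hz'
    apply hxy
    have h1 : (x * 2 ^ a + u) / 2 ^ a = x := by
      rw [mul_comm, Nat.mul_add_div (by positivity), Nat.div_eq_of_lt hu, add_zero]
    have h2 : (y * 2 ^ a + v) / 2 ^ a = y := by
      rw [mul_comm, Nat.mul_add_div (by positivity), Nat.div_eq_of_lt hv, add_zero]
    rw [← h1, ← h2, h]

lemma smallest_subset {k : ℕ} {X : Finset ℕ} : smallest k X ⊆ X := Finset.filter_subset _ _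

lemma mem_smallest {k x : ℕ} {X : Finset ℕ} :
    x ∈ smallest k X ↔ x ∈ X ∧ (X.filter (· < x)).card < k := Finset.mem_filter

lemma mem_smallest_of_le {k x y : ℕ} {X : Finset ℕ} (hx : x ∈ X) (hy : y ∈ smallest k X)
    (h : x ≤ y) : x ∈ smallest k X := by
  rw [mem_smallest] at hy ⊢
  refine ⟨hx, lt_of_le_of_lt (Finset.card_le_card ?_) hy.2⟩
  intro z
  simp only [Finset.mem_filter]
  exact fun hz => ⟨hz.1, hz.2.trans_le h⟩

lemma card_smallest {k : ℕ} {X : Finset ℕ} : (smallest k X).card = min k X.card := by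
  induction X using Finset.induction_on_max with
  | empty => simp [smallest]
  | insert a X ha ih =>
    have haX : a ∉ X := fun h => lt_irrefl _ (ha a h)
    have h1 : ∀ x ∈ X, ((insert a X).filter (· < x)).card = (X.filter (· < x)).card := by
      intro x hx
      rw [Finset.filter_insert, if_neg (not_lt.2 (ha x hx).le)]
    have h2 : (insert a X).filter (· < a) = X := by
      rw [Finset.filter_insert, if_neg (lt_irrefl a), Finset.filter_true_of_mem ha]
    have h3 : X.filter (fun x => ((insert a X).filter (· < x)).card < k) = smallest k X :=
      Finset.filter_congr fun x hx => by rw [h1 x hx]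
    rw [smallest, Finset.filter_insert, h2, h3, Finset.card_insert_of_notMem haX]
    split_ifs with h
    · rw [Finset.card_insert_of_notMem (fun h' => haX (smallest_subset h')), ih]
      omega
    · rw [ih]; omega

lemma card_smallest_le {k : ℕ} {X : Finset ℕ} : (smallest k X).card ≤ k := by
  rw [card_smallest]; exact min_le_left _ _

/-- Whether `x` is among the `k` smallest elements depends only on the elements below `b > x`. -/
lemma mem_smallest_congr {k x b : ℕ} {X X' : Finset ℕ} (hxb : x < b)
    (h : ∀ y < b, y ∈ X ↔ y ∈ X') : x ∈ smallest k X ↔ x ∈ smallest k X' := by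
  rw [mem_smallest, mem_smallest, h x hxb]
  have : X.filter (· < x) = X'.filter (· < x) := by
    ext y
    simp only [Finset.mem_filter]
    constructor
    · exact fun hy => ⟨(h y (hy.2.trans hxb)).1 hy.1, hy.2⟩
    · exact fun hy => ⟨(h y (hy.2.trans hxb)).2 hy.1, hy.2⟩
  rw [this]

lemma mem_nextLayer {β : ℕ × ℕ → Bool} {j x : ℕ} {X : Finset ℕ}
    (h : x ∈ nextLayer M K e β j X) :
    x / 2 ^ e j ∈ X ∧ β (j, x / 2 ^ e j % M) = true :=
  mem_good.1 (mem_children.1 (smallest_subset h))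

lemma evolve_succ' (β : ℕ × ℕ → Bool) (i : ℕ) (Y : Finset ℕ) (r : ℕ) :
    evolve M K e β i Y (r + 1) = evolve M K e β (i + 1) (nextLayer M K e β i Y) r := by
  induction r with
  | zero => rfl
  | succ r ih =>
    rw [evolve, ih, evolve]
    congr 1
    omega

lemma evolve_add (β : ℕ × ℕ → Bool) (i : ℕ) (Y : Finset ℕ) (r s : ℕ) :
    evolve M K e β i Y (r + s) = evolve M K e β (i + r) (evolve M K e β i Y r) s := by
  induction s with
  | zero => rfl
  | succ s ih => rw [← add_assoc, evolve, ih, evolve, add_assoc]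

lemma card_evolve_le (β : ℕ × ℕ → Bool) (i : ℕ) {Y : Finset ℕ} (hY : Y.card ≤ K) (r : ℕ) :
    (evolve M K e β i Y r).card ≤ K := by
  cases r with
  | zero => exact hY
  | succ r => exact card_smallest_le

lemma depth_succ (i r : ℕ) : depth e i (r + 1) = depth e i r + e (i + r) :=
  Finset.sum_range_succ _ _

lemma depth_add (i r s : ℕ) : depth e i (r + s) = depth e i r + depth e (i + r) s := by
  simp [depth, Finset.sum_range_add, add_assoc]

lemma div_pow_div_pow (z a b : ℕ) : z / 2 ^ a / 2 ^ b = z / 2 ^ (b + a) := by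
  rw [Nat.div_div_eq_div_mul, ← pow_add, add_comm]

/-- Ancestors of nodes reached by `evolve` are reached and successful. -/
lemma evolve_ancestor {β : ℕ × ℕ → Bool} {i : ℕ} {Y : Finset ℕ} {s x : ℕ} (r : ℕ)
    (hx : x ∈ evolve M K e β i Y (r + s)) :
    x / 2 ^ depth e (i + r) s ∈ evolve M K e β i Y r := by
  induction s generalizing x with
  | zero => simpa [depth] using hx
  | succ s ih =>
    have := ih (mem_nextLayer (j := i + (r + s)) hx).1
    rwa [div_pow_div_pow, ← add_assoc, ← depth_succ] at this

lemma evolve_ancestor_good {β : ℕ × ℕ → Bool} {i : ℕ} {Y : Finset ℕ} {s x : ℕ} (r : ℕ)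
    (hx : x ∈ evolve M K e β i Y (r + s)) (hs : 0 < s) :
    β (i + r, x / 2 ^ depth e (i + r) s % M) = true := by
  obtain ⟨s, rfl⟩ : ∃ t, s = t + 1 := ⟨s - 1, by omega⟩
  rw [show r + (s + 1) = (r + 1) + s by ring] at hx
  have h := (mem_nextLayer (evolve_ancestor (r + 1) hx)).2
  rw [div_pow_div_pow] at h
  convert! h using 5
  rw [show s + 1 = 1 + s by ring, depth_add]
  simp [depth, add_assoc]

lemma alive_of_mem_evolve {β : ℕ × ℕ → Bool} {i : ℕ} {Y : Finset ℕ}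
    (hY : ∀ x ∈ Y, Alive M e β i x) {r x : ℕ} (hx : x ∈ evolve M K e β i Y r) :
    Alive M e β (i + r) x := by
  induction r generalizing x with
  | zero => exact hY x hx
  | succ r ih => exact ⟨ih (mem_nextLayer hx).1, (mem_nextLayer hx).2⟩

/-- The nodes reached form an initial segment of the nodes all of whose ancestors are
successful. -/
lemma mem_evolve_of_le {β : ℕ × ℕ → Bool} {j x u : ℕ}
    (hu : u ∈ evolve M K e β 0 (Finset.range K) j) (hx : Alive M e β j x) (hxu : x ≤ u) :
    x ∈ evolve M K e β 0 (Finset.range K) j := by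
  induction j generalizing x u with
  | zero =>
    rw [evolve, Finset.mem_range] at hu ⊢
    omega
  | succ j ih =>
    have h1 : x / 2 ^ e j ∈ evolve M K e β 0 (Finset.range K) j := by
      refine ih (by simpa using (mem_nextLayer hu).1) hx.1 ?_
      simpa using Nat.div_le_div_right hxu
    refine mem_smallest_of_le ?_ hu hxu
    rw [mem_children, mem_good]
    simpa using ⟨h1, hx.2⟩

/-- Restricting the start to an initial segment keeps every later layer an initial segment: taking
children preserves the order, and membership among the `K` smallest depends only on what lies to the
left. This transfers distinctness of trials from the full process to the one started with the first
`k` nodes. -/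
lemma evolve_mono_smallest {β : ℕ × ℕ → Bool} {i : ℕ} {Y Y' : Finset ℕ} (hYY : Y' ⊆ Y)
    (hseg : ∀ x ∈ Y, ∀ y ∈ Y', x ≤ y → x ∈ Y') (r : ℕ) :
    evolve M K e β i Y' r ⊆ evolve M K e β i Y r ∧
      ∀ x ∈ evolve M K e β i Y r, ∀ y ∈ evolve M K e β i Y' r, x ≤ y →
        x ∈ evolve M K e β i Y' r := by
  induction r with
  | zero => exact ⟨hYY, hseg⟩
  | succ r ih =>
    obtain ⟨ih1, ih2⟩ := ih
    have key : ∀ y ∈ children (e (i + r)) (good M β (i + r) (evolve M K e β i Y' r)),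
        ∀ x ≤ y, x ∈ children (e (i + r)) (good M β (i + r) (evolve M K e β i Y r)) →
          x ∈ children (e (i + r)) (good M β (i + r) (evolve M K e β i Y' r)) := by
      intro y hy x hxy hx
      rw [mem_children, mem_good] at hx hy ⊢
      exact ⟨ih2 _ hx.1 _ hy.1 (Nat.div_le_div_right hxy), hx.2⟩
    have hsub : children (e (i + r)) (good M β (i + r) (evolve M K e β i Y' r)) ⊆
        children (e (i + r)) (good M β (i + r) (evolve M K e β i Y r)) := by
      intro y hy
      rw [mem_children, mem_good] at hy ⊢
      exact ⟨ih1 hy.1, hy.2⟩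
    refine ⟨fun x hx => ?_, fun x hx y hy hxy => ?_⟩
    · simp only [evolve, nextLayer] at hx ⊢
      have hx' := smallest_subset hx
      refine (mem_smallest_congr (Nat.lt_succ_self x) (fun y hy => ⟨fun h => hsub h, fun h => ?_⟩)).1
        hx
      exact key x hx' y (by omega) h
    · simp only [evolve, nextLayer] at hx hy ⊢
      exact mem_smallest_of_le (key y (smallest_subset hy) x hxy (smallest_subset hx)) hy hxy

/-! ### Dependence on the trials -/

/-- The trials of the layers `i, …, i + r - 1`. -/
def trials (M i r : ℕ) : Finset (ℕ × ℕ) := (Finset.Ico i (i + r)) ×ˢ (Finset.range M)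

lemma mem_trials {M i r : ℕ} {k : ℕ × ℕ} :
    k ∈ trials M i r ↔ (i ≤ k.1 ∧ k.1 < i + r) ∧ k.2 < M := by
  simp [trials]

lemma good_congr (hM : 0 < M) {β β' : ℕ × ℕ → Bool} {j : ℕ} (X : Finset ℕ)
    (h : ∀ s < M, β (j, s) = β' (j, s)) : good M β j X = good M β' j X :=
  Finset.filter_congr fun x _ => by rw [h _ (Nat.mod_lt x hM)]

lemma evolve_congr (hM : 0 < M) {β β' : ℕ × ℕ → Bool} {i r : ℕ} (Y : Finset ℕ)
    (h : ∀ k ∈ trials M i r, β k = β' k) : evolve M K e β i Y r = evolve M K e β' i Y r := by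
  induction r with
  | zero => rfl
  | succ r ih =>
    rw [evolve, evolve, ih, nextLayer, nextLayer, good_congr hM]
    · intro s hs
      exact h _ (by simp only [mem_trials]; omega)
    · intro k hk
      refine h k ?_
      simp only [mem_trials] at hk ⊢
      omega

lemma dependsOn_evolve (hM : 0 < M) (i r : ℕ) (Y : Finset ℕ) :
    DependsOn (fun β => evolve M K e β i Y r) (trials M i r : Set (ℕ × ℕ)) :=
  fun _ _ h => evolve_congr hM Y (fun k hk => h k hk)

end Layers

/-! ## Survival of the capped layers -/

section Survival

variable {Ω : Type*} [MeasurableSpace Ω] {P : Measure Ω}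
  {h : ℕ × ℕ → Ω → Bool} {M K N : ℕ} {e : ℕ → ℕ} {p q : ℝ≥0∞}

/-- Distinctness makes the outcomes at the nodes of `Y` independent, so the generating function of
the number of successes factorises. -/
lemma lintegral_pow_card_good (hm : ∀ k, Measurable (h k)) (hi : iIndepFun h P) (hM : 0 < M)
    {j : ℕ} (hp : ∀ s < M, P {ω | h (j, s) ω = true} = p)
    (hq : ∀ s < M, P {ω | h (j, s) ω = false} = q) {Y : Finset ℕ} (hY : Distinct M Y) (z : ℝ≥0∞) :
    ∫⁻ ω, z ^ (good M (fun k => h k ω) j Y).card ∂P = (q + p * z) ^ Y.card := by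
  classical
  have hinj : Set.InjOn (fun x => (j, x % M)) (Y : Set ℕ) := fun x hx y hy hxy =>
    hY hx hy (Prod.mk.inj hxy).2
  have h1 : ∀ ω, z ^ (good M (fun k => h k ω) j Y).card
      = ∏ k ∈ Y.image (fun x => (j, x % M)), if h k ω = true then z else 1 := by
    intro ω
    rw [Finset.prod_image hinj, good, Finset.prod_ite, Finset.prod_const, Finset.prod_const_one,
      mul_one]
  have hφ : Measurable (fun b : Bool => if b = true then z else 1) := Measurable.of_discrete
  simp_rw [h1]
  rw [lintegral_prod_eq_prod_lintegral_of_indepFun _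
    (fun k ω => if h k ω = true then z else 1)
    (hi.comp (fun _ b => if b = true then z else 1) fun _ => hφ) (fun k => hφ.comp (hm k)),
    Finset.prod_image hinj, Finset.prod_congr rfl (g := fun _ => q + p * z), Finset.prod_const]
  intro x _
  have hs : x % M < M := Nat.mod_lt _ hM
  have ht : MeasurableSet {ω | h (j, x % M) ω = true} := hm _ (MeasurableSet.singleton true)
  have hf : MeasurableSet {ω | h (j, x % M) ω = false} := hm _ (MeasurableSet.singleton false)
  have h2 : ∀ ω, (if h (j, x % M) ω = true then z else 1)
      = {ω | h (j, x % M) ω = false}.indicator (fun _ => 1) ω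
        + {ω | h (j, x % M) ω = true}.indicator (fun _ => z) ω := by
    intro ω
    by_cases hb : h (j, x % M) ω = true <;> simp [hb]
  simp_rw [h2]
  rw [lintegral_add_left (measurable_const.indicator hf), lintegral_indicator_const hf,
    lintegral_indicator_const ht, hp _ hs, hq _ hs, one_mul, mul_comm]

variable [IsProbabilityMeasure P]

lemma trials_disjoint {M i r i' r' : ℕ} (h : i + r ≤ i') :
    Disjoint (trials M i r) (trials M i' r') := by
  rw [Finset.disjoint_left]
  intro k hk hk'
  rw [mem_trials] at hk hk'
  omega

lemma dependsOn_dies (hM : 0 < M) (i r : ℕ) (Y : Finset ℕ) :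
    DependsOn (fun β => (∀ t < r, Distinct M (evolve M K e β i Y t)) ∧ evolve M K e β i Y r = ∅)
      (trials M i r : Set (ℕ × ℕ)) := by
  intro β β' hβ
  have : ∀ t ≤ r, evolve M K e β i Y t = evolve M K e β' i Y t := by
    intro t ht
    refine evolve_congr hM Y fun k hk => hβ k ?_
    rw [Finset.mem_coe, mem_trials] at *
    omega
  simp only [this r le_rfl, eq_iff_iff]
  refine and_congr_left fun _ => forall₂_congr fun t ht => ?_
  rw [this t ht.le]

/-- The extinction probability of the process started with the nodes `Y` in layer `i`. -/
lemma prob_dies_le (hm : ∀ k, Measurable (h k)) (hi : iIndepFun h P) (hM : 0 < M)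
    (hp : ∀ j < N, ∀ s < M, P {ω | h (j, s) ω = true} = p)
    (hq : ∀ j < N, ∀ s < M, P {ω | h (j, s) ω = false} = q)
    {z : ℕ → ℝ≥0∞} (hz : ∀ j < N, q + p * z (j + 1) ^ 2 ^ e j ≤ z j)
    {η : ℝ≥0∞} (hη : ∀ j, z j ^ K ≤ η) (r : ℕ) :
    ∀ i, i + r ≤ N → ∀ Y : Finset ℕ,
    P {ω | (∀ t < r, Distinct M (evolve M K e (fun k => h k ω) i Y t)) ∧
      evolve M K e (fun k => h k ω) i Y r = ∅} ≤ z i ^ Y.card + r * η := by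
  induction r with
  | zero =>
    intro i _ Y
    by_cases hY : Y = ∅
    · subst hY
      simpa using prob_le_one
    · simp [evolve, hY]
  | succ r ih =>
    intro i hir Y
    by_cases hY : Distinct M Y
    swap
    -- The event demands distinctness already at time 0, so it is empty here.
    · refine le_trans (le_of_eq ?_) (zero_le (α := ℝ≥0∞))
      convert! measure_empty (μ := P)
      rw [Set.eq_empty_iff_forall_notMem]
      intro ω hω
      exact hY (hω.1 0 (by omega))
    have hZ : DependsOn (fun β => nextLayer M K e β i Y) (trials M i 1 : Set (ℕ × ℕ)) :=
      dependsOn_evolve hM i 1 Y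
    calc P {ω | (∀ t < r + 1, Distinct M (evolve M K e (fun k => h k ω) i Y t)) ∧
          evolve M K e (fun k => h k ω) i Y (r + 1) = ∅}
        ≤ P {ω | (fun X β => (∀ t < r, Distinct M (evolve M K e β (i + 1) X t)) ∧
            evolve M K e β (i + 1) X r = ∅)
              (nextLayer M K e (fun k => h k ω) i Y) (fun k => h k ω)} := by
          refine measure_mono fun ω hω => ?_
          refine ⟨fun t ht => ?_, ?_⟩
          · rw [← evolve_succ']; exact hω.1 _ (by omega)
          · rw [← evolve_succ']; exact hω.2
      _ ≤ ∫⁻ ω, (z (i + 1) ^ (nextLayer M K e (fun k => h k ω) i Y).card + r * η) ∂P :=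
          prob_freeze hm hi hZ (fun X => dependsOn_dies hM (i + 1) r X)
            (fun X => trials_disjoint (by omega))
            (g := fun X => z (i + 1) ^ X.card + r * η) (fun X => ih (i + 1) (by omega) X)
      _ ≤ ∫⁻ ω, ((z (i + 1) ^ 2 ^ e i) ^ (good M (fun k => h k ω) i Y).card + η + r * η) ∂P := by
          refine lintegral_mono fun ω => ?_
          gcongr
          rw [nextLayer, card_smallest, card_children, ← pow_mul]
          -- If the cap takes effect, `K` nodes remain and die out with probability at most `η`,
          -- which is paid once per layer. Otherwise the cap changes nothing and the exponents
          -- multiply.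
          rcases min_cases K (2 ^ e i * (good M (fun k => h k ω) i Y).card) with h' | h'
          · rw [h'.1]; exact (hη _).trans le_add_self
          · rw [h'.1]; exact le_self_add
      _ = (q + p * z (i + 1) ^ 2 ^ e i) ^ Y.card + η + r * η := by
          rw [lintegral_add_right _ measurable_const, lintegral_add_right _ measurable_const,
            lintegral_pow_card_good hm hi hM (hp i (by omega)) (hq i (by omega)) hY]
          simp
      _ ≤ z i ^ Y.card + (r + 1 : ℕ) * η := by
          rw [add_assoc]
          gcongr
          · exact hz i (by omega)
          · push_cast; rw [add_mul, one_mul, add_comm]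

/-- The extinction probability of the process started with the first `k` nodes that are reached in
layer `i`. -/
lemma prob_dies_smallest_le (hm : ∀ k, Measurable (h k)) (hi : iIndepFun h P) (hM : 0 < M)
    (hp : ∀ j < N, ∀ s < M, P {ω | h (j, s) ω = true} = p)
    (hq : ∀ j < N, ∀ s < M, P {ω | h (j, s) ω = false} = q)
    {z : ℕ → ℝ≥0∞} (hz : ∀ j < N, q + p * z (j + 1) ^ 2 ^ e j ≤ z j)
    {η : ℝ≥0∞} (hη : ∀ j, z j ^ K ≤ η) (i r k : ℕ) (hir : i + r ≤ N) (Y₀ : Finset ℕ) :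
    P {ω | k ≤ (evolve M K e (fun k => h k ω) 0 Y₀ i).card ∧
      (∀ t < r, Distinct M (evolve M K e (fun k => h k ω) i
        (smallest k (evolve M K e (fun k => h k ω) 0 Y₀ i)) t)) ∧
      evolve M K e (fun k => h k ω) i
        (smallest k (evolve M K e (fun k => h k ω) 0 Y₀ i)) r = ∅} ≤ z i ^ k + r * η := by
  refine (prob_freeze hm hi (dependsOn_evolve hM 0 i Y₀) (E := fun X β => k ≤ X.card ∧
      (∀ t < r, Distinct M (evolve M K e β i (smallest k X) t)) ∧
        evolve M K e β i (smallest k X) r = ∅) (J := fun _ => trials M i r)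
      (g := fun _ => z i ^ k + r * η) (fun X β β' hβ => ?_)
      (fun X => trials_disjoint (by omega)) fun X => ?_).trans (by simp)
  · have := dependsOn_dies (K := K) (e := e) hM i r (smallest k X) hβ
    simp only [this]
  · by_cases hk : k ≤ X.card
    · have := prob_dies_le (K := K) hm hi hM hp hq hz hη r i hir (smallest k X)
      rw [card_smallest, min_eq_left hk] at this
      refine (measure_mono fun ω hω => ?_).trans this
      exact hω.2
    · simp [hk]

end Survival

/-! ## Collisions -/

section Collisions

variable {Ω : Type*} [MeasurableSpace Ω] {P : Measure Ω}
  {h : ℕ × ℕ → Ω → Bool} {M K N : ℕ} {e : ℕ → ℕ} {p : ℝ≥0∞}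

/-- The trials of the ancestors in the layers `r, …, r + s - 1` of the node `x` of layer
`r + s`. -/
def ancestorTrials (M : ℕ) (e : ℕ → ℕ) (r s x : ℕ) : Finset (ℕ × ℕ) :=
  (Finset.range s).image (fun t => (r + t, x / 2 ^ depth e (r + t) (s - t) % M))

lemma card_ancestorTrials (r s x : ℕ) : (ancestorTrials M e r s x).card = s := by
  rw [ancestorTrials, Finset.card_image_of_injective, Finset.card_range]
  intro a b hab
  simpa using (Prod.mk.inj hab).1

/-- Changing the trials of the ancestors of a node below the node `y` of layer `r` does not
affect what is to the left of `y`. -/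
lemma evolve_left_congr {β β' : ℕ × ℕ → Bool} {Y₀ : Finset ℕ} {r s x y : ℕ} (hM : 0 < M)
    (hd : ∀ t < r + s, Distinct M (evolve M K e β 0 Y₀ t))
    (hx : x ∈ evolve M K e β 0 Y₀ (r + s)) (hy : y * 2 ^ depth e r s ≤ x)
    (hβ : ∀ k ∉ ancestorTrials M e r s x, β k = β' k) (t : ℕ) (ht : t ≤ s) :
    ∀ u < y * 2 ^ depth e r t,
      u ∈ evolve M K e β 0 Y₀ (r + t) ↔ u ∈ evolve M K e β' 0 Y₀ (r + t) := by
  induction t with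
  | zero =>
    intro u _
    rw [add_zero, evolve_congr hM Y₀ (fun k hk => hβ k fun hk' => ?_)]
    simp only [ancestorTrials, Finset.mem_image, mem_trials] at hk hk'
    obtain ⟨t, _, rfl⟩ := hk'
    simp at hk
  | succ t ih =>
    intro u hu
    have ih := ih (by omega)
    refine mem_smallest_congr hu fun v hv => ?_
    rw [mem_children, mem_children, mem_good, mem_good, zero_add]
    simp only [Nat.add_eq]
    have hv' : v / 2 ^ e (r + t) < y * 2 ^ depth e r t := by
      rw [Nat.div_lt_iff_lt_mul (by positivity)]
      rwa [mul_assoc, ← pow_add, ← depth_succ]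
    rw [← ih _ hv']
    refine and_congr_right fun hvX => ?_
    rw [hβ]
    intro hk
    simp only [ancestorTrials, Finset.mem_image, Finset.mem_range, Prod.mk.injEq] at hk
    obtain ⟨t', ht', h1, h2⟩ := hk
    obtain rfl : t' = t := by omega
    have hxt : x / 2 ^ depth e (r + t') (s - t') ∈ evolve M K e β 0 Y₀ (r + t') := by
      have := evolve_ancestor (M := M) (K := K) (e := e) (β := β) (i := 0) (Y := Y₀)
        (s := s - t') (x := x) (r + t') (by rwa [show r + t' + (s - t') = r + s by omega])
      rwa [zero_add] at this
    -- Distinctness enters here: a node sharing its trial with an ancestor of `x` in its layer must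
    -- be that ancestor, but the ancestors of `x` do not lie left of the subtree of `y`.
    have h3 := hd (r + t') (by omega) hxt hvX h2
    rw [← h3, Nat.div_lt_iff_lt_mul (by positivity), mul_assoc, ← pow_add, ← depth_add,
      show t' + (s - t') = s by omega] at hv'
    omega

lemma dependsOn_evolve_upto (hM : 0 < M) (Y₀ : Finset ℕ) (n : ℕ) {α : Type*}
    (F : (ℕ → Finset ℕ) → α) (hF : ∀ X X' : ℕ → Finset ℕ, (∀ t ≤ n, X t = X' t) → F X = F X') :
    DependsOn (fun β => F (evolve M K e β 0 Y₀)) (trials M 0 n : Set (ℕ × ℕ)) := by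
  intro β β' hβ
  refine hF _ _ fun t ht => evolve_congr hM Y₀ fun k hk => hβ k ?_
  rw [Finset.mem_coe, mem_trials] at *
  omega

/-- The probability that layer `r + s` is the first one in which two of the nodes that are reached
share a trial. -/
lemma prob_collision_le [IsProbabilityMeasure P] (hm : ∀ k, Measurable (h k)) (hi : iIndepFun h P)
    (hM : 0 < M) (hp : ∀ j < N, ∀ s < M, P {ω | h (j, s) ω = true} = p) {Y₀ : Finset ℕ}
    (hY₀ : Y₀.card ≤ K) {r s : ℕ} (hN : r + s ≤ N) (hδ : 2 ^ depth e r s ∣ M) :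
    P {ω | (∀ t < r + s, Distinct M (evolve M K e (fun k => h k ω) 0 Y₀ t)) ∧
      ¬ Distinct M (evolve M K e (fun k => h k ω) 0 Y₀ (r + s))} ≤ K ^ 2 * p ^ s := by
  set δ := depth e r s with hδdef
  -- A collision `x' < x` is recorded by the pair `(x', y)`, where `y` is the ancestor of `x` in
  -- layer `r`. Since `2 ^ δ` divides `M`, the last `δ` bits of `x` are those of `x'`, so the pair
  -- determines `x`. Hence the union bound needs only `K ^ 2` pairs, and after `y` and `x'` are
  -- fixed the `s` successes above `x` are still free.
  let glue : ℕ × ℕ → ℕ := fun c => c.2 * 2 ^ δ + c.1 % 2 ^ δ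
  let E : ℕ × ℕ → (ℕ × ℕ → Bool) → Prop := fun c β =>
    (∀ t < r + s, Distinct M (evolve M K e β 0 Y₀ t)) ∧ c.1 ∈ evolve M K e β 0 Y₀ (r + s) ∧
      glue c ∈ evolve M K e β 0 Y₀ (r + s) ∧ c.1 < c.2 * 2 ^ δ
  let G : ℕ × ℕ → (ℕ × ℕ → Bool) → Prop := fun c β =>
    c.1 ∈ evolve M K e β 0 Y₀ (r + s) ∧ c.2 ∈ evolve M K e β 0 Y₀ r
  have hglue : ∀ c, glue c / 2 ^ δ = c.2 := by
    intro c
    simp only [glue]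
    rw [mul_comm, Nat.mul_add_div (by positivity), Nat.div_eq_of_lt (Nat.mod_lt _ (by positivity)),
      add_zero]
  have hEG : ∀ c, P {ω | E c (fun k => h k ω)} ≤ p ^ s * P {ω | G c (fun k => h k ω)} := by
    intro c
    have hEd : DependsOn (E c) (trials M 0 (r + s) : Set (ℕ × ℕ)) :=
      dependsOn_evolve_upto hM Y₀ (r + s) (fun X => (∀ t < r + s, Distinct M (X t)) ∧
        c.1 ∈ X (r + s) ∧ glue c ∈ X (r + s) ∧ c.1 < c.2 * 2 ^ δ) (by
        intro X X' hXX
        rw [hXX _ le_rfl, eq_iff_iff]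
        refine and_congr_left fun _ => forall₂_congr fun t ht => by rw [hXX t ht.le])
    have := prob_le_pow_mul (G := G c) hm hi hEd (ancestorTrials M e r s (glue c)) (p := p)
      ?_ ?_ ?_
    · rwa [card_ancestorTrials] at this
    · intro k hk
      simp only [ancestorTrials, Finset.mem_image, Finset.mem_range] at hk
      obtain ⟨t, ht, rfl⟩ := hk
      exact hp _ (by omega) _ (Nat.mod_lt _ hM)
    · intro β hβ k hk
      simp only [ancestorTrials, Finset.mem_image, Finset.mem_range] at hk
      obtain ⟨t, ht, rfl⟩ := hk
      have := evolve_ancestor_good (M := M) (K := K) (e := e) (β := β) (i := 0) (Y := Y₀)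
        (s := s - t) (x := glue c) (r + t)
        (by rw [show r + t + (s - t) = r + s by omega]; exact hβ.2.2.1) (by omega)
      rwa [zero_add] at this
    · intro β β' hβ hββ
      have hle : c.2 * 2 ^ depth e r s ≤ glue c := Nat.le_add_right _ _
      have hleft := evolve_left_congr hM hβ.1 hβ.2.2.1 hle hββ
      refine ⟨(hleft s le_rfl _ hβ.2.2.2).1 hβ.2.1, ?_⟩
      have hy : c.2 ∈ evolve M K e β 0 Y₀ r := by
        have := evolve_ancestor (s := s) r hβ.2.2.1
        rwa [zero_add, ← hδdef, hglue] at this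
      rwa [evolve_congr hM Y₀ (β' := β') (fun k hk => hββ k fun hk' => ?_)] at hy
      simp only [ancestorTrials, Finset.mem_image, mem_trials] at hk hk'
      obtain ⟨t, _, rfl⟩ := hk'
      simp at hk
  have hsub : {ω | (∀ t < r + s, Distinct M (evolve M K e (fun k => h k ω) 0 Y₀ t)) ∧
      ¬ Distinct M (evolve M K e (fun k => h k ω) 0 Y₀ (r + s))} ⊆
      ⋃ c, {ω | E c (fun k => h k ω)} := by
    rintro ω ⟨h1, h2⟩
    have key : ∀ x x', x' < x → x ∈ evolve M K e (fun k => h k ω) 0 Y₀ (r + s) →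
        x' ∈ evolve M K e (fun k => h k ω) 0 Y₀ (r + s) → x % M = x' % M →
        ω ∈ ⋃ c, {ω | E c (fun k => h k ω)} := by
      intro x x' hlt hx hx' hxx
      have hmod : x' % 2 ^ δ = x % 2 ^ δ := by
        rw [← Nat.mod_mod_of_dvd x hδ, ← Nat.mod_mod_of_dvd x' hδ, hxx]
      have hg : glue (x', x / 2 ^ δ) = x := by
        simp only [glue]
        rw [hmod, Nat.div_add_mod']
      refine Set.mem_iUnion.2 ⟨(x', x / 2 ^ δ), h1, hx', by rw [hg]; exact hx, ?_⟩
      by_contra hcon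
      simp only [not_lt] at hcon
      -- With equal remainders modulo `2 ^ δ`, this would give `x ≤ x'`; so `x'` lies strictly to
      -- the left of the subtree of `y`.
      have h3 : x / 2 ^ δ ≤ x' / 2 ^ δ := (Nat.le_div_iff_mul_le (by positivity)).2 hcon
      have h4 := Nat.div_add_mod' x (2 ^ δ)
      have h5 := Nat.div_add_mod' x' (2 ^ δ)
      have h6 := Nat.mul_le_mul_right (2 ^ δ) h3
      omega
    simp only [Distinct, Set.InjOn, not_forall] at h2
    obtain ⟨x, hx, x', hx', hxx, hne⟩ := h2
    rcases lt_or_gt_of_ne hne with hlt | hlt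
    · exact key x' x hlt hx' hx hxx.symm
    · exact key x x' hlt hx hx' hxx
  have hGm : ∀ c, MeasurableSet {ω | G c (fun k => h k ω)} := fun c =>
    measurableSet_of_dependsOn hm (E := G c) (I := trials M 0 (r + s))
      (dependsOn_evolve_upto hM Y₀ (r + s) (fun X => c.1 ∈ X (r + s) ∧ c.2 ∈ X r) (by
        intro X X' hXX
        rw [hXX _ le_rfl, hXX r (by omega)]))
  calc _ ≤ P (⋃ c, {ω | E c (fun k => h k ω)}) := measure_mono hsub
    _ ≤ ∑' c, P {ω | E c (fun k => h k ω)} := measure_iUnion_le _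
    _ ≤ ∑' c, p ^ s * P {ω | G c (fun k => h k ω)} := ENNReal.tsum_le_tsum hEG
    _ = p ^ s * ∫⁻ ω, ∑' c, {ω | G c (fun k => h k ω)}.indicator 1 ω ∂P := by
        rw [ENNReal.tsum_mul_left, lintegral_tsum]
        · congr 2 with c
          rw [lintegral_indicator_one (hGm c)]
        · exact fun c => (measurable_one.indicator (hGm c)).aemeasurable
    _ ≤ p ^ s * ∫⁻ _, (K : ℝ≥0∞) ^ 2 ∂P := by
        gcongr with ω
        -- For each `ω` the sum counts pairs from two capped layers, hence is at most `K ^ 2`.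
        rw [tsum_eq_sum (s := evolve M K e (fun k => h k ω) 0 Y₀ (r + s) ×ˢ
          evolve M K e (fun k => h k ω) 0 Y₀ r)]
        · refine (Finset.sum_le_card_nsmul _ _ (1 : ℝ≥0∞) fun c _ => ?_).trans ?_
          · exact Set.indicator_le_self' (f := fun _ => (1 : ℝ≥0∞)) (fun _ _ => zero_le) _
          rw [Finset.card_product, nsmul_one, sq]
          have h1 := card_evolve_le (M := M) (e := e) (fun k => h k ω) 0 hY₀ (r + s)
          have h2 := card_evolve_le (M := M) (e := e) (fun k => h k ω) 0 hY₀ r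
          exact_mod_cast Nat.mul_le_mul h1 h2
        · intro c hc
          rw [Set.indicator_of_notMem]
          intro hG
          exact hc (Finset.mem_product.2 hG)
    _ = K ^ 2 * p ^ s := by simp [mul_comm]

end Collisions

/-! ## The depth first search -/

section Search

variable {N w : ℕ} {len : ℕ → ℕ} {B : ℕ → ℕ → Bool} {cost : ℕ → ℕ}

/-- The number of bits that follow the first `i` fragments in a path through `N + 1` layers. -/
def tail (N : ℕ) (len : ℕ → ℕ) (i : ℕ) : ℕ := depth (fun t => len (t + 1)) i (N + 1 - i)

lemma tail_eq {i : ℕ} (hi : i ≤ N) : tail N len i = len (i + 1) + tail N len (i + 1) := by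
  rw [tail, tail, show N + 1 - i = 1 + (N + 1 - (i + 1)) by omega, depth_add]
  simp [depth]

/-- Index translation: layer `i` of the branching process is layer `i + 1` of the search, since its
nodes are the indices of `σ 0, …, σ (i+1)`. Paths are continued by a fictitious fragment of length
`len (N + 1)`, so that layer `N` consists of nodes all of whose `N` trials have succeeded. -/
lemma tail_succ_eq_depth {i : ℕ} :
    tail N len (i + 1) = depth (fun j => len (j + 2)) i (N - i) := by
  rw [tail, depth, depth, show N + 1 - (i + 1) = N - i by omega]
  exact Finset.sum_congr rfl fun t _ => by congr 1; omega

lemma concat_congr {σ σ' : ℕ → ℕ} {i : ℕ} (h : ∀ j ≤ i, σ j = σ' j) :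
    concat len σ i = concat len σ' i := by
  induction i with
  | zero => exact h 0 le_rfl
  | succ i ih => rw [concat, concat, ih fun j hj => h j (by omega), h _ le_rfl]

lemma concat_update_of_lt {σ : ℕ → ℕ} {i k v : ℕ} (h : i < k) :
    concat len (Function.update σ k v) i = concat len σ i :=
  concat_congr fun j hj => Function.update_of_ne (by omega) _ _

lemma concat_div {σ : ℕ → ℕ} {i : ℕ} (h : σ (i + 1) < 2 ^ len (i + 1)) :
    concat len σ (i + 1) / 2 ^ len (i + 1) = concat len σ i := by
  rw [concat, mul_comm, Nat.mul_add_div (by positivity), Nat.div_eq_of_lt h, add_zero]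

lemma backtrack_le (σ : ℕ → ℕ) (i : ℕ) : backtrack len σ i ≤ i := by
  induction i with
  | zero => exact le_rfl
  | succ i ih =>
    rw [backtrack]
    split_ifs
    · omega
    · exact le_rfl

lemma backtrack_ne (σ : ℕ → ℕ) (i : ℕ) (h : 0 < backtrack len σ i) :
    σ (backtrack len σ i) + 1 ≠ 2 ^ len (backtrack len σ i) := by
  induction i with
  | zero => simp [backtrack] at h
  | succ i ih =>
    by_cases hb : σ (i + 1) + 1 = 2 ^ len (i + 1)
    · rw [backtrack, if_pos hb] at h ⊢
      exact ih h
    · rw [backtrack, if_neg hb]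
      exact hb

/-- Both sides are the first leaf after the current subtree. Dropping a fragment with all bits set
moves to an ancestor whose subtree ends at the same leaf. -/
lemma backtrack_concat (σ : ℕ → ℕ) {i : ℕ} (hi : i ≤ N) :
    (concat len σ (backtrack len σ i) + 1) * 2 ^ tail N len (backtrack len σ i)
      = (concat len σ i + 1) * 2 ^ tail N len i := by
  induction i with
  | zero => rfl
  | succ i ih =>
    by_cases hb : σ (i + 1) + 1 = 2 ^ len (i + 1)
    · rw [backtrack, if_pos hb, ih (by omega), tail_eq (by omega : i ≤ N), concat, pow_add,
        ← mul_assoc, add_assoc, hb, add_mul, one_mul]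
    · rw [backtrack, if_neg hb]

/-- The first leaf below the current node. -/
def position (N : ℕ) (len : ℕ → ℕ) (s : State) : ℕ :=
  concat len s.σ s.layer * 2 ^ tail N len s.layer

/-- The invariant of the depth first search: all leaves in `A`, which have successful ancestors
only, lie ahead. -/
structure SearchInv (N w : ℕ) (len : ℕ → ℕ) (B : ℕ → ℕ → Bool) (A : ℕ → Prop) (s : State) :
    Prop where
  running : s.status = .running → 1 ≤ s.layer ∧ s.layer ≤ N ∧ s.σ 0 < 2 ^ w ∧
    (∀ j, 1 ≤ j → j ≤ s.layer → s.σ j < 2 ^ len j) ∧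
    (∀ j, 1 ≤ j → j < s.layer → B j (seed w len s.σ j) = true) ∧
    ∀ z, A z → position N len s ≤ z
  success : s.status = .success → s.σ 0 < 2 ^ w ∧
    ∀ j, 1 ≤ j → j ≤ N → s.σ j < 2 ^ len j ∧ B j (seed w len s.σ j) = true
  failure : s.status = .failure → ∀ z, A z → 2 ^ w * 2 ^ tail N len 0 ≤ z

/-- A strictly increasing measure of the progress of the search. -/
def progress (N : ℕ) (len : ℕ → ℕ) (s : State) : ℕ := position N len s * (N + 1) + s.layer

/-- The time bound that is maintained: pending backtracking steps are paid for in advance. -/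
def charge (s : State) : ℕ :=
  match s.status with
  | .failure => s.time
  | _ => s.time + s.layer

lemma step_of_not_running {s : State} (h : s.status ≠ .running) :
    step N w len B cost s = s := by
  unfold step
  cases hs : s.status <;> simp_all

/-- After a success the search moves to the first child, which has the same first leaf but a larger
layer. After a failure no leaf of `A` lies below the current node, so the search may jump to the end
of its subtree, where the next node in preorder begins. The potential in `charge` is the layer:
descending raises it by one, and backtracking is paid for by its decrease. -/
lemma step_invariant {A : ℕ → Prop}
    (hA : ∀ z, A z → ∀ i, 1 ≤ i → i ≤ N → B i (z / 2 ^ tail N len i % 2 ^ w) = true)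
    {s : State} (hs : SearchInv N w len B A s) (hrun : s.status = .running) :
    SearchInv N w len B A (step N w len B cost s) ∧
      ((step N w len B cost s).status = .running →
        progress N len s < progress N len (step N w len B cost s)) ∧
      charge (step N w len B cost s) ≤ charge s + (cost s.layer + 2) := by
  obtain ⟨h1, hN, h0, hlt, hB, hz⟩ := hs.running hrun
  obtain ⟨σ, i, st, time⟩ := s
  simp only at hrun h1 hN h0 hlt hB hz
  subst hrun
  by_cases hb : B i (seed w len σ i) = true
  · by_cases hiN : i = N
    · have hstep : step N w len B cost ⟨σ, i, .running, time⟩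
          = ⟨σ, i, .success, time + cost i + 1⟩ := by
        simp [step, hiN] at *
        simp [hb]
      rw [hstep]
      refine ⟨⟨by simp, fun _ => ⟨h0, fun j hj1 hjN => ⟨hlt j hj1 (by omega), ?_⟩⟩, by simp⟩,
        by simp, by simp [charge]; omega⟩
      rcases eq_or_lt_of_le (hiN ▸ hjN : j ≤ i) with rfl | hlt'
      · exact hb
      · exact hB j hj1 hlt'
    · have hstep : step N w len B cost ⟨σ, i, .running, time⟩
          = ⟨Function.update σ (i + 1) 0, i + 1, .running, time + cost i + 1⟩ := by
        simp [step, hb, hiN]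
      rw [hstep]
      have hpos : position N len ⟨Function.update σ (i + 1) 0, i + 1, .running, time + cost i + 1⟩
          = position N len ⟨σ, i, .running, time⟩ := by
        simp only [position]
        rw [concat, concat_update_of_lt (Nat.lt_succ_self i), Function.update_self, add_zero,
          tail_eq hN, pow_add, mul_assoc]
      refine ⟨⟨fun _ => ⟨by simp, by simp only; omega, ?_, fun j hj1 hj => ?_, fun j hj1 hj => ?_,
        fun z hAz => ?_⟩, by simp, by simp⟩, fun _ => ?_, by simp [charge]; omega⟩
      · dsimp only; rw [Function.update_of_ne (by omega)]; exact h0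
      · simp only at hj ⊢
        rcases eq_or_ne j (i + 1) with rfl | hne
        · rw [Function.update_self]; positivity
        · rw [Function.update_of_ne hne]; exact hlt j hj1 (by omega)
      · simp only at hj ⊢
        rw [seed, concat_update_of_lt hj]
        rcases eq_or_lt_of_le (Nat.lt_succ_iff.1 hj) with rfl | hlt'
        · exact hb
        · exact hB j hj1 hlt'
      · rw [hpos]; exact hz z hAz
      · simp only [progress, hpos]; omega
  · have hbf : B i (seed w len σ i) = false := by simpa using hb
    -- A leaf of `A` below the current node would have the failed trial among its ancestors' trials;
    -- hence all leaves of `A` lie after the subtree.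
    have hz' : ∀ z, A z → (concat len σ i + 1) * 2 ^ tail N len i ≤ z := by
      intro z hAz
      rw [← Nat.le_div_iff_mul_le (by positivity)]
      have h2 : concat len σ i ≤ z / 2 ^ tail N len i :=
        (Nat.le_div_iff_mul_le (by positivity)).2 (hz z hAz)
      rcases eq_or_lt_of_le h2 with h3 | h3
      · have := hA z hAz i h1 hN
        rw [← h3] at this
        exact absurd this hb
      · exact h3
    have hposlt : position N len ⟨σ, i, .running, time⟩
        < (concat len σ i + 1) * 2 ^ tail N len i := by
      simp only [position]
      exact Nat.mul_lt_mul_of_pos_right (Nat.lt_succ_self _) (by positivity)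
    have hprog : ∀ s' : State, 1 ≤ s'.layer →
        position N len s' = (concat len σ i + 1) * 2 ^ tail N len i →
        progress N len ⟨σ, i, .running, time⟩ < progress N len s' := by
      intro s' hs' hpos
      simp only [progress, hpos]
      have := Nat.mul_le_mul_right (N + 1) (Nat.succ_le_of_lt hposlt)
      rw [Nat.succ_mul] at this
      omega
    have hbt := backtrack_concat (N := N) (len := len) σ hN
    have hble := backtrack_le (len := len) σ i
    set j := backtrack len σ i with hj
    by_cases hj0 : 0 < j
    · have hne : σ j + 1 ≠ 2 ^ len j := backtrack_ne σ i hj0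
      have hstep : step N w len B cost ⟨σ, i, .running, time⟩
          = ⟨Function.update σ j (σ j + 1), j, .running, time + cost i + 1 + (i - j)⟩ := by
        simp [step, hbf, ← hj, hj0]
      rw [hstep]
      have hcon : concat len (Function.update σ j (σ j + 1)) j = concat len σ j + 1 := by
        obtain ⟨j', hj'⟩ : ∃ j', j = j' + 1 := ⟨j - 1, by omega⟩
        rw [hj', concat, concat, concat_update_of_lt (Nat.lt_succ_self _), Function.update_self,
          add_assoc]
      have hpos : position N len
          ⟨Function.update σ j (σ j + 1), j, .running, time + cost i + 1 + (i - j)⟩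
          = (concat len σ i + 1) * 2 ^ tail N len i := by
        simp only [position, hcon, hbt]
      refine ⟨⟨fun _ => ⟨hj0, by simp only; omega, ?_, fun k hk1 hk => ?_, fun k hk1 hk => ?_,
        fun z hAz => ?_⟩, by simp, by simp⟩, fun _ => hprog _ hj0 hpos, by simp [charge]; omega⟩
      · dsimp only; rw [Function.update_of_ne (by omega)]; exact h0
      · simp only at hk ⊢
        by_cases hkj : k = j
        · rw [hkj, Function.update_self]
          have := hlt j hj0 hble
          omega
        · rw [Function.update_of_ne hkj]; exact hlt k hk1 (by omega)
      · simp only at hk ⊢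
        rw [seed, concat_update_of_lt hk]
        exact hB k hk1 (by omega)
      · rw [hpos]; exact hz' z hAz
    · have hj0' : j = 0 := by omega
      rw [hj0'] at hbt
      simp only [concat] at hbt
      by_cases hw : σ 0 + 1 < 2 ^ w
      · have hstep : step N w len B cost ⟨σ, i, .running, time⟩
            = ⟨Function.update (Function.update σ 0 (σ 0 + 1)) 1 0, 1, .running,
              time + cost i + 1 + (i - j)⟩ := by
          simp [step, hbf, ← hj, hj0', hw]
        rw [hstep]
        have hpos : position N len ⟨Function.update (Function.update σ 0 (σ 0 + 1)) 1 0, 1,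
            .running, time + cost i + 1 + (i - j)⟩
            = (concat len σ i + 1) * 2 ^ tail N len i := by
          rw [← hbt, tail_eq (Nat.zero_le N)]
          simp [position, concat, pow_add, mul_assoc]
        refine ⟨⟨fun _ => ⟨le_rfl, by simp only; omega, by simpa using hw, fun k hk1 hk => ?_,
          fun k hk1 hk => ?_, fun z hAz => ?_⟩, by simp, by simp⟩, fun _ => hprog _ le_rfl hpos,
          by simp [charge]; omega⟩
        · simp only at hk ⊢
          obtain rfl : k = 1 := by omega
          rw [Function.update_self]; positivity
        · simp only at hk
          omega
        · rw [hpos]; exact hz' z hAz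
      · have hstep : step N w len B cost ⟨σ, i, .running, time⟩
            = ⟨σ, i, .failure, time + cost i + 1 + (i - j)⟩ := by
          simp [step, hbf, ← hj, hj0', hw]
        rw [hstep]
        refine ⟨⟨by simp, by simp, fun _ z hAz => ?_⟩, by simp, by simp [charge]; omega⟩
        refine le_trans ?_ (hz' z hAz)
        rw [← hbt]
        exact Nat.mul_le_mul_right _ (by omega)

/-- The state of the search after `t` steps. -/
def searchState (N w : ℕ) (len : ℕ → ℕ) (B : ℕ → ℕ → Bool) (cost : ℕ → ℕ) (t : ℕ) : State :=
  consensus N w t len B cost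

lemma searchState_succ (t : ℕ) : searchState N w len B cost (t + 1)
    = step N w len B cost (searchState N w len B cost t) :=
  Function.iterate_succ_apply' _ _ _

lemma searchState_inv {A : ℕ → Prop} (hN : 1 ≤ N)
    (hA : ∀ z, A z → ∀ i, 1 ≤ i → i ≤ N → B i (z / 2 ^ tail N len i % 2 ^ w) = true) (t : ℕ) :
    SearchInv N w len B A (searchState N w len B cost t) := by
  induction t with
  | zero =>
    refine ⟨fun _ => ⟨le_rfl, hN, ?_, fun j _ _ => ?_, fun j h1 h2 => ?_, fun z _ => ?_⟩, ?_, ?_⟩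
    · simp [searchState, consensus]
    · simp [searchState, consensus]
    · simp only [searchState, consensus, Function.iterate_zero, id] at h2
      omega
    · simp [searchState, consensus, position, concat]
    · simp [searchState, consensus]
    · simp [searchState, consensus]
  | succ t ih =>
    rw [searchState_succ]
    by_cases hrun : (searchState N w len B cost t).status = .running
    · exact (step_invariant hA ih hrun).1
    · rw [step_of_not_running hrun]; exact ih

lemma searchState_stays {t u : ℕ} (htu : t ≤ u)
    (h : (searchState N w len B cost t).status ≠ .running) :
    searchState N w len B cost u = searchState N w len B cost t := by
  induction u, htu using Nat.le_induction with
  | base => rfl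
  | succ u _ ih => rw [searchState_succ, ih, step_of_not_running h]

lemma searchState_running_of_le {t u : ℕ} (htu : t ≤ u)
    (h : (searchState N w len B cost u).status = .running) :
    (searchState N w len B cost t).status = .running := by
  by_contra hn
  rw [searchState_stays htu hn] at h
  exact hn h

lemma progress_strictMono (hN : 1 ≤ N) {t u : ℕ} (htu : t < u)
    (h : (searchState N w len B cost u).status = .running) :
    progress N len (searchState N w len B cost t)
      < progress N len (searchState N w len B cost u) := by
  -- Progress does not concern the leaves still ahead, so the invariant is used with an empty set of
  -- leaves.
  have hA : ∀ z, (fun _ => False) z → ∀ i, 1 ≤ i → i ≤ N →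
      B i (z / 2 ^ tail N len i % 2 ^ w) = true := fun z hz => hz.elim
  induction u, Nat.succ_le_of_lt htu using Nat.le_induction with
  | base =>
    have ht := searchState_running_of_le (Nat.le_succ t) h
    have := (step_invariant (cost := cost) hA (searchState_inv hN hA t) ht).2.1
    rw [Nat.succ_eq_add_one, searchState_succ] at h ⊢
    exact this h
  | succ u hu ih =>
    have hu' := searchState_running_of_le (Nat.le_succ u) h
    have := (step_invariant (cost := cost) hA (searchState_inv hN hA u) hu').2.1
    rw [searchState_succ] at h ⊢
    exact (ih hu hu').trans (this h)

/-- The times at which the search inspects a trial. -/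
noncomputable def activeTimes (N w : ℕ) (len : ℕ → ℕ) (B : ℕ → ℕ → Bool) (cost : ℕ → ℕ) (limit : ℕ) :
    Finset ℕ := by
  classical
  exact (Finset.range limit).filter fun t => (searchState N w len B cost t).status = .running

/-- The times at which the search inspects a trial of family `i`. -/
noncomputable def visitTimes (N w : ℕ) (len : ℕ → ℕ) (B : ℕ → ℕ → Bool) (cost : ℕ → ℕ) (limit i : ℕ) :
    Finset ℕ :=
  (activeTimes N w len B cost limit).filter fun t => (searchState N w len B cost t).layer = i

lemma mem_activeTimes {limit t : ℕ} : t ∈ activeTimes N w len B cost limit ↔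
    t < limit ∧ (searchState N w len B cost t).status = .running := by
  simp [activeTimes]

lemma card_activeTimes_le (limit : ℕ) : (activeTimes N w len B cost limit).card ≤ limit := by
  refine (Finset.card_le_card (t := Finset.range limit) fun t ht => ?_).trans
    (Finset.card_range _).le
  exact Finset.mem_range.2 (mem_activeTimes.1 ht).1

lemma card_activeTimes_of_running {limit : ℕ}
    (h : (searchState N w len B cost limit).status = .running) :
    (activeTimes N w len B cost limit).card = limit := by
  have : activeTimes N w len B cost limit = Finset.range limit := by
    ext t
    rw [mem_activeTimes, Finset.mem_range]
    exact ⟨fun ht => ht.1, fun ht => ⟨ht, searchState_running_of_le ht.le h⟩⟩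
  rw [this, Finset.card_range]

lemma card_activeTimes_eq_sum (hN : 1 ≤ N) (limit : ℕ) :
    (activeTimes N w len B cost limit).card
      = ∑ i ∈ Finset.range N, (visitTimes N w len B cost limit (i + 1)).card := by
  have hmaps : ∀ t ∈ activeTimes N w len B cost limit,
      (searchState N w len B cost t).layer ∈ (Finset.range N).image (· + 1) := by
    intro t ht
    obtain ⟨h1, h2, _⟩ := (searchState_inv (A := fun _ => False) hN (fun z hz => hz.elim) t).running
      (mem_activeTimes.1 ht).2
    exact Finset.mem_image.2 ⟨(searchState N w len B cost t).layer - 1,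
      Finset.mem_range.2 (by omega), by omega⟩
  rw [Finset.card_eq_sum_card_fiberwise hmaps, Finset.sum_image (fun a _ b _ h => by simpa using h)]
  rfl

/-- Each step pays `m` for the trial, one unit for itself and one for the backtracking step it may
cause later. The initial 2 is the starting time 1 plus the potential 1 of layer 1. -/
lemma time_le {m : ℕ} (hN : 1 ≤ N) (hcost : ∀ i, 1 ≤ i → i ≤ N → cost i = m) (limit : ℕ) :
    (searchState N w len B cost limit).time
      ≤ 2 + (m + 2) * (activeTimes N w len B cost limit).card := by
  have hA : ∀ z, (fun _ => False) z → ∀ i, 1 ≤ i → i ≤ N →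
      B i (z / 2 ^ tail N len i % 2 ^ w) = true := fun z hz => hz.elim
  have hcharge : charge (searchState N w len B cost limit)
      ≤ 2 + (m + 2) * (activeTimes N w len B cost limit).card := by
    induction limit with
    | zero => simp [searchState, consensus, charge]
    | succ t ih =>
      by_cases ht : (searchState N w len B cost t).status = .running
      · have hact : activeTimes N w len B cost (t + 1)
            = insert t (activeTimes N w len B cost t) := by
          ext u
          rw [Finset.mem_insert, mem_activeTimes, mem_activeTimes]
          constructor
          · rintro ⟨h1, h2⟩
            rcases Nat.lt_succ_iff_lt_or_eq.1 h1 with h3 | h3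
            · exact Or.inr ⟨h3, h2⟩
            · exact Or.inl h3
          · rintro (rfl | ⟨h1, h2⟩)
            · exact ⟨Nat.lt_succ_self _, ht⟩
            · exact ⟨by omega, h2⟩
        rw [hact, Finset.card_insert_of_notMem (by simp [mem_activeTimes]), searchState_succ]
        have hinv := searchState_inv (cost := cost) hN hA t
        obtain ⟨h1, h2, _⟩ := hinv.running ht
        have := (step_invariant (cost := cost) hA hinv ht).2.2
        rw [hcost _ h1 h2] at this
        rw [mul_add, mul_one]
        omega
      · have hact : activeTimes N w len B cost (t + 1) = activeTimes N w len B cost t := by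
          ext u
          rw [mem_activeTimes, mem_activeTimes]
          constructor
          · rintro ⟨h1, h2⟩
            rcases Nat.lt_succ_iff_lt_or_eq.1 h1 with h3 | h3
            · exact ⟨h3, h2⟩
            · exact absurd (h3 ▸ h2) ht
          · rintro ⟨h1, h2⟩
            exact ⟨by omega, h2⟩
        rw [hact, searchState_succ, step_of_not_running ht]
        exact ih
  refine le_trans ?_ hcharge
  unfold charge
  cases (searchState N w len B cost limit).status <;> simp

end Search

/-! ## Expected number of steps of the search -/

section Expectation

variable {N w K : ℕ} {len : ℕ → ℕ} {β : ℕ × ℕ → Bool} {cost : ℕ → ℕ}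

/-- Trials of the families `1, 2, …` given by the bits of the layers `0, 1, …`. -/
def families (β : ℕ × ℕ → Bool) (i s : ℕ) : Bool := β (i - 1, s)

/-- The exponents of the numbers of children in the search tree. -/
def childExp (len : ℕ → ℕ) (j : ℕ) : ℕ := len (j + 2)

/-- The first `K` nodes with successful ancestors in layer `j`, if only the first `K` nodes in each
of the previous layers are taken into account. -/
abbrev reached (w K : ℕ) (len : ℕ → ℕ) (β : ℕ × ℕ → Bool) (j : ℕ) : Finset ℕ :=
  evolve (2 ^ w) K (childExp len) β 0 (Finset.range K) j

/-- The search tree restricted to `reached` has no successful leaf or two nodes that share a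
trial. -/
def Bad (N w K : ℕ) (len : ℕ → ℕ) (β : ℕ × ℕ → Bool) : Prop :=
  (∃ j < N, ¬ Distinct (2 ^ w) (reached w K len β j)) ∨ reached w K len β N = ∅

/-- There is no successful leaf below the first `k` nodes of layer `i`. -/
def Dies (N w K : ℕ) (len : ℕ → ℕ) (i k : ℕ) (β : ℕ × ℕ → Bool) : Prop :=
  k ≤ (reached w K len β i).card ∧
    (∀ t < N - i, Distinct (2 ^ w)
      (evolve (2 ^ w) K (childExp len) β i (smallest k (reached w K len β i)) t)) ∧
    evolve (2 ^ w) K (childExp len) β i (smallest k (reached w K len β i)) (N - i) = ∅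

lemma Alive.ancestor_good {M : ℕ} {e : ℕ → ℕ} {i s z : ℕ} (hz : Alive M e β (i + s) z)
    (hs : 0 < s) : β (i, z / 2 ^ depth e i s % M) = true := by
  induction s generalizing z with
  | zero => omega
  | succ s ih =>
    rcases Nat.eq_zero_or_pos s with rfl | hs'
    · simpa [depth] using hz.2
    · have := ih hz.1 hs'
      rw [div_pow_div_pow] at this
      rw [depth_succ]
      exact this

lemma Alive.families_tail {z : ℕ} (hz : Alive (2 ^ w) (childExp len) β N z) (i : ℕ) (h1 : 1 ≤ i)
    (hi : i ≤ N) : families β i (z / 2 ^ tail N len i % 2 ^ w) = true := by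
  obtain ⟨i, rfl⟩ : ∃ j, i = j + 1 := ⟨i - 1, by omega⟩
  rw [tail_succ_eq_depth]
  have : Alive (2 ^ w) (childExp len) β (i + (N - i)) z := by
    rwa [show i + (N - i) = N by omega]
  exact this.ancestor_good (by omega)

lemma alive_concat {σ : ℕ → ℕ} {i : ℕ} (hσ : ∀ j, 1 ≤ j → j ≤ i + 1 → σ j < 2 ^ len j)
    (hB : ∀ j, 1 ≤ j → j < i + 1 → families β j (seed w len σ j) = true) :
    Alive (2 ^ w) (childExp len) β i (concat len σ (i + 1)) := by
  induction i with
  | zero => trivial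
  | succ i ih =>
    have hdiv : concat len σ (i + 1 + 1) / 2 ^ childExp len i = concat len σ (i + 1) :=
      concat_div (hσ _ (by omega) le_rfl)
    refine ⟨?_, ?_⟩
    · rw [hdiv]
      exact ih (fun j h1 h2 => hσ j h1 (by omega)) fun j h1 h2 => hB j h1 (by omega)
    · rw [hdiv]
      exact hB (i + 1) (by omega) (by omega)

lemma reached_div_lt {j x : ℕ} (hx : x ∈ reached w K len β j) :
    x / 2 ^ depth (childExp len) 0 j < K := by
  have := evolve_ancestor (M := 2 ^ w) (K := K) (e := childExp len) (β := β) (i := 0)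
    (Y := Finset.range K) (s := j) 0 (by simpa using hx)
  simpa [evolve] using this

/-- The inspected nodes of a layer are distinct, have successful ancestors and never pass the
ancestor of a successful leaf. Thus they all lie in the capped layer. The rightmost of them has at
least `k` nodes of that layer to its left, so a successful leaf below one of the first `k` nodes
would have stopped the search before. -/
lemma dies_of_lt_card_visitTimes (hN : 1 ≤ N) {limit : ℕ}
    (hbad : ¬ Bad N w K len β) {i k : ℕ} (hi : i < N)
    (hk : k < (visitTimes N w len (families β) cost limit (i + 1)).card) :
    k < (reached w K len β i).card ∧ Dies N w K len i k β := by
  classical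
  have hinv := searchState_inv (cost := cost) (A := Alive (2 ^ w) (childExp len) β N) hN
    (fun z hz => hz.families_tail)
  set V := visitTimes N w len (families β) cost limit (i + 1) with hV
  let node : ℕ → ℕ := fun t =>
    concat len (searchState N w len (families β) cost t).σ (i + 1)
  have hVmem : ∀ t ∈ V, (searchState N w len (families β) cost t).status = .running ∧
      (searchState N w len (families β) cost t).layer = i + 1 := fun t ht =>
    ⟨(mem_activeTimes.1 (Finset.mem_filter.1 ht).1).2, (Finset.mem_filter.1 ht).2⟩
  have hpos : ∀ t ∈ V, position N len (searchState N w len (families β) cost t)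
      = node t * 2 ^ depth (childExp len) i (N - i) := by
    intro t ht
    rw [position, (hVmem t ht).2, tail_succ_eq_depth]
    rfl
  have hinj : Set.InjOn node (V : Set ℕ) := by
    have aux : ∀ t ∈ V, ∀ u ∈ V, t < u → node t ≠ node u := by
      intro t ht u hu htu heq
      have := progress_strictMono hN htu (hVmem u hu).1
      rw [progress, progress, hpos t ht, hpos u hu, heq, (hVmem t ht).2, (hVmem u hu).2] at this
      exact lt_irrefl _ this
    intro t ht u hu heq
    rcases lt_trichotomy t u with h | h | h
    · exact absurd heq (aux t ht u hu h)
    · exact h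
    · exact absurd heq.symm (aux u hu t ht h)
  have halive : ∀ t ∈ V, Alive (2 ^ w) (childExp len) β i (node t) := by
    intro t ht
    obtain ⟨-, -, -, h4, h5, -⟩ := (hinv t).running (hVmem t ht).1
    rw [(hVmem t ht).2] at h4 h5
    exact alive_concat h4 h5
  have hleaf : ∀ t ∈ V, ∀ z, Alive (2 ^ w) (childExp len) β N z →
      node t ≤ z / 2 ^ depth (childExp len) i (N - i) := by
    intro t ht z hz
    rw [Nat.le_div_iff_mul_le (by positivity), ← hpos t ht]
    exact ((hinv t).running (hVmem t ht).1).2.2.2.2.2 z hz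
  have hVne : V.Nonempty := Finset.card_pos.1 (by omega)
  obtain ⟨tm, htm, hmax⟩ := Finset.exists_max_image V node hVne
  have hne : reached w K len β N ≠ ∅ := fun h => hbad (Or.inr h)
  obtain ⟨z, hz⟩ := Finset.nonempty_iff_ne_empty.2 hne
  have hzal : Alive (2 ^ w) (childExp len) β N z := by
    simpa using alive_of_mem_evolve (i := 0) (fun x _ => trivial) hz
  have hzi : z / 2 ^ depth (childExp len) i (N - i) ∈ reached w K len β i := by
    have := evolve_ancestor (M := 2 ^ w) (K := K) (e := childExp len) (β := β) (i := 0)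
      (Y := Finset.range K) (s := N - i) (x := z) i (by rwa [show i + (N - i) = N by omega])
    rwa [zero_add] at this
  -- The leaf `z` exists because the capped process does not die out; its ancestor bounds the
  -- visited nodes from the right, and capped layers are initial segments.
  have hnodeX : ∀ t ∈ V, node t ∈ reached w K len β i := fun t ht =>
    mem_evolve_of_le hzi (halive t ht) (hleaf t ht z hzal)
  have hcard : (V.image node).card = V.card := Finset.card_image_of_injOn hinj
  have hsubX : V.image node ⊆ reached w K len β i := by
    intro x hx
    obtain ⟨t, ht, rfl⟩ := Finset.mem_image.1 hx
    exact hnodeX t ht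
  have hlt : k < (reached w K len β i).card := by
    have := Finset.card_le_card hsubX
    omega
  have hseg := fun t => evolve_mono_smallest (M := 2 ^ w) (K := K) (e := childExp len) (β := β)
    (i := i) (Y := reached w K len β i) (Y' := smallest k (reached w K len β i)) smallest_subset
    (fun x hx y hy hxy => mem_smallest_of_le hx hy hxy) t
  refine ⟨hlt, hlt.le, fun t ht => ?_, ?_⟩
  · have h1 : Distinct (2 ^ w) (reached w K len β (i + t)) := by
      by_contra hcon
      exact hbad (Or.inl ⟨i + t, by omega, hcon⟩)
    refine Set.InjOn.mono ?_ h1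
    have h2 : reached w K len β (i + t)
        = evolve (2 ^ w) K (childExp len) β i (reached w K len β i) t := by
      simpa using evolve_add (M := 2 ^ w) (K := K) (e := childExp len) β 0 (Finset.range K) i t
    rw [h2]
    exact_mod_cast (hseg t).1
  · by_contra hcon
    obtain ⟨z', hz'⟩ := Finset.nonempty_iff_ne_empty.2 hcon
    have hz'al : Alive (2 ^ w) (childExp len) β N z' := by
      have := alive_of_mem_evolve (i := i) (fun x hx => ?_) hz'
      · rwa [show i + (N - i) = N by omega] at this
      · simpa using alive_of_mem_evolve (i := 0) (fun x _ => trivial) (smallest_subset hx)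
    have hu : z' / 2 ^ depth (childExp len) i (N - i) ∈ smallest k (reached w K len β i) := by
      have := evolve_ancestor (M := 2 ^ w) (K := K) (e := childExp len) (β := β) (i := i)
        (Y := smallest k (reached w K len β i)) (s := N - i) (x := z') 0 (by simpa using hz')
      simpa [evolve] using this
    have hle := hleaf tm htm z' hz'al
    have h2 := (mem_smallest.1 (mem_smallest_of_le (hnodeX tm htm) hu hle)).2
    have h3 : (V.image node).erase (node tm) ⊆
        (reached w K len β i).filter (· < node tm) := by
      intro x hx
      obtain ⟨hx1, hx2⟩ := Finset.mem_erase.1 hx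
      obtain ⟨t, ht, rfl⟩ := Finset.mem_image.1 hx2
      exact Finset.mem_filter.2 ⟨hnodeX t ht, lt_of_le_of_ne (hmax t ht) hx1⟩
    have h4 := Finset.card_le_card h3
    rw [Finset.card_erase_of_mem (Finset.mem_image_of_mem _ htm), hcard] at h4
    omega

open Classical in
/-- An upper bound for the number of steps of the search. -/
noncomputable def stepBound (N w K : ℕ) (len : ℕ → ℕ) (limit : ℕ) (β : ℕ × ℕ → Bool) : ℝ≥0∞ :=
  ∑ i ∈ Finset.range N, ∑ k ∈ Finset.range K, (if Dies N w K len i k β then 1 else 0)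
    + limit * (if Bad N w K len β then 1 else 0)

lemma card_activeTimes_le_stepBound (hN : 1 ≤ N) (limit : ℕ) :
    ((activeTimes N w len (families β) cost limit).card : ℝ≥0∞) ≤ stepBound N w K len limit β := by
  classical
  rw [stepBound]
  by_cases hbad : Bad N w K len β
  · rw [if_pos hbad, mul_one]
    exact le_add_left (by exact_mod_cast card_activeTimes_le limit)
  · rw [card_activeTimes_eq_sum hN]
    push_cast
    refine le_add_right (Finset.sum_le_sum fun i hi => ?_)
    have hiN := Finset.mem_range.1 hi
    set v := (visitTimes N w len (families β) cost limit (i + 1)).card with hv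
    have hvK : v ≤ K := by
      by_contra hcon
      have := (dies_of_lt_card_visitTimes hN hbad hiN (by omega : K < v)).1
      have h2 : (reached w K len β i).card ≤ K := card_evolve_le β 0 (Finset.card_range K).le i
      omega
    -- The `k`-th summand is 1 for every `k < v`, so the number of visits is dominated by the number
    -- of indices `k` for which the first `k` nodes die out.
    calc (v : ℝ≥0∞) = ∑ k ∈ Finset.range v, 1 := by simp
      _ ≤ ∑ k ∈ Finset.range v, (if Dies N w K len i k β then 1 else 0) := by
          refine Finset.sum_le_sum fun k hk => ?_
          rw [if_pos (dies_of_lt_card_visitTimes hN hbad hiN (Finset.mem_range.1 hk)).2]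
      _ ≤ _ := Finset.sum_le_sum_of_subset (Finset.range_subset_range.2 hvK)

/-- In the bad event the limit is charged explicitly. Otherwise a search still running has used all
its steps, and exhaustion of the tree is impossible: a successful leaf descends from one of the
first `K ≤ 2 ^ w` roots, so it is inside the searched range. -/
lemma limit_le_stepBound (hN : 1 ≤ N) (hKw : K ≤ 2 ^ w) {limit : ℕ}
    (h : (searchState N w len (families β) cost limit).status ≠ .success) :
    (limit : ℝ≥0∞) ≤ stepBound N w K len limit β := by
  classical
  by_cases hbad : Bad N w K len β
  · rw [stepBound, if_pos hbad, mul_one]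
    exact le_add_self
  · cases hst : (searchState N w len (families β) cost limit).status with
    | success => exact absurd hst h
    | running =>
      have := card_activeTimes_le_stepBound (w := w) (K := K) (cost := cost) (len := len)
        (β := β) hN limit
      rwa [card_activeTimes_of_running hst] at this
    | failure =>
      exfalso
      have hne : reached w K len β N ≠ ∅ := fun h => hbad (Or.inr h)
      obtain ⟨z, hz⟩ := Finset.nonempty_iff_ne_empty.2 hne
      have hzal : Alive (2 ^ w) (childExp len) β N z := by
        simpa using alive_of_mem_evolve (i := 0) (fun x _ => trivial) hz
      have h1 := (searchState_inv (cost := cost) (A := Alive (2 ^ w) (childExp len) β N) hN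
        (fun z hz => hz.families_tail) limit).failure hst z hzal
      have h2 := reached_div_lt hz
      rw [Nat.div_lt_iff_lt_mul (by positivity)] at h2
      rw [tail_eq (Nat.zero_le N), tail_succ_eq_depth, Nat.sub_zero, pow_add] at h1
      have h3 : K * 2 ^ depth (childExp len) 0 N
          ≤ 2 ^ w * (2 ^ len (0 + 1) * 2 ^ depth (childExp len) 0 N) := by
        rw [← mul_assoc]
        exact Nat.mul_le_mul_right _ (hKw.trans (Nat.le_mul_of_pos_right _ (by positivity)))
      have h4 : (2 : ℕ) ^ w * (2 ^ len (0 + 1) * 2 ^ depth (childExp len) 0 N) ≤ z := h1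
      omega

/-! ### Probability of the bad event and expectation of the step bound -/

section Probability

variable {Ω : Type*} [MeasurableSpace Ω] {P : Measure Ω} [IsProbabilityMeasure P]
  {h : ℕ × ℕ → Ω → Bool} {p q : ℝ≥0∞}

lemma dependsOn_Bad : DependsOn (Bad N w K len) (trials (2 ^ w) 0 N : Set (ℕ × ℕ)) := by
  refine dependsOn_evolve_upto (by positivity) (Finset.range K) N
    (fun X => (∃ j < N, ¬ Distinct (2 ^ w) (X j)) ∨ X N = ∅) fun X X' hX => ?_
  rw [hX N le_rfl, eq_iff_iff]
  refine or_congr_left (exists_congr fun j => and_congr_right fun hj => ?_)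
  rw [hX j hj.le]

lemma dependsOn_Dies {i k : ℕ} (hi : i ≤ N) :
    DependsOn (Dies N w K len i k) (trials (2 ^ w) 0 N : Set (ℕ × ℕ)) := by
  intro β β' hβ
  have h1 : reached w K len β i = reached w K len β' i :=
    evolve_congr (by positivity) _ fun k hk => hβ k (by
      rw [Finset.mem_coe, mem_trials] at *; omega)
  have h2 := dependsOn_dies (M := 2 ^ w) (K := K) (e := childExp len) (by positivity) i (N - i)
    (smallest k (reached w K len β' i)) (x := β) (y := β') (fun k hk => hβ k (by
      rw [Finset.mem_coe, mem_trials] at *; omega))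
  simp only [Dies, h1, h2]

lemma dependsOn_stepBound (limit : ℕ) :
    DependsOn (stepBound N w K len limit) (trials (2 ^ w) 0 N : Set (ℕ × ℕ)) := by
  intro β β' hβ
  classical
  have hb : Bad N w K len β ↔ Bad N w K len β' := iff_of_eq (dependsOn_Bad hβ)
  have hd : ∀ i ∈ Finset.range N, ∀ k, Dies N w K len i k β ↔ Dies N w K len i k β' :=
    fun i hi k => iff_of_eq (dependsOn_Dies (Finset.mem_range.1 hi).le hβ)
  rw [stepBound, stepBound]
  refine congrArg₂ _ (Finset.sum_congr rfl fun i hi => Finset.sum_congr rfl fun k _ => ?_)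
    (congrArg _ ?_)
  · exact if_congr (hd i hi k) rfl rfl
  · exact if_congr hb rfl rfl

/-- A union bound over extinction and the first layer with a collision. Near the root (first
alternative of `hγ`) all indices are below `2 ^ w`, so collisions cannot occur; deeper layers use
the last `s` layers, which together contribute at most `w` bits. -/
lemma prob_Bad_le (hm : ∀ k, Measurable (h k)) (hi : iIndepFun h P)
    (hp : ∀ j < N, ∀ s < 2 ^ w, P {ω | h (j, s) ω = true} = p)
    (hq : ∀ j < N, ∀ s < 2 ^ w, P {ω | h (j, s) ω = false} = q)
    {z : ℕ → ℝ≥0∞} (hz : ∀ j < N, q + p * z (j + 1) ^ 2 ^ childExp len j ≤ z j)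
    {η γ : ℝ≥0∞} (hη : ∀ j, z j ^ K ≤ η)
    (hγ : ∀ j < N, K * 2 ^ depth (childExp len) 0 j ≤ 2 ^ w ∨
      ∃ r s, r + s = j ∧ depth (childExp len) r s ≤ w ∧ K ^ 2 * p ^ s ≤ γ) :
    P {ω | Bad N w K len (fun k => h k ω)} ≤ (N + 1) * η + N * γ := by
  have hcoll : ∀ j < N, P {ω | (∀ t < j, Distinct (2 ^ w) (reached w K len (fun k => h k ω) t)) ∧
      ¬ Distinct (2 ^ w) (reached w K len (fun k => h k ω) j)} ≤ γ := by
    intro j hj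
    rcases hγ j hj with h1 | ⟨r, s, rfl, h2, h3⟩
    · refine le_trans (le_of_eq ?_) (zero_le (α := ℝ≥0∞))
      convert! measure_empty (μ := P)
      rw [Set.eq_empty_iff_forall_notMem]
      rintro ω ⟨-, hω⟩
      refine hω fun x hx y hy hxy => ?_
      have hlt : ∀ x ∈ reached w K len (fun k => h k ω) j, x < 2 ^ w := fun x hx =>
        ((Nat.div_lt_iff_lt_mul (by positivity)).1 (reached_div_lt hx)).trans_le h1
      simp only at hxy
      rwa [Nat.mod_eq_of_lt (hlt x hx), Nat.mod_eq_of_lt (hlt y hy)] at hxy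
    · exact (prob_collision_le hm hi (by positivity) hp (Finset.card_range K).le hj.le
        (pow_dvd_pow 2 h2)).trans h3
  have hdie := prob_dies_le (K := K) (e := childExp len) hm hi (by positivity) hp hq hz hη N 0
    (by omega) (Finset.range K)
  have hsub : {ω | Bad N w K len (fun k => h k ω)} ⊆
      {ω | (∀ t < N, Distinct (2 ^ w) (reached w K len (fun k => h k ω) t)) ∧
        reached w K len (fun k => h k ω) N = ∅} ∪
      ⋃ j ∈ Finset.range N, {ω | (∀ t < j, Distinct (2 ^ w) (reached w K len (fun k => h k ω) t)) ∧
        ¬ Distinct (2 ^ w) (reached w K len (fun k => h k ω) j)} := by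
    classical
    intro ω hω
    by_cases hex : ∃ j, j < N ∧ ¬ Distinct (2 ^ w) (reached w K len (fun k => h k ω) j)
    · right
      have hf := Nat.find_spec hex
      refine Set.mem_iUnion₂.2 ⟨Nat.find hex, Finset.mem_range.2 hf.1, fun t ht => ?_, hf.2⟩
      by_contra hcon
      exact Nat.find_min hex ht ⟨ht.trans hf.1, hcon⟩
    · left
      push Not at hex
      refine ⟨hex, ?_⟩
      rcases hω with ⟨j, hj, hj'⟩ | h2
      · exact absurd (hex j hj) hj'
      · exact h2
  calc P {ω | Bad N w K len (fun k => h k ω)}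
      ≤ (z 0 ^ K + N * η) + ∑ j ∈ Finset.range N, γ := by
        refine (measure_mono hsub).trans ((measure_union_le _ _).trans (add_le_add ?_ ?_))
        · simpa using hdie
        · refine (measure_biUnion_finset_le _ _).trans (Finset.sum_le_sum fun j hj => ?_)
          exact hcoll j (Finset.mem_range.1 hj)
    _ ≤ (N + 1) * η + N * γ := by
        rw [Finset.sum_const, Finset.card_range, nsmul_eq_mul, add_mul, one_mul, add_comm (_ * η)]
        gcongr
        exact hη 0

/-- A bound for the expected number of steps of the search. -/
lemma lintegral_stepBound_le (hm : ∀ k, Measurable (h k)) (hi : iIndepFun h P)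
    (hp : ∀ j < N, ∀ s < 2 ^ w, P {ω | h (j, s) ω = true} = p)
    (hq : ∀ j < N, ∀ s < 2 ^ w, P {ω | h (j, s) ω = false} = q)
    {z : ℕ → ℝ≥0∞} (hz : ∀ j < N, q + p * z (j + 1) ^ 2 ^ childExp len j ≤ z j)
    {η γ A : ℝ≥0∞} (hη : ∀ j, z j ^ K ≤ η) (hA : ∀ j, (1 - z j)⁻¹ ≤ A)
    (hγ : ∀ j < N, K * 2 ^ depth (childExp len) 0 j ≤ 2 ^ w ∨
      ∃ r s, r + s = j ∧ depth (childExp len) r s ≤ w ∧ K ^ 2 * p ^ s ≤ γ) (limit : ℕ) :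
    ∫⁻ ω, stepBound N w K len limit (fun k => h k ω) ∂P
      ≤ N * (A + K * (N * η)) + limit * ((N + 1) * η + N * γ) := by
  classical
  have hmBad : MeasurableSet {ω | Bad N w K len (fun k => h k ω)} :=
    measurableSet_of_dependsOn hm dependsOn_Bad
  have hmDies : ∀ i < N, ∀ k, MeasurableSet {ω | Dies N w K len i k (fun k => h k ω)} :=
    fun i hi k => measurableSet_of_dependsOn hm (dependsOn_Dies hi.le)
  have hind : ∀ (s : Set Ω) (_ : MeasurableSet s),
      ∫⁻ ω, (if ω ∈ s then 1 else 0 : ℝ≥0∞) ∂P = P s := by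
    intro s hs
    rw [← lintegral_indicator_one hs]
    rfl
  have hindm : ∀ (s : Set Ω) (_ : MeasurableSet s),
      Measurable fun ω => (if ω ∈ s then 1 else 0 : ℝ≥0∞) := fun s hs =>
    measurable_const.ite hs measurable_const
  simp only [stepBound]
  have hDm : ∀ i ∈ Finset.range N, ∀ k ∈ Finset.range K, Measurable fun ω =>
      (if Dies N w K len i k (fun k => h k ω) then 1 else 0 : ℝ≥0∞) := fun i hi k _ =>
    hindm _ (hmDies i (Finset.mem_range.1 hi) k)
  have hBm : Measurable fun ω => (if Bad N w K len (fun k => h k ω) then 1 else 0 : ℝ≥0∞) :=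
    hindm _ hmBad
  rw [lintegral_add_right _ (hBm.const_mul _), lintegral_const_mul _ hBm,
    lintegral_finsetSum _ fun i hi => Finset.measurable_sum _ (hDm i hi)]
  refine add_le_add ?_ ?_
  · calc _ ≤ ∑ _i ∈ Finset.range N, (A + K * (N * η)) := by
          refine Finset.sum_le_sum fun i hiN => ?_
          have hiN' := Finset.mem_range.1 hiN
          rw [lintegral_finsetSum _ (hDm i hiN)]
          calc _ ≤ ∑ k ∈ Finset.range K, (z i ^ k + N * η) := by
                refine Finset.sum_le_sum fun k _ => ?_
                refine (hind _ (hmDies i hiN' k)).trans_le ?_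
                refine (prob_dies_smallest_le hm hi (by positivity) hp hq hz hη i (N - i) k
                  (by omega) (Finset.range K)).trans ?_
                gcongr
                omega
            _ ≤ A + K * (N * η) := by
                rw [Finset.sum_add_distrib, Finset.sum_const, Finset.card_range, nsmul_eq_mul]
                gcongr
                -- Extending the sum over `k` to the full geometric series yields `(1 - z i)⁻¹`, the
                -- expected number of nodes tried until one has a successful leaf below it.
                refine (ENNReal.sum_le_tsum _).trans ?_
                rw [ENNReal.tsum_geometric]
                exact hA i
      _ = _ := by rw [Finset.sum_const, Finset.card_range, nsmul_eq_mul]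
  · gcongr
    exact (hind _ hmBad).trans_le (prob_Bad_le hm hi hp hq hz hη hγ)

end Probability

end Expectation

/-! ## Parameters of the levels -/

section Parameters

lemma splitProb_two_mul (r : ℕ) : splitProb (2 * r) = (r.centralBinom : ℝ) / 4 ^ r := by
  rw [splitProb, Nat.mul_div_cancel_left r (by norm_num), Nat.centralBinom, pow_mul]
  norm_num

lemma splitProb_two_mul_succ (r : ℕ) :
    splitProb (2 * (r + 1)) * (2 * (r + 1)) = splitProb (2 * r) * (2 * r + 1) := by
  rw [splitProb_two_mul, splitProb_two_mul]
  have h : ((r : ℝ) + 1) * ((r + 1).centralBinom : ℝ) = 2 * (2 * r + 1) * (r.centralBinom : ℝ) := by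
    exact_mod_cast Nat.succ_mul_centralBinom_succ r
  have h4 : (4 : ℝ) ^ r ≠ 0 := by positivity
  rw [pow_succ]
  field_simp
  linarith

lemma splitProb_two_mul_pos (r : ℕ) : 0 < splitProb (2 * r) := by
  rw [splitProb_two_mul]
  have := Nat.centralBinom_pos r
  positivity

lemma splitProb_two_mul_le (r : ℕ) (hr : 1 ≤ r) : splitProb (2 * r) ≤ 1 / 2 := by
  induction r, hr using Nat.le_induction with
  | base => norm_num [splitProb]
  | succ r hr ih =>
    have h1 := splitProb_two_mul_succ r
    have h2 := splitProb_two_mul_pos r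
    have h3 := splitProb_two_mul_pos (r + 1)
    nlinarith

/-- The right-hand side equals 1 at `r = 1` and grows by the factor `(2r+1)² / (4r(r+1)) > 1`. This
is the lower bound `p(m) ≥ 1 / √(2m)` without Stirling's formula. -/
lemma one_le_splitProb_sq (r : ℕ) (hr : 1 ≤ r) : 1 ≤ splitProb (2 * r) ^ 2 * (4 * r) := by
  induction r, hr using Nat.le_induction with
  | base => norm_num [splitProb]
  | succ r hr ih =>
    have h1 := splitProb_two_mul_succ r
    have h2 := splitProb_two_mul_pos r
    have hr' : (1 : ℝ) ≤ r := by exact_mod_cast hr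
    have h3 : splitProb (2 * (r + 1)) = splitProb (2 * r) * (2 * r + 1) / (2 * (r + 1)) := by
      field_simp
      linarith
    rw [h3]
    push_cast
    have h4 : (splitProb (2 * r) * (2 * r + 1) / (2 * (r + 1))) ^ 2 * (4 * ((r : ℝ) + 1))
        = splitProb (2 * r) ^ 2 * (4 * r) * ((2 * r + 1) ^ 2 / (4 * r * (r + 1))) := by
      field_simp
      ring
    rw [h4]
    have h5 : 1 ≤ (2 * (r : ℝ) + 1) ^ 2 / (4 * r * (r + 1)) := by
      rw [le_div_iff₀ (by positivity)]
      nlinarith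
    nlinarith

variable {d l : ℕ} {ε : ℝ}

lemma splitProb_pos (hl : l < d) : 0 < splitProb (2 ^ (d - l)) := by
  obtain ⟨k, hk⟩ : ∃ k, d - l = k + 1 := ⟨d - l - 1, by omega⟩
  rw [hk, pow_succ']
  exact splitProb_two_mul_pos _

lemma splitProb_le (hl : l < d) : splitProb (2 ^ (d - l)) ≤ 1 / 2 := by
  obtain ⟨k, hk⟩ : ∃ k, d - l = k + 1 := ⟨d - l - 1, by omega⟩
  rw [hk, pow_succ']
  exact splitProb_two_mul_le _ Nat.one_le_two_pow

lemma one_div_splitProb_le (hl : l < d) :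
    1 / splitProb (2 ^ (d - l)) ≤ Real.sqrt (2 * 2 ^ (d - l)) := by
  obtain ⟨k, hk⟩ : ∃ k, d - l = k + 1 := ⟨d - l - 1, by omega⟩
  have h0 := splitProb_pos hl
  rw [hk, pow_succ'] at h0 ⊢
  have := one_le_splitProb_sq (2 ^ k) Nat.one_le_two_pow
  rw [div_le_iff₀ h0]
  refine le_of_pow_le_pow_left₀ (two_ne_zero) (by positivity) ?_
  rw [mul_pow, Real.sq_sqrt (by positivity)]
  push_cast at this
  rw [pow_succ' (2 : ℝ) k]
  linarith

lemma one_div_splitProb_le_two_pow (hl : l < d) :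
    1 / splitProb (2 ^ (d - l)) ≤ 2 ^ (d - l) := by
  refine (one_div_splitProb_le hl).trans (Real.sqrt_le_iff.2 ⟨by positivity, ?_⟩)
  have : (2 : ℝ) ≤ 2 ^ (d - l) := le_self_pow₀ (by norm_num) (by omega)
  nlinarith

lemma levelEps_le_one : levelEps d ε l ≤ 1 := min_le_left _ _

lemma le_levelEps (hε0 : 0 ≤ ε) (hε : ε ≤ 1) : ε ≤ levelEps d ε l := by
  refine le_min hε (le_mul_of_one_le_right hε0 ?_)
  exact Real.one_le_rpow (one_le_pow₀ (by norm_num)) (by norm_num)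

lemma levelEps_pos (hε0 : 0 < ε) (hε : ε ≤ 1) : 0 < levelEps d ε l :=
  hε0.trans_le (le_levelEps hε0.le hε)

/-- The information content of a seed of level `l`. -/
noncomputable def seedInfo (d l : ℕ) : ℝ := Real.logb 2 (1 / splitProb (2 ^ (d - l)))

lemma two_rpow_neg_seedInfo (hl : l < d) : (2 : ℝ) ^ (-seedInfo d l) = splitProb (2 ^ (d - l)) := by
  rw [seedInfo, one_div, Real.logb_inv, neg_neg,
    Real.rpow_logb (by norm_num) (by norm_num) (splitProb_pos hl)]

lemma one_le_seedInfo (hl : l < d) : 1 ≤ seedInfo d l := by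
  rw [seedInfo, Real.le_logb_iff_rpow_le (by norm_num) (one_div_pos.2 (splitProb_pos hl)),
    Real.rpow_one, le_one_div (by norm_num) (splitProb_pos hl)]
  exact splitProb_le hl

lemma seedInfo_le (hl : l < d) : seedInfo d l ≤ d := by
  rw [seedInfo, Real.logb_le_iff_le_rpow (by norm_num) (one_div_pos.2 (splitProb_pos hl)),
    Real.rpow_natCast]
  exact (one_div_splitProb_le_two_pow hl).trans (pow_le_pow_right₀ (by norm_num) (by omega))

lemma prefixLen_eq (i : ℕ) :
    prefixLen d ε l i = ⌈(levelEps d ε l + seedInfo d l) * i⌉₊ := by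
  rw [prefixLen, seedInfo]
  congr 1
  ring

lemma le_prefixLen (i : ℕ) :
    (levelEps d ε l + seedInfo d l) * i ≤ prefixLen d ε l i := by
  rw [prefixLen_eq]
  exact Nat.le_ceil _

lemma prefixLen_zero : prefixLen d ε l 0 = 0 := by simp [prefixLen_eq]

section

variable (hl : l < d) (hε0 : 0 < ε) (hε : ε ≤ 1)

include hl hε0 hε

lemma prefixLen_mono : Monotone (prefixLen d ε l) := by
  intro i j hij
  rw [prefixLen_eq, prefixLen_eq]
  have h1 := levelEps_pos (d := d) (l := l) hε0 hε
  have h2 := one_le_seedInfo hl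
  gcongr

lemma sum_fragLen (i s : ℕ) :
    ∑ t ∈ Finset.range s, fragLen d ε l (i + t + 1) + prefixLen d ε l i
      = prefixLen d ε l (i + s) := by
  induction s with
  | zero => simp
  | succ s ih =>
    rw [Finset.sum_range_succ, fragLen, Nat.add_sub_cancel, ← add_assoc i s 1]
    have := prefixLen_mono hl hε0 hε (Nat.le_succ (i + s))
    simp only [Nat.succ_eq_add_one] at this
    omega

lemma depth_childExp (r s : ℕ) :
    depth (childExp (fragLen d ε l)) r s + prefixLen d ε l (r + 1)
      = prefixLen d ε l (r + 1 + s) := by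
  rw [← sum_fragLen hl hε0 hε (r + 1) s, depth]
  congr 1
  refine Finset.sum_congr rfl fun t _ => ?_
  rw [childExp]
  congr 1
  omega

lemma prefixLen_lt (i : ℕ) :
    (prefixLen d ε l i : ℝ) < (levelEps d ε l + seedInfo d l) * i + 1 := by
  rw [prefixLen_eq]
  have h1 := levelEps_pos (d := d) (l := l) hε0 hε
  have h2 := one_le_seedInfo hl
  exact Nat.ceil_lt_add_one (by positivity)

end

/-- The rounding error in the length of the first `i` fragments. -/
noncomputable def rounding (d : ℕ) (ε : ℝ) (l i : ℕ) : ℝ :=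
  prefixLen d ε l i - (levelEps d ε l + seedInfo d l) * i

lemma rounding_nonneg (i : ℕ) : 0 ≤ rounding d ε l i := by
  have := le_prefixLen (d := d) (ε := ε) (l := l) i
  rw [rounding]
  linarith

/-- A lower bound for the probability that a node of layer `j` leads to a successful leaf. -/
noncomputable def survival (d : ℕ) (ε : ℝ) (l j : ℕ) : ℝ :=
  splitProb (2 ^ (d - l)) * (levelEps d ε l / 4) * 2 ^ (-rounding d ε l (j + 1))

section

variable (hl : l < d) (hε0 : 0 < ε) (hε : ε ≤ 1)

include hl hε0 hε

lemma rounding_le_one (i : ℕ) : rounding d ε l i ≤ 1 := by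
  have := prefixLen_lt hl hε0 hε i
  rw [rounding]
  linarith

lemma le_survival (j : ℕ) :
    splitProb (2 ^ (d - l)) * levelEps d ε l / 8 ≤ survival d ε l j := by
  have h1 : (2 : ℝ) ^ (-1 : ℝ) ≤ 2 ^ (-rounding d ε l (j + 1)) :=
    Real.rpow_le_rpow_of_exponent_le (by norm_num)
      (neg_le_neg (rounding_le_one hl hε0 hε (j + 1)))
  rw [Real.rpow_neg_one] at h1
  have h2 := levelEps_pos (d := d) (l := l) hε0 hε
  have h3 := splitProb_pos hl
  rw [survival]
  calc _ = splitProb (2 ^ (d - l)) * (levelEps d ε l / 4) * 2⁻¹ := by ring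
    _ ≤ _ := by gcongr

lemma survival_pos (j : ℕ) : 0 < survival d ε l j := by
  have h2 := levelEps_pos (d := d) (l := l) hε0 hε
  have h3 := splitProb_pos hl
  rw [survival]
  positivity

lemma survival_le_one (j : ℕ) : survival d ε l j ≤ 1 := by
  have h1 : (2 : ℝ) ^ (-rounding d ε l (j + 1)) ≤ 1 :=
    Real.rpow_le_one_of_one_le_of_nonpos (by norm_num)
      (by linarith [rounding_nonneg (d := d) (ε := ε) (l := l) (j + 1)])
  have h2 := levelEps_pos (d := d) (l := l) hε0 hε
  have h2' := levelEps_le_one (d := d) (l := l) (ε := ε)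
  have h3 := splitProb_pos hl
  have h3' := splitProb_le hl
  rw [survival]
  have h4 : (0 : ℝ) < 2 ^ (-rounding d ε l (j + 1)) := by positivity
  calc _ ≤ (1 / 2 : ℝ) * (1 / 4) * 1 := by gcongr
    _ ≤ 1 := by norm_num

/-- The recursion for the survival probability: `j` is the layer, `2 ^ childExp j` the number of
children of its nodes. -/
lemma survival_step (j : ℕ) :
    (1 - splitProb (2 ^ (d - l))) + splitProb (2 ^ (d - l)) *
      (1 - survival d ε l (j + 1)) ^ 2 ^ childExp (fragLen d ε l) j ≤ 1 - survival d ε l j := by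
  set p := splitProb (2 ^ (d - l)) with hp
  set e₀ := levelEps d ε l with he₀
  have hp0 : 0 < p := splitProb_pos hl
  have he0 : 0 < e₀ := levelEps_pos hε0 hε
  set u : ℝ := e₀ / 4 * 2 ^ (e₀ - rounding d ε l (j + 1)) with hu
  have hu0 : 0 < u := by positivity
  -- The factor `2 ^ (-rounding)` in the survival bound exists for this cancellation: the next
  -- layer's rounding error drops out, and only that of the current layer remains.
  have hexp : (2 : ℝ) ^ childExp (fragLen d ε l) j * survival d ε l (j + 1) = u := by
    have h1 : ((childExp (fragLen d ε l) j : ℕ) : ℝ)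
        = e₀ + seedInfo d l + rounding d ε l (j + 2) - rounding d ε l (j + 1) := by
      have h2 : fragLen d ε l (j + 2) + prefixLen d ε l (j + 1) = prefixLen d ε l (j + 2) := by
        have := sum_fragLen hl hε0 hε (j + 1) 1
        simpa using this
      have h3 : (fragLen d ε l (j + 2) : ℝ) + prefixLen d ε l (j + 1) = prefixLen d ε l (j + 2) := by
        exact_mod_cast h2
      rw [childExp, rounding, rounding]
      push_cast
      linarith
    have hpi : p = 2 ^ (-seedInfo d l) := (two_rpow_neg_seedInfo hl).symm
    rw [← Real.rpow_natCast, h1, survival, hu, ← hp, hpi, ← he₀]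
    have h4 : (2 : ℝ) ^ (e₀ + seedInfo d l + rounding d ε l (j + 2) - rounding d ε l (j + 1)) *
        (2 ^ (-seedInfo d l) * (e₀ / 4) * 2 ^ (-rounding d ε l (j + 1 + 1)))
        = e₀ / 4 * (2 ^ (e₀ + seedInfo d l + rounding d ε l (j + 2) - rounding d ε l (j + 1)) *
          2 ^ (-seedInfo d l) * 2 ^ (-rounding d ε l (j + 2))) := by ring
    rw [h4, ← Real.rpow_add (by norm_num), ← Real.rpow_add (by norm_num)]
    congr 2
    ring
  -- `(1 - x) ^ k ≤ exp (-k * x)` and `exp u ≥ 1 + u`.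
  have h1 : (1 - survival d ε l (j + 1)) ^ 2 ^ childExp (fragLen d ε l) j ≤ (1 + u)⁻¹ := by
    have h2 : 1 - survival d ε l (j + 1) ≤ Real.exp (-survival d ε l (j + 1)) := by
      have := Real.add_one_le_exp (-survival d ε l (j + 1))
      linarith
    have h3 : (0 : ℝ) ≤ 1 - survival d ε l (j + 1) := by
      linarith [survival_le_one hl hε0 hε (j + 1)]
    calc _ ≤ Real.exp (-survival d ε l (j + 1)) ^ 2 ^ childExp (fragLen d ε l) j := by gcongr
      _ = (Real.exp u)⁻¹ := by
          rw [← Real.exp_nat_mul, ← Real.exp_neg]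
          push_cast
          rw [← hexp]
          ring_nf
      _ ≤ (1 + u)⁻¹ := by
          gcongr
          linarith [Real.add_one_le_exp u]
  -- This dictates the constant `1/4` in `survival`: as `e₀ - rounding ≤ 1`, it gives `u ≤ e₀ / 2`,
  -- which is below `e₀ * log 2`.
  have hle : 1 + u ≤ 2 ^ e₀ := by
    have h2 : (2 : ℝ) ^ (e₀ - rounding d ε l (j + 1)) ≤ 2 := by
      calc _ ≤ (2 : ℝ) ^ (1 : ℝ) := by
            apply Real.rpow_le_rpow_of_exponent_le (by norm_num)
            linarith [rounding_nonneg (d := d) (ε := ε) (l := l) (j + 1), levelEps_le_one (d := d) (l := l) (ε := ε)]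
        _ = 2 := Real.rpow_one 2
    have h3 : e₀ * Real.log 2 + 1 ≤ 2 ^ e₀ := by
      rw [Real.rpow_def_of_pos (by norm_num), mul_comm]
      exact Real.add_one_le_exp _
    have h4 := Real.log_two_gt_d9
    have h5 : u ≤ e₀ / 4 * 2 := by rw [hu]; gcongr
    nlinarith
  have hsurv : survival d ε l j = p * (u / 2 ^ e₀) := by
    rw [survival, hu, Real.rpow_sub (by norm_num), Real.rpow_neg (by norm_num)]
    field_simp
    rw [hp, he₀]
  have h6 : u / 2 ^ e₀ ≤ 1 - (1 + u)⁻¹ := by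
    have : 1 - (1 + u)⁻¹ = u / (1 + u) := by field_simp; ring
    rw [this]
    gcongr
  have h7 := mul_le_mul_of_nonneg_left h6 hp0.le
  have h8 := mul_le_mul_of_nonneg_left h1 hp0.le
  rw [hsurv]
  linarith

end

end Parameters

/-! ### Choice of the cap, the error exponent and the word size -/

section LevelExpectation

/-- In the analysis, `2 ^ (capExp lim * d)` nodes per layer are taken into account. -/
def capExp (lim : ℕ) : ℕ := lim + 16

/-- Error probabilities in the analysis of a level are at most `2 ^ (-errExp lim * d)`. -/
def errExp (lim : ℕ) : ℕ := 2 * lim + 20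

/-- The word size in units of `d`. -/
def wordFactor (lim : ℕ) : ℕ := 5 * capExp lim + 2 * errExp lim + 1

variable {d l lim : ℕ} {ε : ℝ}

/-- Survival probabilities are at least `1 / (8 * n ^ 2)`, so this makes the cap `K` large enough
for `K` nodes to expect at least `errExp lim * d` survivors. -/
lemma errExp_le (lim d : ℕ) (hd : 1 ≤ d) :
    8 * 2 ^ d * 2 ^ d * (errExp lim * d) ≤ 2 ^ (capExp lim * d) := by
  have h1 : 2 * lim + 20 ≤ 2 ^ (lim + 10) := by
    have : lim + 9 < 2 ^ (lim + 9) := Nat.lt_two_pow_self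
    rw [pow_succ]
    omega
  have h2 : errExp lim ≤ (2 ^ d) ^ (lim + 10) :=
    h1.trans (Nat.pow_le_pow_left (Nat.le_self_pow (by omega) 2) _)
  have h3 : d ≤ 2 ^ d := Nat.lt_two_pow_self.le
  have h4 : 8 ≤ (2 ^ d) ^ 3 := by
    calc 8 = 2 ^ 3 := by norm_num
      _ ≤ (2 ^ d) ^ 3 := Nat.pow_le_pow_left (Nat.le_self_pow (by omega) 2) _
  calc 8 * 2 ^ d * 2 ^ d * (errExp lim * d)
      ≤ (2 ^ d) ^ 3 * 2 ^ d * 2 ^ d * ((2 ^ d) ^ (lim + 10) * 2 ^ d) := by gcongr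
    _ = (2 ^ d) ^ (capExp lim) := by rw [capExp]; ring
    _ = 2 ^ (capExp lim * d) := by rw [← pow_mul, mul_comm]

/-- The left side collects the coefficients of the error probability in the bound for the expected
number of steps; it follows that all errors together contribute at most one step. -/
lemma errors_le (lim d N : ℕ) (hd : 1 ≤ d) (hN : N ≤ 2 ^ d) :
    N * 2 ^ (capExp lim * d) * N + 2 ^ (lim * d) * (2 * N + 1) ≤ 2 ^ (errExp lim * d) := by
  have h2 : 2 ≤ 2 ^ d := Nat.le_self_pow (by omega) 2
  have hpow : ∀ a, 2 ^ (a * d) = (2 ^ d) ^ a := fun a => by rw [← pow_mul, mul_comm]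
  rw [hpow, hpow, hpow]
  generalize 2 ^ d = n at *
  have h3 : 2 * N + 1 ≤ n ^ 3 := by
    have : n * 4 ≤ n ^ 3 := by rw [pow_succ' n 2]; gcongr; nlinarith
    omega
  calc N * n ^ capExp lim * N + n ^ lim * (2 * N + 1)
      ≤ n * n ^ capExp lim * n + n ^ lim * n ^ 3 := by gcongr
    _ = n ^ (lim + 18) + n ^ (lim + 3) := by rw [capExp]; ring
    _ ≤ n ^ (lim + 18) + n ^ (lim + 18) := by gcongr <;> omega
    _ = 2 * n ^ (lim + 18) := by ring
    _ ≤ n * n ^ (lim + 18) := by gcongr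
    _ = n ^ (lim + 19) := by ring
    _ ≤ n ^ errExp lim := Nat.pow_le_pow_right (by omega) (by rw [errExp]; omega)

lemma inv_le_survival (hl : l < d) (hε : ε ≤ 1) (hε1 : 1 / 2 ^ d ≤ ε) (j : ℕ) :
    1 / (8 * 2 ^ d * 2 ^ d) ≤ survival d ε l j := by
  have hε0 : 0 < ε := lt_of_lt_of_le (by positivity) hε1
  refine le_trans ?_ (le_survival hl hε0 hε j)
  have h1 : 1 / 2 ^ d ≤ splitProb (2 ^ (d - l)) := by
    have := one_div_splitProb_le_two_pow hl
    rw [one_div_le (by positivity) (splitProb_pos hl)]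
    exact this.trans (pow_le_pow_right₀ (by norm_num) (by omega))
  have h2 : 1 / 2 ^ d ≤ levelEps d ε l := hε1.trans (le_levelEps hε0.le hε)
  calc 1 / (8 * 2 ^ d * 2 ^ d) = (1 / 2 ^ d) * (1 / 2 ^ d) / (8 : ℝ) := by
        field_simp
    _ ≤ _ := by
        have := (splitProb_pos hl).le
        gcongr

lemma one_sub_survival_pow_le (hd : 1 ≤ d) (hl : l < d) (hε : ε ≤ 1) (hε1 : 1 / 2 ^ d ≤ ε)
    (j : ℕ) :
    (1 - survival d ε l j) ^ 2 ^ (capExp lim * d) ≤ ((2 : ℝ) ^ (errExp lim * d))⁻¹ := by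
  have hε0 : 0 < ε := lt_of_lt_of_le (by positivity) hε1
  have h1 := Real.add_one_le_exp (-survival d ε l j)
  have h2 := survival_le_one hl hε0 hε j
  have h3 : ((errExp lim * d : ℕ) : ℝ) ≤ 2 ^ (capExp lim * d) * survival d ε l j := by
    have h4 : (8 * 2 ^ d * 2 ^ d * (errExp lim * d : ℕ) : ℝ) ≤ 2 ^ (capExp lim * d) := by
      exact_mod_cast errExp_le lim d hd
    calc ((errExp lim * d : ℕ) : ℝ)
        = (8 * 2 ^ d * 2 ^ d * (errExp lim * d : ℕ)) * (1 / (8 * 2 ^ d * 2 ^ d)) := by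
          field_simp
      _ ≤ _ := by
          gcongr
          exact inv_le_survival hl hε hε1 j
  calc (1 - survival d ε l j) ^ 2 ^ (capExp lim * d)
      ≤ Real.exp (-survival d ε l j) ^ 2 ^ (capExp lim * d) := by
        gcongr
        linarith
    _ = (Real.exp (2 ^ (capExp lim * d) * survival d ε l j))⁻¹ := by
        rw [← Real.exp_nat_mul, ← Real.exp_neg]
        push_cast
        ring_nf
    _ ≤ (Real.exp (errExp lim * d : ℕ))⁻¹ := by gcongr
    _ ≤ ((2 : ℝ) ^ (errExp lim * d))⁻¹ := by
        gcongr
        rw [← mul_one ((errExp lim * d : ℕ) : ℝ), Real.exp_nat_mul]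
        gcongr
        linarith [Real.add_one_le_exp 1]

/-- Take the longest run of layers above `j` that adds at most `w` bits. Unless the root is too
close for any collision, this run adds nearly `w` bits, while a layer adds only about `seedInfo +
ε_ℓ ≤ 2 * seedInfo` bits; so `p ^ s` is roughly at most `2 ^ (-w/2)`, which must beat `K ^ 2` and
the error target. This is why `wordFactor` contains `2 * errExp` and `4 * capExp`, plus one further
`capExp` for the incomplete layer. -/
lemma collision_bound (hl : l < d) (hε0 : 0 < ε) (hε : ε ≤ 1) (j : ℕ) :
    2 ^ (capExp lim * d) * 2 ^ depth (childExp (fragLen d ε l)) 0 j ≤ 2 ^ (wordFactor lim * d) ∨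
      ∃ r s, r + s = j ∧ depth (childExp (fragLen d ε l)) r s ≤ wordFactor lim * d ∧
        ((2 : ℝ) ^ (capExp lim * d)) ^ 2 * splitProb (2 ^ (d - l)) ^ s
          ≤ ((2 : ℝ) ^ (errExp lim * d))⁻¹ := by
  classical
  set D := depth (childExp (fragLen d ε l)) with hD
  by_cases h0 : capExp lim * d + D 0 j ≤ wordFactor lim * d
  · left
    rw [← pow_add]
    exact Nat.pow_le_pow_right (by norm_num) h0
  right
  have hex : ∃ r, r ≤ j ∧ D r (j - r) ≤ wordFactor lim * d := ⟨j, le_rfl, by simp [hD, depth]⟩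
  set r := Nat.find hex with hr
  obtain ⟨hrj, hrw⟩ := Nat.find_spec hex
  have he1 := levelEps_le_one (d := d) (l := l) (ε := ε)
  have hs1 := one_le_seedInfo hl
  have hsd := seedInfo_le hl
  have hd1 : 1 ≤ d := by omega
  -- By minimality of `r`, one more layer would exceed `w` bits, and a layer has fewer than `d + 2 ≤
  -- capExp lim * d` bits. For `r = 0` this is the negation of the first alternative.
  have hbig : wordFactor lim * d < capExp lim * d + D r (j - r) := by
    rcases Nat.eq_zero_or_pos r with hr0 | hr0
    · rw [hr0, Nat.sub_zero]
      omega
    · have hmin := Nat.find_min hex (m := r - 1) (by omega)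
      have h1 : wordFactor lim * d < D (r - 1) (j - (r - 1)) := by
        by_contra hcon
        exact hmin ⟨by omega, by omega⟩
      have h2 := depth_childExp hl hε0 hε (r - 1) (j - (r - 1))
      have h3 := depth_childExp hl hε0 hε r (j - r)
      rw [show r - 1 + 1 = r by omega, show r + (j - (r - 1)) = r + 1 + (j - r) by omega] at h2
      have h4 := prefixLen_lt hl hε0 hε (r + 1)
      have h5 := le_prefixLen (d := d) (ε := ε) (l := l) r
      have h6 : (prefixLen d ε l (r + 1) : ℝ) < ((prefixLen d ε l r + (d + 2) : ℕ) : ℝ) := by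
        push_cast at h4 ⊢
        nlinarith
      have h7 : prefixLen d ε l (r + 1) < prefixLen d ε l r + (d + 2) := by exact_mod_cast h6
      have h8 : d + 2 ≤ capExp lim * d := by
        rw [capExp]
        nlinarith
      rw [← hD] at h2 h3
      omega
  refine ⟨r, j - r, by omega, hrw, ?_⟩
  have h3 := depth_childExp hl hε0 hε r (j - r)
  rw [← hD] at h3
  have h4 := prefixLen_lt hl hε0 hε (r + 1 + (j - r))
  have h5 := le_prefixLen (d := d) (ε := ε) (l := l) (r + 1)
  have h3' : (D r (j - r) : ℝ) + prefixLen d ε l (r + 1) = prefixLen d ε l (r + 1 + (j - r)) := by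
    exact_mod_cast h3
  have hbig' : (wordFactor lim * d : ℝ) + 1 ≤ capExp lim * d + D r (j - r) := by exact_mod_cast hbig
  set s : ℝ := ((j - r : ℕ) : ℝ) with hs
  have hs0 : 0 ≤ s := Nat.cast_nonneg _
  -- Uses `levelEps ≤ 1 ≤ seedInfo`; the `+ 1` is the rounding error of the longer prefix.
  have h6 : (D r (j - r) : ℝ) ≤ 2 * seedInfo d l * s + 1 := by
    push_cast at h4 h5
    rw [← hs] at h4
    nlinarith
  have h7 : (2 * capExp lim + errExp lim : ℝ) * d ≤ seedInfo d l * s := by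
    rw [wordFactor] at hbig'
    push_cast at hbig'
    have : (1 : ℝ) ≤ d := by exact_mod_cast hd1
    nlinarith
  rw [← two_rpow_neg_seedInfo hl, ← Real.rpow_natCast, ← Real.rpow_natCast, ← Real.rpow_natCast,
    ← Real.rpow_natCast, ← Real.rpow_mul (by norm_num), ← Real.rpow_mul (by norm_num),
    ← Real.rpow_add (by norm_num), ← Real.rpow_neg (by norm_num)]
  apply Real.rpow_le_rpow_of_exponent_le (by norm_num)
  push_cast
  rw [← hs]
  nlinarith

variable {Ω : Type*} [MeasurableSpace Ω] {P : Measure Ω} [IsProbabilityMeasure P]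
  {h : ℕ × ℕ → Ω → Bool}

/-- The expected number of steps of the search on one level. -/
lemma lintegral_stepBound_level_le (hl : l < d) (hε : ε ≤ 1)
    (hε1 : 1 / 2 ^ d ≤ ε) (hm : ∀ k, Measurable (h k)) (hi : iIndepFun h P)
    (hp : ∀ j < 2 ^ l, ∀ s < 2 ^ (wordFactor lim * d),
      P {ω | h (j, s) ω = true} = ENNReal.ofReal (splitProb (2 ^ (d - l)))) :
    ∫⁻ ω, stepBound (2 ^ l) (wordFactor lim * d) (2 ^ (capExp lim * d)) (fragLen d ε l)
      (2 ^ (lim * d)) (fun k => h k ω) ∂P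
      ≤ ENNReal.ofReal (2 ^ l * (8 / (splitProb (2 ^ (d - l)) * levelEps d ε l)) + 1) := by
  have hd : 1 ≤ d := by omega
  have hε0 : 0 < ε := lt_of_lt_of_le (by positivity) hε1
  have hp0 := splitProb_pos hl
  have hp1 := splitProb_le hl
  have he0 := levelEps_pos (d := d) (l := l) hε0 hε
  have hs0 := survival_pos hl hε0 hε
  have hs1 := survival_le_one hl hε0 hε
  set p := splitProb (2 ^ (d - l)) with hpdef
  have hq : ∀ j < 2 ^ l, ∀ s < 2 ^ (wordFactor lim * d),
      P {ω | h (j, s) ω = false} = ENNReal.ofReal (1 - p) := by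
    intro j hj s hs
    have h1 : {ω | h (j, s) ω = false} = {ω | h (j, s) ω = true}ᶜ := by ext ω; simp
    have hms : MeasurableSet {ω | h (j, s) ω = true} := hm _ (MeasurableSet.singleton true)
    rw [h1, prob_compl_eq_one_sub hms, hp j hj s hs,
      ENNReal.ofReal_sub _ hp0.le, ENNReal.ofReal_one]
  set η : ℝ≥0∞ := ENNReal.ofReal ((2 : ℝ) ^ (errExp lim * d))⁻¹ with hη
  set A : ℝ≥0∞ := ENNReal.ofReal (8 / (p * levelEps d ε l)) with hA
  have key := lintegral_stepBound_le (K := 2 ^ (capExp lim * d)) (len := fragLen d ε l)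
    (z := fun j => ENNReal.ofReal (1 - survival d ε l j)) (η := η) (γ := η) (A := A)
    hm hi hp hq ?_ ?_ ?_ ?_ (2 ^ (lim * d))
  · refine key.trans ?_
    have h1 : ((2 ^ l * 2 ^ (capExp lim * d) * 2 ^ l + 2 ^ (lim * d) * (2 * 2 ^ l + 1) : ℕ) : ℝ≥0∞)
        * η ≤ 1 := by
      have h2 := errors_le lim d (2 ^ l) hd (Nat.pow_le_pow_right (by norm_num) hl.le)
      have h3 : ((2 ^ (errExp lim * d) : ℕ) : ℝ≥0∞) * η = 1 := by
        rw [hη, ← ENNReal.ofReal_natCast, ← ENNReal.ofReal_mul (by positivity)]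
        push_cast
        rw [mul_inv_cancel₀ (by positivity), ENNReal.ofReal_one]
      rw [← h3]
      gcongr
    calc _ = ((2 ^ l : ℕ) : ℝ≥0∞) * A + ((2 ^ l * 2 ^ (capExp lim * d) * 2 ^ l
          + 2 ^ (lim * d) * (2 * 2 ^ l + 1) : ℕ) : ℝ≥0∞) * η := by
          push_cast
          ring
      _ ≤ ((2 ^ l : ℕ) : ℝ≥0∞) * A + 1 := by gcongr
      _ = _ := by
          rw [ENNReal.ofReal_add (by positivity) (by norm_num), ENNReal.ofReal_mul (by positivity),
            ENNReal.ofReal_one, ← ENNReal.ofReal_natCast]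
          push_cast
          rfl
  · intro j _
    rw [← ENNReal.ofReal_pow (by linarith [hs1 (j + 1)]), ← ENNReal.ofReal_mul hp0.le,
      ← ENNReal.ofReal_add (by linarith)
        (mul_nonneg hp0.le (pow_nonneg (by linarith [hs1 (j + 1)]) _))]
    exact ENNReal.ofReal_le_ofReal (survival_step hl hε0 hε j)
  · intro j
    rw [← ENNReal.ofReal_pow (by linarith [hs1 j])]
    exact ENNReal.ofReal_le_ofReal (one_sub_survival_pow_le hd hl hε hε1 j)
  · intro j
    rw [← ENNReal.ofReal_one, ← ENNReal.ofReal_sub _ (by linarith [hs1 j]), sub_sub_cancel,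
      ← ENNReal.ofReal_inv_of_pos (hs0 j)]
    apply ENNReal.ofReal_le_ofReal
    rw [inv_le_comm₀ (hs0 j) (by positivity)]
    have := le_survival hl hε0 hε j
    rwa [inv_div]
  · intro j _
    refine (collision_bound hl hε0 hε j).imp_right ?_
    rintro ⟨r, s, h1, h2, h3⟩
    refine ⟨r, s, h1, h2, ?_⟩
    have h4 : ((2 ^ (capExp lim * d) : ℕ) : ℝ≥0∞) = ENNReal.ofReal (2 ^ (capExp lim * d)) := by
      rw [← ENNReal.ofReal_natCast]
      push_cast
      rfl
    rw [h4, ← ENNReal.ofReal_pow (by positivity), ← ENNReal.ofReal_pow hp0.le,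
      ← ENNReal.ofReal_mul (by positivity)]
    exact ENNReal.ofReal_le_ofReal h3

end LevelExpectation

/-! ## The top-down construction -/

section Build

variable {U : Type*} {S : Finset U} {H H' : HashIndex U → Bool} {a l d κ lim w : ℕ} {ε : ℝ}
  {node node' : U → ℕ}

/-- The outcomes of the trials of level `l`. -/
def levelTrials (S : Finset U) (H : HashIndex U → Bool) (a l : ℕ) (node : U → ℕ) (k : ℕ × ℕ) :
    Bool :=
  splits S H a l node k.1 k.2

lemma levelRun_eq : levelRun d κ lim ε S H a l node
    = searchState (2 ^ l) (κ * d) (fragLen d ε l) (families (levelTrials S H a l node))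
      (fun i => (bucket S node (i - 1)).card) (2 ^ (lim * d)) := rfl

/-- The hash bits of attempt `a` for the levels in `L`. -/
def hashBits (d w : ℕ) (S : Finset U) (a : ℕ) (L : Finset ℕ) : Finset (HashIndex U) :=
  {a} ×ˢ L ×ˢ Finset.range (2 ^ d) ×ˢ Finset.range (2 ^ w) ×ˢ S

lemma mem_hashBits {L : Finset ℕ} {k : HashIndex U} : k ∈ hashBits d w S a L ↔
    k.1 = a ∧ k.2.1 ∈ L ∧ k.2.2.1 < 2 ^ d ∧ k.2.2.2.1 < 2 ^ w ∧ k.2.2.2.2 ∈ S := by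
  obtain ⟨a', l, i, s, x⟩ := k
  simp only [hashBits, Finset.mem_product, Finset.mem_singleton, Finset.mem_range]

lemma mem_bucket {i : ℕ} {x : U} : x ∈ bucket S node i ↔ x ∈ S ∧ node x = i :=
  Finset.mem_filter

lemma bucket_congr (h : ∀ x ∈ S, node x = node' x) (i : ℕ) :
    bucket S node i = bucket S node' i :=
  Finset.filter_congr fun x hx => by rw [h x hx]

lemma splits_congr (hnode : ∀ x ∈ S, node x = node' x) {i s : ℕ}
    (hH : ∀ x ∈ bucket S node i, H (a, l, i, s, x) = H' (a, l, i, s, x)) :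
    splits S H a l node i s = splits S H' a l node' i s := by
  rw [splits, splits, ← bucket_congr hnode i]
  have : (bucket S node i).filter (fun x => H (a, l, i, s, x) = true)
      = (bucket S node i).filter (fun x => H' (a, l, i, s, x) = true) :=
    Finset.filter_congr fun x hx => by rw [hH x hx]
  rw [this]

lemma levelTrials_congr (hnode : ∀ x ∈ S, node x = node' x) (hlt : ∀ x ∈ S, node x < 2 ^ d)
    (hH : ∀ k ∈ hashBits d w S a {l}, H k = H' k) {k : ℕ × ℕ} (hk : k.2 < 2 ^ w) :
    levelTrials S H a l node k = levelTrials S H' a l node' k := by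
  refine splits_congr hnode fun x hx => hH _ ?_
  rw [mem_bucket] at hx
  rw [mem_hashBits]
  exact ⟨rfl, Finset.mem_singleton_self l, by rw [← hx.2]; exact hlt x hx.1, hk, hx.1⟩

lemma step_congr {N w : ℕ} {len : ℕ → ℕ} {B B' : ℕ → ℕ → Bool} {cost : ℕ → ℕ}
    (h : ∀ i, ∀ s < 2 ^ w, B i s = B' i s) : step N w len B cost = step N w len B' cost := by
  funext s
  have : B s.layer (seed w len s.σ s.layer) = B' s.layer (seed w len s.σ s.layer) :=
    h _ _ (Nat.mod_lt _ (by positivity))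
  simp only [step, this]

lemma levelRun_congr (hnode : ∀ x ∈ S, node x = node' x) (hlt : ∀ x ∈ S, node x < 2 ^ d)
    (hH : ∀ k ∈ hashBits d (κ * d) S a {l}, H k = H' k) :
    levelRun d κ lim ε S H a l node = levelRun d κ lim ε S H' a l node' := by
  rw [levelRun, levelRun, consensus, consensus, step_congr (B' := fun i s =>
    splits S H' a l node' (i - 1) s) fun i s hs => ?_]
  · simp only [bucket_congr hnode]
  · exact levelTrials_congr (k := (i - 1, s)) hnode hlt hH hs

lemma build_node_lt (x : U) : (build d κ lim ε S H a l).node x < 2 ^ l := by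
  induction l with
  | zero => simp [build]
  | succ l ih =>
    simp only [build]
    split_ifs with hok
    · cases (levelRun d κ lim ε S H a l (build d κ lim ε S H a l).node).status with
      | success =>
        simp only
        have := Bool.toNat_le (H (a, l, (build d κ lim ε S H a l).node x, seed (κ * d)
          (fragLen d ε l) (levelRun d κ lim ε S H a l (build d κ lim ε S H a l).node).σ
          ((build d κ lim ε S H a l).node x + 1), x))
        rw [pow_succ]
        omega
      | running => simp only; rw [pow_succ]; omega
      | failure => simp only; rw [pow_succ]; omega
    · rw [pow_succ]; omega

/-- The construction up to level `l` depends only on the hash bits of the previous levels. -/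
lemma build_congr (hl : l ≤ d) (hH : ∀ k ∈ hashBits d (κ * d) S a (Finset.range l), H k = H' k) :
    (build d κ lim ε S H a l).ok = (build d κ lim ε S H' a l).ok ∧
    (build d κ lim ε S H a l).bits = (build d κ lim ε S H' a l).bits ∧
    (build d κ lim ε S H a l).time = (build d κ lim ε S H' a l).time ∧
    ∀ x ∈ S, (build d κ lim ε S H a l).node x = (build d κ lim ε S H' a l).node x := by
  induction l with
  | zero => simp [build]
  | succ l ih =>
    obtain ⟨h1, h2, h3, h4⟩ := ih (by omega) fun k hk => hH k (by
      rw [mem_hashBits] at hk ⊢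
      exact ⟨hk.1, Finset.mem_range.2 (by have := Finset.mem_range.1 hk.2.1; omega), hk.2.2⟩)
    have hlt : ∀ x ∈ S, (build d κ lim ε S H a l).node x < 2 ^ d := fun x _ =>
      (build_node_lt x).trans_le (Nat.pow_le_pow_right (by norm_num) (by omega))
    have hr := levelRun_congr (κ := κ) (lim := lim) (ε := ε) (l := l) h4 hlt fun k hk => hH k (by
      rw [mem_hashBits] at hk ⊢
      exact ⟨hk.1, Finset.mem_range.2 (by have := Finset.mem_singleton.1 hk.2.1; omega), hk.2.2⟩)
    simp only [build]
    rw [← h1, ← hr]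
    by_cases hok : (build d κ lim ε S H a l).ok = true
    · rw [if_pos hok, if_pos hok]
      cases (levelRun d κ lim ε S H a l (build d κ lim ε S H a l).node).status with
      | success =>
        refine ⟨rfl, by simp only [h2], by simp only [h3], fun x hx => ?_⟩
        simp only [h4 x hx]
        rw [hH]
        rw [mem_hashBits]
        refine ⟨rfl, Finset.self_mem_range_succ l, ?_, Nat.mod_lt _ (by positivity), hx⟩
        rw [← h4 x hx]
        exact hlt x hx
      | running => exact ⟨rfl, h2, by simp only [h3], h4⟩
      | failure => exact ⟨rfl, h2, by simp only [h3], h4⟩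
    · rw [if_neg hok, if_neg hok]
      exact ⟨h1, h2, h3, h4⟩

/-- Every node of level `l` is responsible for `2 ^ (d - l)` keys. -/
def Balanced (S : Finset U) (d l : ℕ) (node : U → ℕ) : Prop :=
  ∀ i < 2 ^ l, (bucket S node i).card = 2 ^ (d - l)

lemma levelRun_success
    (h : (levelRun d κ lim ε S H a l node).status = .success) :
    (levelRun d κ lim ε S H a l node).σ 0 < 2 ^ (κ * d) ∧ ∀ j, 1 ≤ j → j ≤ 2 ^ l →
      (levelRun d κ lim ε S H a l node).σ j < 2 ^ fragLen d ε l j ∧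
      splits S H a l node (j - 1)
        (seed (κ * d) (fragLen d ε l) (levelRun d κ lim ε S H a l node).σ j) = true := by
  rw [levelRun_eq] at h ⊢
  exact (searchState_inv (A := fun _ => False) Nat.one_le_two_pow (fun z hz => hz.elim) _).success h

/-- Success on a level certifies that every seed used there splits its bucket exactly, so sizes
halve whatever the hash functions are. Keys with bit 0 go to the even child, keys with bit 1 to the
odd one. -/
lemma build_balanced (hS : S.card = 2 ^ d) (hl : l ≤ d)
    (hok : (build d κ lim ε S H a l).ok = true) :
    Balanced S d l (build d κ lim ε S H a l).node := by
  induction l with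
  | zero =>
    intro i hi
    obtain rfl : i = 0 := by simpa using hi
    simp [build, bucket, hS]
  | succ l ih =>
    simp only [build] at hok ⊢
    by_cases hb : (build d κ lim ε S H a l).ok = true
    swap
    · rw [if_neg hb] at hok
      exact absurd hok hb
    rw [if_pos hb] at hok ⊢
    have ih := ih (by omega) hb
    set b := build d κ lim ε S H a l with hbdef
    set r := levelRun d κ lim ε S H a l b.node with hr
    cases hst : r.status with
    | running => rw [hst] at hok; simp at hok
    | failure => rw [hst] at hok; simp at hok
    | success =>
      have hsucc := (levelRun_success (hr ▸ hst)).2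
      rw [← hr] at hsucc
      intro i hi
      simp only
      have hi2 : i / 2 < 2 ^ l := by rw [pow_succ] at hi; omega
      set s := seed (κ * d) (fragLen d ε l) r.σ (i / 2 + 1) with hs
      have hsp := (hsucc (i / 2 + 1) (by omega) (by omega)).2
      rw [Nat.add_sub_cancel, ← hs, splits, decide_eq_true_eq, ih _ hi2] at hsp
      have hpow : 2 ^ (d - l) = 2 * 2 ^ (d - (l + 1)) := by
        rw [← pow_succ']
        congr 1
        omega
      have htrue : ((bucket S b.node (i / 2)).filter
          (fun x => H (a, l, i / 2, s, x) = true)).card = 2 ^ (d - (l + 1)) := by omega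
      have hcompl := Finset.card_filter_add_card_filter_not (s := bucket S b.node (i / 2))
        (fun x => H (a, l, i / 2, s, x) = true)
      rw [ih _ hi2] at hcompl
      rcases Nat.mod_two_eq_zero_or_one i with hpar | hpar
      · rw [← show ((bucket S b.node (i / 2)).filter
          (fun x => ¬ H (a, l, i / 2, s, x) = true)).card = 2 ^ (d - (l + 1)) by omega]
        congr 1
        ext x
        rw [mem_bucket, Finset.mem_filter, mem_bucket]
        constructor
        · rintro ⟨hx, hxi⟩
          have hle := Bool.toNat_le (H (a, l, b.node x, seed (κ * d) (fragLen d ε l) r.σ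
            (b.node x + 1), x))
          have hxn : b.node x = i / 2 := by omega
          refine ⟨⟨hx, hxn⟩, ?_⟩
          rw [hxn, ← hs] at hxi
          intro hcon
          rw [hcon, Bool.toNat_true] at hxi
          omega
        · rintro ⟨⟨hx, hxn⟩, hf⟩
          refine ⟨hx, ?_⟩
          rw [hxn, ← hs, Bool.eq_false_iff.2 hf, Bool.toNat_false]
          omega
      · rw [← htrue]
        congr 1
        ext x
        rw [mem_bucket, Finset.mem_filter, mem_bucket]
        constructor
        · rintro ⟨hx, hxi⟩
          have hle := Bool.toNat_le (H (a, l, b.node x, seed (κ * d) (fragLen d ε l) r.σ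
            (b.node x + 1), x))
          have hxn : b.node x = i / 2 := by omega
          refine ⟨⟨hx, hxn⟩, ?_⟩
          rw [hxn, ← hs] at hxi
          by_contra hcon
          rw [Bool.eq_false_iff.2 hcon, Bool.toNat_false] at hxi
          omega
        · rintro ⟨⟨hx, hxn⟩, ht⟩
          refine ⟨hx, ?_⟩
          rw [hxn, ← hs, ht, Bool.toNat_true]
          omega

/-! ### Length of the output and time of one attempt -/

lemma length_toBits (k x : ℕ) : (toBits k x).length = k := by
  induction k with
  | zero => rfl
  | succ k ih => simp [toBits, ih]

lemma length_encode (N w : ℕ) (len σ : ℕ → ℕ) :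
    (encode N w len σ).length = w + ∑ j ∈ Finset.range N, len (j + 1) := by
  simp only [encode, List.length_append, length_toBits, List.length_flatMap]
  rfl

/-- The number of bits written for level `l`. -/
noncomputable def levelBits (d κ : ℕ) (ε : ℝ) (l : ℕ) : ℕ := κ * d + prefixLen d ε l (2 ^ l)

lemma length_encode_fragLen (hl : l < d) (hε0 : 0 < ε) (hε : ε ≤ 1) (σ : ℕ → ℕ) :
    (encode (2 ^ l) (κ * d) (fragLen d ε l) σ).length = levelBits d κ ε l := by
  have := sum_fragLen hl hε0 hε 0 (2 ^ l)
  rw [prefixLen_zero, add_zero, zero_add] at this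
  rw [length_encode, levelBits, ← this]
  simp only [zero_add]

lemma length_bits_le (hε0 : 0 < ε) (hε : ε ≤ 1) (hl : l ≤ d) :
    (build d κ lim ε S H a l).bits.length ≤ ∑ l' ∈ Finset.range l, levelBits d κ ε l' := by
  induction l with
  | zero => simp [build]
  | succ l ih =>
    have ih := ih (by omega)
    rw [Finset.sum_range_succ]
    simp only [build]
    split_ifs with hok
    · cases (levelRun d κ lim ε S H a l (build d κ lim ε S H a l).node).status with
      | success =>
        simp only [List.length_append, length_encode_fragLen (by omega : l < d) hε0 hε]
        omega
      | running => simp only; omega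
      | failure => simp only; omega
    · omega

open Classical in
/-- An upper bound for the number of steps of the search on level `l`. -/
noncomputable def levelSteps (d lim : ℕ) (ε : ℝ) (S : Finset U) (a l : ℕ)
    (H : HashIndex U → Bool) : ℝ≥0∞ :=
  if (build d (wordFactor lim) lim ε S H a l).ok = true then
    stepBound (2 ^ l) (wordFactor lim * d) (2 ^ (capExp lim * d)) (fragLen d ε l) (2 ^ (lim * d))
      (levelTrials S H a l (build d (wordFactor lim) lim ε S H a l).node)
  else 0

lemma dependsOn_levelSteps (hl : l < d) : DependsOn (levelSteps d lim ε S a l)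
    (hashBits d (wordFactor lim * d) S a (Finset.range (l + 1)) : Set (HashIndex U)) := by
  intro H H' hH
  obtain ⟨h1, -, -, h4⟩ := build_congr (κ := wordFactor lim) (lim := lim) (ε := ε) (H := H)
    (H' := H') (l := l) (a := a) (S := S) hl.le fun k hk => hH k (by
      rw [Finset.mem_coe, mem_hashBits] at *
      exact ⟨hk.1, Finset.mem_range.2 (by have := Finset.mem_range.1 hk.2.1; omega), hk.2.2⟩)
  have hlt : ∀ x ∈ S, (build d (wordFactor lim) lim ε S H a l).node x < 2 ^ d := fun x _ =>
    (build_node_lt x).trans_le (Nat.pow_le_pow_right (by norm_num) (by omega))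
  simp only [levelSteps, h1]
  split_ifs
  · refine dependsOn_stepBound _ fun k hk => ?_
    rw [Finset.mem_coe, mem_trials] at hk
    refine levelTrials_congr (w := wordFactor lim * d) h4 hlt (fun k hk => hH k ?_) hk.2
    rw [Finset.mem_coe, mem_hashBits] at *
    exact ⟨hk.1, Finset.mem_range.2 (by have := Finset.mem_singleton.1 hk.2.1; omega), hk.2.2⟩
  · rfl

lemma two_pow_capExp_le : 2 ^ (capExp lim * d) ≤ 2 ^ (wordFactor lim * d) :=
  Nat.pow_le_pow_right (by norm_num) (Nat.mul_le_mul_right _ (by rw [wordFactor]; omega))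

/-- If an attempt fails, then some level takes many steps. -/
lemma le_sum_levelSteps (hf : (build d (wordFactor lim) lim ε S H a l).ok = false) :
    ((2 ^ (lim * d) : ℕ) : ℝ≥0∞) ≤ ∑ l' ∈ Finset.range l, levelSteps d lim ε S a l' H := by
  induction l with
  | zero => simp [build] at hf
  | succ l ih =>
    rw [Finset.sum_range_succ]
    by_cases hb : (build d (wordFactor lim) lim ε S H a l).ok = true
    · refine le_add_left ?_
      rw [levelSteps, if_pos hb]
      refine limit_le_stepBound (cost := fun i => (bucket S
        (build d (wordFactor lim) lim ε S H a l).node (i - 1)).card) Nat.one_le_two_pow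
        two_pow_capExp_le fun hst => ?_
      rw [← levelRun_eq] at hst
      simp only [build] at hf
      rw [if_pos hb, hst] at hf
      simp at hf
    · exact le_add_right (ih (by simpa using hb))

/-- As long as no level has failed, all buckets have the same size `2 ^ (d - l)`, so the search pays
a uniform price per step. After a failure nothing more is spent. -/
lemma build_time_succ_le (hS : S.card = 2 ^ d) (hε0 : 0 < ε) (hε : ε ≤ 1) (hl : l < d) :
    ((build d (wordFactor lim) lim ε S H a (l + 1)).time : ℝ≥0∞)
      ≤ (build d (wordFactor lim) lim ε S H a l).time
        + ((2 + 2 ^ l + 2 * 2 ^ d + levelBits d (wordFactor lim) ε l : ℕ) : ℝ≥0∞)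
        + ((2 ^ (d - l) + 2 : ℕ) : ℝ≥0∞) * levelSteps d lim ε S a l H := by
  simp only [build]
  by_cases hb : (build d (wordFactor lim) lim ε S H a l).ok = true
  swap
  · rw [if_neg hb, add_assoc]
    exact le_self_add
  rw [if_pos hb]
  have hbal := build_balanced hS hl.le hb
  have htime : ((levelRun d (wordFactor lim) lim ε S H a l
      (build d (wordFactor lim) lim ε S H a l).node).time : ℝ≥0∞)
      ≤ 2 + ((2 ^ (d - l) + 2 : ℕ) : ℝ≥0∞) * levelSteps d lim ε S a l H := by
    rw [levelRun_eq]
    refine (Nat.cast_le.2 (time_le (m := 2 ^ (d - l)) Nat.one_le_two_pow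
      (fun i h1 h2 => hbal (i - 1) (by omega)) _)).trans ?_
    push_cast
    gcongr
    rw [levelSteps, if_pos hb]
    exact card_activeTimes_le_stepBound Nat.one_le_two_pow _
  set r := levelRun d (wordFactor lim) lim ε S H a l
    (build d (wordFactor lim) lim ε S H a l).node with hr
  have hmain : ∀ t : ℕ, t ≤ (build d (wordFactor lim) lim ε S H a l).time + 2 ^ l + r.time
        + 2 * 2 ^ d + levelBits d (wordFactor lim) ε l →
      (t : ℝ≥0∞) ≤ (build d (wordFactor lim) lim ε S H a l).time
        + ((2 + 2 ^ l + 2 * 2 ^ d + levelBits d (wordFactor lim) ε l : ℕ) : ℝ≥0∞)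
        + ((2 ^ (d - l) + 2 : ℕ) : ℝ≥0∞) * levelSteps d lim ε S a l H := by
    intro t ht
    calc (t : ℝ≥0∞) ≤ (((build d (wordFactor lim) lim ε S H a l).time + 2 ^ l + r.time
        + 2 * 2 ^ d + levelBits d (wordFactor lim) ε l : ℕ) : ℝ≥0∞) := Nat.cast_le.2 ht
      _ = (build d (wordFactor lim) lim ε S H a l).time
        + ((2 ^ l + 2 * 2 ^ d + levelBits d (wordFactor lim) ε l : ℕ) : ℝ≥0∞) + r.time := by
          push_cast
          ring
      _ ≤ (build d (wordFactor lim) lim ε S H a l).time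
        + ((2 ^ l + 2 * 2 ^ d + levelBits d (wordFactor lim) ε l : ℕ) : ℝ≥0∞)
        + (2 + ((2 ^ (d - l) + 2 : ℕ) : ℝ≥0∞) * levelSteps d lim ε S a l H) := by gcongr
      _ = _ := by
          push_cast
          ring
  cases hst : r.status with
  | success =>
    refine hmain _ ?_
    simp only [length_encode_fragLen hl hε0 hε, hS]
    omega
  | running => exact hmain _ (by simp only; omega)
  | failure => exact hmain _ (by simp only; omega)

/-- The time of an attempt in terms of the numbers of steps on the levels. -/
lemma build_time_le (hS : S.card = 2 ^ d) (hε0 : 0 < ε) (hε : ε ≤ 1) (hl : l ≤ d) :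
    ((build d (wordFactor lim) lim ε S H a l).time : ℝ≥0∞)
      ≤ ((2 ^ d + 1 : ℕ) : ℝ≥0∞) + ∑ l' ∈ Finset.range l,
        (((2 + 2 ^ l' + 2 * 2 ^ d + levelBits d (wordFactor lim) ε l' : ℕ) : ℝ≥0∞)
        + ((2 ^ (d - l') + 2 : ℕ) : ℝ≥0∞) * levelSteps d lim ε S a l' H) := by
  induction l with
  | zero => simp [build, hS]
  | succ l ih =>
    rw [Finset.sum_range_succ, ← add_assoc, ← add_assoc]
    refine (build_time_succ_le hS hε0 hε (by omega)).trans ?_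
    gcongr
    exact ih (by omega)

end Build

/-! ## Expectations for the construction -/

section BuildProbability

variable {Ω : Type*} [MeasurableSpace Ω] {P : Measure Ω}

/-- The probability that exactly half of an even number of fair bits are `true`. -/
lemma prob_half_true {ι : Type*} {h : ι → Ω → Bool} (hm : ∀ k, Measurable (h k))
    (hh : ∀ k, P {ω | h k ω = true} = 1 / 2) (hi : iIndepFun h P) (T : Finset ι) {r : ℕ}
    (hT : T.card = 2 * r) :
    P {ω | 2 * (T.filter (fun k => h k ω = true)).card = T.card}
      = ENNReal.ofReal (splitProb T.card) := by
  classical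
  have := hi.isProbabilityMeasure
  have hf : ∀ k, P {ω | h k ω = false} = 1 / 2 := by
    intro k
    have h1 : {ω | h k ω = false} = {ω | h k ω = true}ᶜ := by ext ω; simp
    have hms : MeasurableSet {ω | h k ω = true} := hm _ (MeasurableSet.singleton true)
    rw [h1, prob_compl_eq_one_sub hms, hh, one_div, ENNReal.one_sub_inv_two]
  have hA : ∀ A : Finset ι, P {ω | ∀ k ∈ T, h k ω = decide (k ∈ A)} = (1 / 2) ^ T.card := by
    intro A
    have := hi.meas_biInter (S := T) (s := fun k => {ω | h k ω = decide (k ∈ A)})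
      (fun k _ => ⟨{decide (k ∈ A)}, trivial, by ext; simp⟩)
    rw [Finset.prod_congr rfl (g := fun _ => 1 / 2), Finset.prod_const] at this
    · rw [← this]
      congr 1
      ext; simp
    · intro k _
      by_cases hk : k ∈ A
      · simpa [hk] using hh k
      · simpa [hk] using hf k
  have hAm : ∀ A : Finset ι, MeasurableSet {ω | ∀ k ∈ T, h k ω = decide (k ∈ A)} := by
    intro A
    have : {ω | ∀ k ∈ T, h k ω = decide (k ∈ A)} = ⋂ k ∈ T, h k ⁻¹' {decide (k ∈ A)} := by
      ext; simp
    rw [this]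
    exact Finset.measurableSet_biInter _ fun k _ => hm k (MeasurableSet.singleton _)
  have hU : {ω | 2 * (T.filter (fun k => h k ω = true)).card = T.card}
      = ⋃ A ∈ T.powersetCard r, {ω | ∀ k ∈ T, h k ω = decide (k ∈ A)} := by
    ext ω
    simp only [Set.mem_iUnion, Finset.mem_powersetCard, exists_prop]
    constructor
    · intro hω
      refine ⟨T.filter (fun k => h k ω = true), ⟨Finset.filter_subset _ _, ?_⟩, fun k hk => ?_⟩
      · have : 2 * (T.filter (fun k => h k ω = true)).card = T.card := hω
        omega
      · simp [hk]
    · rintro ⟨A, ⟨hAT, hAr⟩, hω⟩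
      have : T.filter (fun k => h k ω = true) = A := by
        ext k
        rw [Finset.mem_filter]
        constructor
        · rintro ⟨hk, hk'⟩
          have := hω k hk
          rw [hk'] at this
          simpa using this.symm
        · intro hk
          refine ⟨hAT hk, ?_⟩
          rw [hω k (hAT hk)]
          simpa using hk
      change 2 * (T.filter (fun k => h k ω = true)).card = T.card
      rw [this]
      omega
  rw [hU, measure_biUnion_finset _ fun A _ => hAm A, Finset.sum_congr rfl fun A _ => hA A,
    Finset.sum_const, Finset.card_powersetCard, splitProb, nsmul_eq_mul,
    ENNReal.ofReal_div_of_pos (by positivity), ENNReal.ofReal_natCast,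
    ENNReal.ofReal_pow (by norm_num), ENNReal.ofReal_ofNat, one_div, ← ENNReal.inv_pow, hT,
    Nat.mul_div_cancel_left r (by norm_num), div_eq_mul_inv]
  intro A hAr B hBr hAB
  rw [Function.onFun, Set.disjoint_left]
  intro ω h1 h2
  apply hAB
  ext k
  have hsub : ∀ C ∈ T.powersetCard r, k ∈ C → k ∈ T := fun C hC hk =>
    (Finset.mem_powersetCard.1 hC).1 hk
  by_cases hk : k ∈ T
  · have := (h1 k hk).symm.trans (h2 k hk)
    simpa using this
  · exact ⟨fun h => absurd (hsub A hAr h) hk, fun h => absurd (hsub B hBr h) hk⟩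

variable {U : Type*} {S : Finset U} {h : HashIndex U → Ω → Bool} {a l d lim : ℕ} {ε : ℝ}
  {node : U → ℕ}

/-- The hash bits that determine the outcome of a trial. -/
def trialBits (S : Finset U) (a l : ℕ) (node : U → ℕ) (k : ℕ × ℕ) : Finset (HashIndex U) :=
  {a} ×ˢ {l} ×ˢ {k.1} ×ˢ {k.2} ×ˢ bucket S node k.1

lemma mem_trialBits {k : ℕ × ℕ} {j : HashIndex U} : j ∈ trialBits S a l node k ↔
    j.1 = a ∧ j.2.1 = l ∧ j.2.2.1 = k.1 ∧ j.2.2.2.1 = k.2 ∧ j.2.2.2.2 ∈ bucket S node k.1 := by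
  obtain ⟨a', l', i, s, x⟩ := j
  simp only [trialBits, Finset.mem_product, Finset.mem_singleton]

lemma dependsOn_levelTrials (k : ℕ × ℕ) :
    DependsOn (fun H : HashIndex U → Bool => levelTrials S H a l node k)
      (trialBits S a l node k : Set (HashIndex U)) := by
  intro H H' hH
  refine splits_congr (fun _ _ => rfl) fun x hx => hH _ ?_
  rw [Finset.mem_coe, mem_trialBits]
  exact ⟨rfl, rfl, rfl, rfl, hx⟩

/-- For a fixed assignment of keys to nodes, trials of different node-seed pairs read disjoint sets
of hash bits. -/
lemma iIndepFun_levelTrials [IsProbabilityMeasure P] (hm : ∀ k, Measurable (h k))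
    (hi : iIndepFun h P) :
    iIndepFun (fun k ω => levelTrials S (fun j => h j ω) a l node k) P := by
  refine iIndepFun_blocks hm hi (fun k => dependsOn_levelTrials k) fun k k' hkk => ?_
  rw [Finset.disjoint_left]
  intro j hj hj'
  rw [mem_trialBits] at hj hj'
  exact hkk (Prod.ext (by rw [← hj.2.2.1, hj'.2.2.1]) (by rw [← hj.2.2.2.1, hj'.2.2.2.1]))

lemma measurable_levelTrials (hm : ∀ k, Measurable (h k)) (k : ℕ × ℕ) :
    Measurable (fun ω => levelTrials S (fun j => h j ω) a l node k) :=
  measurable_of_dependsOn hm (dependsOn_levelTrials k)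

lemma prob_levelTrials (hm : ∀ k, Measurable (h k)) (hh : ∀ k, P {ω | h k ω = true} = 1 / 2)
    (hi : iIndepFun h P) (hl : l < d) (hbal : Balanced S d l node) {i s : ℕ} (hil : i < 2 ^ l) :
    P {ω | levelTrials S (fun j => h j ω) a l node (i, s) = true}
      = ENNReal.ofReal (splitProb (2 ^ (d - l))) := by
  have hinj : Function.Injective (fun x : U => ((a, l, i, s, x) : HashIndex U)) := by
    intro x y hxy
    simpa using hxy
  have hcard := hbal i hil
  have key := prob_half_true (h := fun x => h (a, l, i, s, x)) (r := 2 ^ (d - l - 1))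
    (fun x => hm _) (fun x => hh _) (hi.precomp hinj) (bucket S node i) (by
      rw [hcard, ← pow_succ']
      congr 1
      omega)
  rw [hcard] at key
  rw [← key]
  congr 1
  ext ω
  simp [levelTrials, splits, hcard]

/-- The bound for the expected number of steps of the search on a level. -/
noncomputable def levelTime (d : ℕ) (ε : ℝ) (l : ℕ) : ℝ :=
  2 ^ l * (8 / (splitProb (2 ^ (d - l)) * levelEps d ε l)) + 1

/-- The expected number of steps of the search on a level. -/
lemma lintegral_levelSteps_le [IsProbabilityMeasure P] (hm : ∀ k, Measurable (h k))
    (hh : ∀ k, P {ω | h k ω = true} = 1 / 2) (hi : iIndepFun h P) (hS : S.card = 2 ^ d)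
    (hl : l < d) (hε : ε ≤ 1) (hε1 : 1 / 2 ^ d ≤ ε) :
    ∫⁻ ω, levelSteps d lim ε S a l (fun k => h k ω) ∂P
      ≤ ENNReal.ofReal (levelTime d ε l) := by
  classical
  set T := ENNReal.ofReal (levelTime d ε l) with hT
  -- The freezing lemma needs countably many values, so only the nodes of the keys in `S` are
  -- frozen, and the assignment is extended by the irrelevant default 0. Unbalanced assignments are
  -- given the value 0 in `f`, since for them the trials would have the wrong probability.
  let ext : (S → ℕ) → U → ℕ := fun ν x => if hx : x ∈ S then ν ⟨x, hx⟩ else 0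
  let Z : (HashIndex U → Bool) → (S → ℕ) × Bool := fun H =>
    (fun x => (build d (wordFactor lim) lim ε S H a l).node x,
      (build d (wordFactor lim) lim ε S H a l).ok)
  let f : (S → ℕ) × Bool → (HashIndex U → Bool) → ℝ≥0∞ := fun z H =>
    if Balanced S d l (ext z.1) ∧ (∀ x ∈ S, ext z.1 x < 2 ^ d) ∧ z.2 = true then
      stepBound (2 ^ l) (wordFactor lim * d) (2 ^ (capExp lim * d)) (fragLen d ε l) (2 ^ (lim * d))
        (levelTrials S H a l (ext z.1))
    else 0
  have hext : ∀ H, ∀ x ∈ S, (build d (wordFactor lim) lim ε S H a l).node x = ext (Z H).1 x := by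
    intro H x hx
    simp [ext, Z, hx]
  have hZ : DependsOn Z
      (hashBits d (wordFactor lim * d) S a (Finset.range l) : Set (HashIndex U)) := by
    intro H H' hH
    obtain ⟨h1, -, -, h4⟩ := build_congr (κ := wordFactor lim) (lim := lim) (ε := ε) (l := l)
      (a := a) (S := S) hl.le fun k hk => hH k hk
    exact Prod.ext (funext fun x => h4 x x.2) h1
  have hf : ∀ z, DependsOn (f z)
      (hashBits d (wordFactor lim * d) S a {l} : Set (HashIndex U)) := by
    intro z H H' hH
    simp only [f]
    split_ifs with hz
    · refine dependsOn_stepBound _ fun k hk => ?_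
      rw [Finset.mem_coe, mem_trials] at hk
      exact levelTrials_congr (fun _ _ => rfl) hz.2.1 (fun k hk => hH k hk) hk.2
    · rfl
  have hdisj : Disjoint (hashBits d (wordFactor lim * d) S a (Finset.range l))
      (hashBits d (wordFactor lim * d) S a {l}) := by
    rw [Finset.disjoint_left]
    intro k hk hk'
    rw [mem_hashBits] at hk hk'
    have h1 := Finset.mem_range.1 hk.2.1
    have h2 := Finset.mem_singleton.1 hk'.2.1
    omega
  have hle : ∀ H, levelSteps d lim ε S a l H ≤ f (Z H) H := by
    intro H
    rw [levelSteps]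
    split_ifs with hok
    · have hbal := build_balanced hS hl.le hok
      have hb : Balanced S d l (ext (Z H).1) := fun i hi => by
        rw [← bucket_congr (hext H) i]
        exact hbal i hi
      have hlt : ∀ x ∈ S, ext (Z H).1 x < 2 ^ d := fun x hx => by
        rw [← hext H x hx]
        exact (build_node_lt x).trans_le (Nat.pow_le_pow_right (by norm_num) hl.le)
      simp only [f]
      rw [if_pos ⟨hb, hlt, hok⟩]
      refine le_of_eq (congrArg _ (funext fun k => ?_))
      exact splits_congr (hext H) fun _ _ => rfl
    · exact zero_le
  calc ∫⁻ ω, levelSteps d lim ε S a l (fun k => h k ω) ∂P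
      ≤ ∫⁻ ω, f (Z (fun k => h k ω)) (fun k => h k ω) ∂P := lintegral_mono fun ω => hle _
    _ ≤ ∫⁻ _, T ∂P := lintegral_freeze hm hi hZ hf (fun _ => hdisj) (g := fun _ => T) fun z => by
        simp only [f]
        split_ifs with hz
        · exact lintegral_stepBound_level_le hl hε hε1 (measurable_levelTrials hm)
            (iIndepFun_levelTrials hm hi) fun j hj s _ => prob_levelTrials hm hh hi hl hz.1 hj
        · simp
    _ = T := by simp

/-! ### Restarts: independent attempts and geometric series -/

lemma dependsOn_attempt (κ : ℕ) : DependsOn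
    (fun H => ((attempt d κ lim ε S H a).ok, (attempt d κ lim ε S H a).time))
    (hashBits d (κ * d) S a (Finset.range d) : Set (HashIndex U)) := by
  intro H H' hH
  obtain ⟨h1, -, h3, -⟩ := build_congr (κ := κ) (lim := lim) (ε := ε) (l := d)
    (a := a) (S := S) le_rfl fun k hk => hH k hk
  exact Prod.ext h1 h3

/-- The probability that an attempt fails. -/
lemma prob_attempt_fails_le (hm : ∀ k, Measurable (h k)) {T : ℕ → ℝ≥0∞}
    (hT : ∀ l < d, ∀ a, ∫⁻ ω, levelSteps d lim ε S a l (fun k => h k ω) ∂P ≤ T l) (a : ℕ) :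
    P {ω | (attempt d (wordFactor lim) lim ε S (fun k => h k ω) a).ok = false}
      ≤ (∑ l ∈ Finset.range d, T l) / 2 ^ (lim * d) := by
  have hmeas : ∀ l ∈ Finset.range d,
      Measurable fun ω => levelSteps d lim ε S a l (fun k => h k ω) := fun l hl =>
    measurable_of_dependsOn hm (dependsOn_levelSteps (Finset.mem_range.1 hl))
  rw [ENNReal.le_div_iff_mul_le (by simp) (by simp)]
  calc P {ω | (attempt d (wordFactor lim) lim ε S (fun k => h k ω) a).ok = false} * 2 ^ (lim * d)
      ≤ 2 ^ (lim * d) * P {ω | 2 ^ (lim * d)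
          ≤ ∑ l ∈ Finset.range d, levelSteps d lim ε S a l (fun k => h k ω)} := by
        rw [mul_comm]
        gcongr with ω
        intro hω
        have := le_sum_levelSteps (l := d) hω
        exact_mod_cast this
    _ ≤ ∫⁻ ω, ∑ l ∈ Finset.range d, levelSteps d lim ε S a l (fun k => h k ω) ∂P :=
        mul_meas_ge_le_lintegral (Finset.measurable_sum _ hmeas) _
    _ ≤ ∑ l ∈ Finset.range d, T l := by
        rw [lintegral_finsetSum _ hmeas]
        exact Finset.sum_le_sum fun l hl => hT l (Finset.mem_range.1 hl) a

/-- The expected time of an attempt. -/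
lemma lintegral_attempt_time_le [IsProbabilityMeasure P] (hm : ∀ k, Measurable (h k))
    {T : ℕ → ℝ≥0∞}
    (hT : ∀ l < d, ∀ a, ∫⁻ ω, levelSteps d lim ε S a l (fun k => h k ω) ∂P ≤ T l)
    (hS : S.card = 2 ^ d) (hε0 : 0 < ε) (hε : ε ≤ 1) (a : ℕ) :
    ∫⁻ ω, ((attempt d (wordFactor lim) lim ε S (fun k => h k ω) a).time : ℝ≥0∞) ∂P
      ≤ ((2 ^ d + 1 : ℕ) : ℝ≥0∞) + ∑ l ∈ Finset.range d,
        (((2 + 2 ^ l + 2 * 2 ^ d + levelBits d (wordFactor lim) ε l : ℕ) : ℝ≥0∞)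
        + ((2 ^ (d - l) + 2 : ℕ) : ℝ≥0∞) * T l) := by
  have hmeas : ∀ l ∈ Finset.range d,
      Measurable fun ω => levelSteps d lim ε S a l (fun k => h k ω) := fun l hl =>
    measurable_of_dependsOn hm (dependsOn_levelSteps (Finset.mem_range.1 hl))
  refine (lintegral_mono fun ω => build_time_le hS hε0 hε le_rfl).trans ?_
  have hmeas' : ∀ l ∈ Finset.range d, Measurable fun ω =>
      ((2 + 2 ^ l + 2 * 2 ^ d + levelBits d (wordFactor lim) ε l : ℕ) : ℝ≥0∞)
        + ((2 ^ (d - l) + 2 : ℕ) : ℝ≥0∞) * levelSteps d lim ε S a l (fun k => h k ω) :=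
    fun l hl => measurable_const.add ((hmeas l hl).const_mul _)
  rw [lintegral_add_left measurable_const, lintegral_finsetSum _ hmeas']
  simp only [lintegral_const, measure_univ, mul_one]
  gcongr with l hl
  rw [lintegral_add_left measurable_const, lintegral_const_mul _ (hmeas l hl)]
  simp only [lintegral_const, measure_univ, mul_one]
  gcongr
  exact hT l (Finset.mem_range.1 hl) a

/-- The hash functions for which the first `a` attempts fail. -/
def failsBefore (d κ lim : ℕ) (ε : ℝ) (S : Finset U) (a : ℕ) : Set (HashIndex U → Bool) :=
  {H | ∀ b < a, (attempt d κ lim ε S H b).ok = false}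

/-- The hash bits that are used by the first `a` attempts. -/
def attemptBits (d w : ℕ) (S : Finset U) (a : ℕ) : Finset (HashIndex U) :=
  Finset.range a ×ˢ Finset.range d ×ˢ Finset.range (2 ^ d) ×ˢ Finset.range (2 ^ w) ×ˢ S

lemma hashBits_subset_attemptBits {w b : ℕ} (hb : b < a) :
    hashBits d w S b (Finset.range d) ⊆ attemptBits d w S a := by
  rintro ⟨b', l, i, s, x⟩ hk
  rw [mem_hashBits] at hk
  simp only [attemptBits, Finset.mem_product, Finset.mem_range]
  obtain ⟨h1, h2, h3, h4, h5⟩ := hk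
  exact ⟨by simp only at h1; omega, Finset.mem_range.1 h2, h3, h4, h5⟩

lemma attemptBits_disjoint {w : ℕ} {L : Finset ℕ} :
    Disjoint (attemptBits d w S a) (hashBits d w S a L) := by
  rw [Finset.disjoint_left]
  rintro ⟨b', l, i, s, x⟩ hk hk'
  rw [mem_hashBits] at hk'
  simp only [attemptBits, Finset.mem_product, Finset.mem_range] at hk
  have := hk'.1
  simp only at this
  omega

lemma dependsOn_failsBefore (κ : ℕ) :
    DependsOn (fun H => H ∈ failsBefore d κ lim ε S a)
      (attemptBits d (κ * d) S a : Set (HashIndex U)) := by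
  intro H H' hH
  simp only [eq_iff_iff, failsBefore, Set.mem_ofPred_eq]
  refine forall₂_congr fun b hb => ?_
  have := dependsOn_attempt (d := d) (lim := lim) (ε := ε) (S := S) (a := b) κ (x := H) (y := H')
    fun k hk => hH k (hashBits_subset_attemptBits hb hk)
  rw [(Prod.mk.inj this).1]

lemma measurableSet_failsBefore (hm : ∀ k, Measurable (h k)) (κ : ℕ) :
    MeasurableSet {ω | (fun k => h k ω) ∈ failsBefore d κ lim ε S a} :=
  measurableSet_of_dependsOn hm (dependsOn_failsBefore κ)

/-- An attempt is independent of the failure of the previous ones. -/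
lemma lintegral_failsBefore_le [IsProbabilityMeasure P] (hm : ∀ k, Measurable (h k))
    (hi : iIndepFun h P) {κ : ℕ} (G : Bool × ℕ → ℝ≥0∞) {D : ℝ≥0∞}
    (hD : ∫⁻ ω, G ((attempt d κ lim ε S (fun k => h k ω) a).ok,
        (attempt d κ lim ε S (fun k => h k ω) a).time) ∂P ≤ D) :
    ∫⁻ ω, (failsBefore d κ lim ε S a).indicator (fun H => G ((attempt d κ lim ε S H a).ok,
        (attempt d κ lim ε S H a).time)) (fun k => h k ω) ∂P
      ≤ P {ω | (fun k => h k ω) ∈ failsBefore d κ lim ε S a} * D := by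
  classical
  -- The frozen value is the truth value of "all earlier attempts failed", which reads only bits of
  -- attempts with smaller numbers.
  refine (lintegral_freeze (α := Bool) (Z := fun H => decide (H ∈ failsBefore d κ lim ε S a))
    (I := attemptBits d (κ * d) S a) hm hi (fun H H' hH => ?_)
    (f := fun z H => if z then G ((attempt d κ lim ε S H a).ok, (attempt d κ lim ε S H a).time)
      else 0) (J := fun _ => hashBits d (κ * d) S a (Finset.range d))
    (fun z H H' hH => ?_) (fun _ => attemptBits_disjoint)
    (g := fun z => if z then D else 0) fun z => ?_).trans' (le_of_eq ?_) |>.trans (le_of_eq ?_)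
  · have := dependsOn_failsBefore (d := d) (lim := lim) (ε := ε) (S := S) (a := a) κ hH
    simp only [eq_iff_iff] at this
    simp only [this]
  · have := dependsOn_attempt (d := d) (lim := lim) (ε := ε) (S := S) (a := a) κ hH
    simp only at this
    simp only [this]
  · cases z
    · simp
    · simpa using hD
  · refine lintegral_congr fun ω => ?_
    simp only [Set.indicator_apply, decide_eq_true_eq]
  · rw [mul_comm, ← lintegral_indicator_const (measurableSet_failsBefore hm κ)]
    refine lintegral_congr fun ω => ?_
    simp only [Set.indicator_apply, decide_eq_true_eq, Set.mem_ofPred_eq]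

/-- Attempts fail independently. -/
lemma prob_failsBefore_le [IsProbabilityMeasure P] (hm : ∀ k, Measurable (h k))
    (hi : iIndepFun h P) {κ : ℕ} {q : ℝ≥0∞}
    (hq : ∀ a, P {ω | (attempt d κ lim ε S (fun k => h k ω) a).ok = false} ≤ q) (a : ℕ) :
    P {ω | (fun k => h k ω) ∈ failsBefore d κ lim ε S a} ≤ q ^ a := by
  classical
  induction a with
  | zero => rw [pow_zero]; exact prob_le_one
  | succ a ih =>
    have hma : MeasurableSet {ω | (attempt d κ lim ε S (fun k => h k ω) a).ok = false} :=
      measurableSet_of_dependsOn hm (E := fun H => (attempt d κ lim ε S H a).ok = false)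
        fun H H' hH => by
          have := (Prod.mk.inj (dependsOn_attempt (d := d) (lim := lim) (ε := ε) (S := S)
            (a := a) κ hH)).1
          simp only [this]
    have h1 := lintegral_failsBefore_le (a := a) hm hi (fun z => if z.1 = false then 1 else 0)
      (D := q) (κ := κ) (lim := lim) (ε := ε) (S := S) (d := d) (by
        refine le_trans (le_of_eq ?_) (hq a)
        rw [← lintegral_indicator_one hma]
        refine lintegral_congr fun ω => ?_
        simp [Set.indicator_apply])
    rw [← lintegral_indicator_one (measurableSet_failsBefore hm κ), pow_succ]
    refine le_trans (le_of_eq ?_) (h1.trans (by gcongr))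
    refine lintegral_congr fun ω => ?_
    have : (fun k => h k ω) ∈ failsBefore d κ lim ε S (a + 1)
        ↔ (fun k => h k ω) ∈ failsBefore d κ lim ε S a
          ∧ (attempt d κ lim ε S (fun k => h k ω) a).ok = false := by
      simp only [failsBefore, Set.mem_ofPred_eq]
      exact Nat.forall_lt_succ_right
    simp only [Set.indicator_apply, Set.mem_ofPred_eq, this, Pi.one_apply, ite_and]

/-- The total of a quantity over all attempts up to the first successful one is bounded by a
geometric series. -/
lemma lintegral_attempts_le [IsProbabilityMeasure P] (hm : ∀ k, Measurable (h k))
    (hi : iIndepFun h P) {κ : ℕ} {q C : ℝ≥0∞} (F : Bool × ℕ → ℝ≥0∞)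
    (hq : ∀ a, P {ω | (attempt d κ lim ε S (fun k => h k ω) a).ok = false} ≤ q)
    (hC : ∀ a, ∫⁻ ω, F ((attempt d κ lim ε S (fun k => h k ω) a).ok,
      (attempt d κ lim ε S (fun k => h k ω) a).time) ∂P ≤ C) :
    ∫⁻ ω, ∑' a : ℕ, (failsBefore d κ lim ε S a).indicator
      (fun H => F ((attempt d κ lim ε S H a).ok, (attempt d κ lim ε S H a).time))
      (fun k => h k ω) ∂P ≤ (1 - q)⁻¹ * C := by
  rw [lintegral_tsum]
  · calc _ ≤ ∑' a, q ^ a * C := ENNReal.tsum_le_tsum fun a =>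
          (lintegral_failsBefore_le hm hi F (hC a)).trans (by
            gcongr
            exact prob_failsBefore_le hm hi hq a)
      _ = _ := by rw [ENNReal.tsum_mul_right, ENNReal.tsum_geometric]
  · intro a
    have hQ : DependsOn (fun H => (failsBefore d κ lim ε S a).indicator
        (fun H => F ((attempt d κ lim ε S H a).ok, (attempt d κ lim ε S H a).time)) H)
        (attemptBits d (κ * d) S (a + 1) : Set (HashIndex U)) := by
      classical
      intro H H' hH
      have key : ∀ b < a + 1, ((attempt d κ lim ε S H b).ok, (attempt d κ lim ε S H b).time)
          = ((attempt d κ lim ε S H' b).ok, (attempt d κ lim ε S H' b).time) := fun b hb =>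
        dependsOn_attempt κ fun k hk => hH k (hashBits_subset_attemptBits hb hk)
      simp only [Set.indicator_apply, key a (Nat.lt_succ_self a)]
      refine if_congr (forall₂_congr fun b hb => ?_) rfl rfl
      rw [(Prod.mk.inj (key b (by omega))).1]
    exact (measurable_of_dependsOn hm hQ).aemeasurable

lemma constructionTime_eq (κ : ℕ) (H : HashIndex U → Bool) :
    constructionTime d κ lim ε S H = ∑' a : ℕ, (failsBefore d κ lim ε S a).indicator
      (fun H => ((attempt d κ lim ε S H a).time : ℝ≥0∞)) H := by
  classical
  rw [constructionTime]
  refine tsum_congr fun a => ?_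
  rw [Set.indicator_apply]
  exact if_congr Iff.rfl rfl rfl

end BuildProbability

/-! ## Queries -/

lemma foldl_bits (l : List Bool) (c : ℕ) :
    l.foldl (fun acc b => 2 * acc + b.toNat) c = c * 2 ^ l.length + ofBits l := by
  induction l generalizing c with
  | nil => simp [ofBits]
  | cons b l ih =>
    rw [ofBits, List.foldl_cons, List.foldl_cons, ih, ih (2 * 0 + b.toNat), List.length_cons]
    ring

lemma ofBits_cons (b : Bool) (l : List Bool) :
    ofBits (b :: l) = b.toNat * 2 ^ l.length + ofBits l := by
  rw [ofBits, List.foldl_cons, foldl_bits, mul_zero, zero_add]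

lemma ofBits_append (l m : List Bool) :
    ofBits (l ++ m) = ofBits l * 2 ^ m.length + ofBits m := by
  rw [ofBits, List.foldl_append, foldl_bits]
  rfl

lemma ofBits_lt (l : List Bool) : ofBits l < 2 ^ l.length := by
  induction l with
  | nil => simp [ofBits]
  | cons b l ih =>
    rw [ofBits_cons, List.length_cons, pow_succ]
    have := Nat.mul_le_mul_right (2 ^ l.length) (Bool.toNat_le b)
    omega

lemma ofBits_drop (l : List Bool) {k i : ℕ} (h : l.length = k + i) :
    ofBits (l.drop i) = ofBits l % 2 ^ k := by
  have hk : (l.drop i).length = k := by rw [List.length_drop]; omega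
  conv_rhs => rw [← List.take_append_drop i l, ofBits_append, hk]
  rw [Nat.mul_comm, Nat.mul_add_mod, Nat.mod_eq_of_lt (hk ▸ ofBits_lt _)]

lemma ofBits_toBits {k x : ℕ} (h : x < 2 ^ k) : ofBits (toBits k x) = x := by
  have key : ∀ k, ofBits (toBits k x) = x % 2 ^ k := by
    intro k
    induction k with
    | zero => simp [toBits, ofBits, Nat.mod_one]
    | succ k ih =>
      rw [toBits, ofBits_cons, ih, length_toBits, Nat.mod_pow_succ, Nat.toNat_testBit]
      ring
  rw [key, Nat.mod_eq_of_lt h]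

lemma encode_succ (N w : ℕ) (len σ : ℕ → ℕ) :
    encode (N + 1) w len σ = encode N w len σ ++ toBits (len (N + 1)) (σ (N + 1)) := by
  simp [encode, List.range_succ, List.flatMap_append]

lemma encode_prefix {i N : ℕ} (h : i ≤ N) (w : ℕ) (len σ : ℕ → ℕ) :
    encode i w len σ <+: encode N w len σ := by
  induction N, h using Nat.le_induction with
  | base => exact List.prefix_refl _
  | succ N _ ih => exact ih.trans (by rw [encode_succ]; exact List.prefix_append _ _)

lemma ofBits_encode {w : ℕ} {len σ : ℕ → ℕ} (h0 : σ 0 < 2 ^ w) {i : ℕ}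
    (h : ∀ j, 1 ≤ j → j ≤ i → σ j < 2 ^ len j) : ofBits (encode i w len σ) = concat len σ i := by
  induction i with
  | zero => simp [encode, concat, ofBits_toBits h0]
  | succ i ih =>
    rw [encode_succ, ofBits_append, ih fun j hj hji => h j hj (by omega), length_toBits,
      ofBits_toBits (h _ (by omega) le_rfl), concat]

/-- Reading a seed from a bitstring. -/
lemma ofBits_take_drop_encode {w i N L : ℕ} {len σ : ℕ → ℕ} (h0 : σ 0 < 2 ^ w) (hi : i ≤ N)
    (h : ∀ j, 1 ≤ j → j ≤ i → σ j < 2 ^ len j) (hL : ∑ j ∈ Finset.range i, len (j + 1) = L)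
    {pre D : List Bool} (hD : pre ++ encode N w len σ <+: D) :
    ofBits ((D.drop (pre.length + L)).take w) = seed w len σ i := by
  obtain ⟨t, rfl⟩ := hD
  obtain ⟨t', ht'⟩ := encode_prefix hi w len σ
  have hlen : (encode i w len σ).length = w + L := by rw [length_encode, hL]
  -- The encoding of `σ 0, …, σ i` has `w + L` bits, so its `w`-bit suffix starts at offset `L`;
  -- what follows it in `D` is irrelevant.
  rw [← ht', List.append_assoc, List.append_assoc, ← List.drop_drop, List.drop_left,
    List.drop_append_of_le_length (by omega),
    List.take_append_of_le_length (by rw [List.length_drop]; omega), List.take_of_length_le (by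
      rw [List.length_drop]; omega), ofBits_drop _ hlen, ofBits_encode h0 h, seed]

section Query

variable {U : Type*} {S : Finset U} {H : HashIndex U → Bool} {a l d κ lim : ℕ} {ε : ℝ}

lemma build_succ_of_ok (hok : (build d κ lim ε S H a (l + 1)).ok = true) :
    let b := build d κ lim ε S H a l
    let r := levelRun d κ lim ε S H a l b.node
    b.ok = true ∧ r.status = .success ∧
      (build d κ lim ε S H a (l + 1)).bits
        = b.bits ++ encode (2 ^ l) (κ * d) (fragLen d ε l) r.σ ∧
      ∀ x, (build d κ lim ε S H a (l + 1)).node x = 2 * b.node x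
        + (H (a, l, b.node x, seed (κ * d) (fragLen d ε l) r.σ (b.node x + 1), x)).toNat := by
  simp only [build] at hok ⊢
  by_cases hb : (build d κ lim ε S H a l).ok = true
  swap
  · rw [if_neg hb] at hok
    exact absurd hok hb
  rw [if_pos hb] at hok ⊢
  cases hst : (levelRun d κ lim ε S H a l (build d κ lim ε S H a l).node).status with
  | running => rw [hst] at hok; simp at hok
  | failure => rw [hst] at hok; simp at hok
  | success => exact ⟨hb, rfl, rfl, fun _ => rfl⟩

lemma build_prefix_of_ok {l' : ℕ} (hl : l ≤ l') (hok : (build d κ lim ε S H a l').ok = true) :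
    (build d κ lim ε S H a l).ok = true ∧
      (build d κ lim ε S H a l).bits <+: (build d κ lim ε S H a l').bits := by
  induction l', hl using Nat.le_induction with
  | base => exact ⟨hok, List.prefix_refl _⟩
  | succ l' _ ih =>
    obtain ⟨h1, -, h3, -⟩ := build_succ_of_ok hok
    obtain ⟨h4, h5⟩ := ih h1
    exact ⟨h4, h5.trans (by rw [h3]; exact List.prefix_append _ _)⟩

lemma length_takeWhile_replicate (a : ℕ) (l : List Bool) :
    ((List.replicate a true ++ false :: l).takeWhile id).length = a := by
  rw [List.takeWhile_append_of_pos (by simp)]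
  simp

/-- A query follows the path of the key in the construction. -/
lemma queryState_eq (hε0 : 0 < ε) (hε : ε ≤ 1)
    (hok : (attempt d κ lim ε S H a).ok = true) (x : U) (hl : l ≤ d) :
    let q := queryState d κ ε H (List.replicate a true ++ false :: (attempt d κ lim ε S H a).bits)
      x l
    q.pos = a + 1 + (build d κ lim ε S H a l).bits.length ∧
      q.node = (build d κ lim ε S H a l).node x := by
  induction l with
  | zero => simp [queryState, build]
  | succ l ih =>
    obtain ⟨ih1, ih2⟩ := ih (by omega)
    obtain ⟨hok', hpre⟩ := build_prefix_of_ok hl hok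
    obtain ⟨-, hst, hbits, hnode⟩ := build_succ_of_ok hok'
    simp only [queryState]
    rw [ih1, ih2, hnode, hbits, length_takeWhile_replicate]
    set b := build d κ lim ε S H a l
    set r := levelRun d κ lim ε S H a l b.node
    obtain ⟨h0, hσ⟩ := levelRun_success hst
    have hlt : b.node x < 2 ^ l := build_node_lt x
    have hseed : ofBits (((List.replicate a true ++ false :: (attempt d κ lim ε S H a).bits).drop
        (a + 1 + b.bits.length + prefixLen d ε l (b.node x + 1))).take (κ * d))
        = seed (κ * d) (fragLen d ε l) r.σ (b.node x + 1) := by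
      have hsum := sum_fragLen (by omega : l < d) hε0 hε 0 (b.node x + 1)
      simp only [prefixLen_zero, add_zero, zero_add] at hsum
      have := ofBits_take_drop_encode (N := 2 ^ l) h0 hlt
        (fun j hj hji => (hσ j hj (by omega)).1) hsum
        (pre := List.replicate a true ++ false :: b.bits)
        (D := List.replicate a true ++ false :: (attempt d κ lim ε S H a).bits) (by
          rw [List.append_assoc, List.prefix_append_right_inj, List.cons_append,
            List.cons_prefix_cons, ← hbits]
          exact ⟨rfl, hpre⟩)
      rw [← this]
      simp only [List.length_append, List.length_replicate, List.length_cons]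
      congr 3
      omega
    rw [hseed]
    refine ⟨?_, rfl⟩
    rw [List.length_append, length_encode_fragLen (by omega) hε0 hε, levelBits]
    omega

/-- Each key has its own leaf. -/
lemma build_bijOn (hS : S.card = 2 ^ d) (hok : (attempt d κ lim ε S H a).ok = true) :
    Set.BijOn (attempt d κ lim ε S H a).node (S : Set U) (Set.Iio (2 ^ d)) := by
  have hbal := build_balanced hS le_rfl hok
  have hlt : ∀ x, (attempt d κ lim ε S H a).node x < 2 ^ d := fun x => build_node_lt x
  refine ⟨fun x _ => hlt x, fun x hx y hy hxy => ?_, fun i hi => ?_⟩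
  · have h1 := hbal _ (hlt x)
    rw [Nat.sub_self, pow_zero] at h1
    exact Finset.card_le_one.1 h1.le x (mem_bucket.2 ⟨hx, rfl⟩) y (mem_bucket.2 ⟨hy, hxy.symm⟩)
  · have h1 := hbal i hi
    rw [Nat.sub_self, pow_zero] at h1
    obtain ⟨x, hx⟩ := Finset.card_pos.1 (h1 ▸ Nat.one_pos)
    exact ⟨x, mem_bucket.1 hx⟩

/-- If the construction terminates, it yields a minimal perfect hash function. -/
lemma query_bijOn (hε0 : 0 < ε) (hε : ε ≤ 1) (hS : S.card = 2 ^ d)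
    (hok : ∃ a, (attempt d κ lim ε S H a).ok = true) :
    Set.BijOn (query d κ ε H (dataStructure d κ lim ε S H)) (S : Set U) (Set.Iio (2 ^ d)) := by
  have h : (attempt d κ lim ε S H (restarts d κ lim ε S H)).ok = true := Nat.sInf_mem hok
  refine (build_bijOn hS h).congr fun x _ => ?_
  exact (queryState_eq hε0 hε h x le_rfl).2.symm

lemma queryTime_eq (x : U) : queryTime d κ ε H (dataStructure d κ lim ε S H) x
    = restarts d κ lim ε S H + 1 + 5 * d := by
  have key : ∀ l, (queryState d κ ε H (dataStructure d κ lim ε S H) x l).time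
      = restarts d κ lim ε S H + 1 + 5 * l := by
    intro l
    induction l with
    | zero => simp [queryState, dataStructure]
    | succ l ih => rw [queryState]; simp only [ih]; ring
  exact key d

lemma length_dataStructure_le (hε0 : 0 < ε) (hε : ε ≤ 1) :
    (dataStructure d κ lim ε S H).length
      ≤ restarts d κ lim ε S H + 1 + ∑ l ∈ Finset.range d, levelBits d κ ε l := by
  have := length_bits_le (d := d) (κ := κ) (lim := lim) (S := S) (H := H)
    (a := restarts d κ lim ε S H) hε0 hε le_rfl
  simp only [dataStructure, List.length_append, List.length_replicate, List.length_cons, attempt]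
  omega

lemma restarts_eq_zero (hok : (attempt d κ lim ε S H 0).ok = true) :
    restarts d κ lim ε S H = 0 :=
  Nat.sInf_eq_zero.2 (Or.inl hok)

/-- The number of restarts in terms of the failures of attempts. -/
lemma restarts_le : (restarts d κ lim ε S H : ℝ≥0∞)
    ≤ ∑' a : ℕ, (failsBefore d κ lim ε S (a + 1)).indicator 1 H := by
  classical
  -- Every index below the number of restarts contributes 1. If no attempt succeeds, the infimum of
  -- the empty set makes that number 0 and the bound is trivial.
  refine le_trans ?_ (ENNReal.sum_le_tsum (Finset.range (restarts d κ lim ε S H)))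
  rw [Finset.sum_congr rfl (g := fun _ => 1) fun a ha => ?_]
  · simp
  · rw [Set.indicator_of_mem, Pi.one_apply]
    intro b hb
    have : b < sInf {a | (attempt d κ lim ε S H a).ok = true} := by
      have := Finset.mem_range.1 ha
      rw [restarts] at this
      omega
    simpa using Nat.notMem_of_lt_sInf this

end Query

/-! ## Space -/

lemma seedInfo_succ (d l : ℕ) : seedInfo (d + 1) (l + 1) = seedInfo d l := by
  rw [seedInfo, seedInfo, Nat.add_sub_add_right]

/-- The number of bits that are necessary for a minimal perfect hash function. -/
noncomputable def perfectHashBits (n : ℕ) : ℝ := Real.logb 2 ((n : ℝ) ^ n / n.factorial)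

/-- `(2n) ^ (2n) / (2n)!` is the square of `n ^ n / n!` times `4 ^ n / centralBinom n`. In terms of
hashing, a perfect hash function is a perfect split together with one for each half. -/
lemma perfectHashBits_two_mul (n : ℕ) (hn : 0 < n) :
    perfectHashBits (2 * n) = Real.logb 2 (1 / splitProb (2 * n)) + 2 * perfectHashBits n := by
  have hn' : (0 : ℝ) < n := by exact_mod_cast hn
  have hf : (0 : ℝ) < n.factorial := by exact_mod_cast n.factorial_pos
  have hc : (0 : ℝ) < n.centralBinom := by exact_mod_cast n.centralBinom_pos
  have hf2 : ((2 * n).factorial : ℝ) = n.centralBinom * n.factorial * n.factorial := by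
    have := Nat.choose_mul_factorial_mul_factorial (show n ≤ 2 * n by omega)
    rw [show 2 * n - n = n by omega] at this
    rw [Nat.centralBinom, ← this]
    push_cast
    ring
  rw [perfectHashBits, perfectHashBits, hf2, splitProb_two_mul, ← Nat.cast_ofNat (n := 2) (R := ℝ),
    ← Real.logb_pow, ← Real.logb_mul (by positivity) (by positivity)]
  congr 1
  push_cast
  rw [mul_pow, pow_mul (2 : ℝ), pow_mul']
  norm_num
  field_simp

/-- The seeds carry as much information as a minimal perfect hash function requires. -/
lemma sum_seedInfo (d : ℕ) :
    ∑ l ∈ Finset.range d, 2 ^ l * seedInfo d l = perfectHashBits (2 ^ d) := by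
  induction d with
  | zero => simp [perfectHashBits]
  | succ d ih =>
    rw [Finset.sum_range_succ', pow_succ', perfectHashBits_two_mul _ (by positivity), ← ih,
      Finset.mul_sum, pow_zero, one_mul, seedInfo, Nat.sub_zero, ← pow_succ', add_comm]
    congr 1
    refine Finset.sum_congr rfl fun l _ => ?_
    rw [seedInfo_succ]
    ring

/-- `n ^ n / n!` is a single term of the exponential series of `exp n`. -/
lemma perfectHashBits_le (n : ℕ) : perfectHashBits n ≤ n * Real.logb 2 (Real.exp 1) := by
  have hpos : 0 < (n : ℝ) ^ n / n.factorial := by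
    rcases n.eq_zero_or_pos with rfl | hn
    · simp
    · have := n.factorial_pos
      positivity
  rw [perfectHashBits, ← Real.logb_pow, ← Real.exp_nat_mul, mul_one]
  exact Real.logb_le_logb_of_le (by norm_num) hpos
    (Real.pow_div_factorial_le_exp (n : ℝ) (Nat.cast_nonneg n) n)

/-- `12/7` is exactly what the induction in `sum_rpow_le` requires: the increment needs `7 * 2 ^
(3/4) ≤ 12`. -/
lemma two_rpow_three_quarters_le : (2 : ℝ) ^ (3 / 4 : ℝ) ≤ 12 / 7 := by
  refine le_of_pow_le_pow_left₀ (n := 4) (by norm_num) (by norm_num) ?_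
  rw [← Real.rpow_mul_natCast (by norm_num)]
  norm_num

/-- The sum is dominated by the levels with few keys per node. The subtracted term strengthens the
claim so that the induction, which doubles the sum and adds the root's term, goes through. -/
lemma sum_rpow_le (d : ℕ) :
    ∑ l ∈ Finset.range d, (2 : ℝ) ^ l * ((2 : ℝ) ^ (d - l)) ^ (3 / 4 : ℝ)
      ≤ 6 * (2 ^ d - ((2 : ℝ) ^ d) ^ (3 / 4 : ℝ)) := by
  induction d with
  | zero => simp
  | succ d ih =>
    have h : ∀ l ∈ Finset.range d, (2 : ℝ) ^ (l + 1) * ((2 : ℝ) ^ (d + 1 - (l + 1))) ^ (3 / 4 : ℝ)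
        = 2 * ((2 : ℝ) ^ l * ((2 : ℝ) ^ (d - l)) ^ (3 / 4 : ℝ)) := by
      intro l _
      rw [Nat.add_sub_add_right]
      ring
    rw [Finset.sum_range_succ', Finset.sum_congr rfl h, ← Finset.mul_sum, Nat.sub_zero, pow_zero,
      one_mul, pow_succ, Real.mul_rpow (by positivity) (by norm_num)]
    have := two_rpow_three_quarters_le
    have hx : (0 : ℝ) ≤ ((2 : ℝ) ^ d) ^ (3 / 4 : ℝ) := by positivity
    nlinarith

lemma sum_levelEps_le {d : ℕ} {ε : ℝ} (hε : 0 ≤ ε) :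
    ∑ l ∈ Finset.range d, 2 ^ l * levelEps d ε l ≤ 6 * (ε * 2 ^ d) := by
  calc ∑ l ∈ Finset.range d, 2 ^ l * levelEps d ε l
      ≤ ∑ l ∈ Finset.range d, ε * (2 ^ l * ((2 : ℝ) ^ (d - l)) ^ (3 / 4 : ℝ)) := by
        refine Finset.sum_le_sum fun l _ => ?_
        rw [mul_left_comm]
        gcongr
        exact min_le_right _ _
    _ ≤ ε * (6 * (2 ^ d - ((2 : ℝ) ^ d) ^ (3 / 4 : ℝ))) := by
        rw [← Finset.mul_sum]
        gcongr
        exact sum_rpow_le d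
    _ ≤ 6 * (ε * 2 ^ d) := by
        have hx : (0 : ℝ) ≤ ((2 : ℝ) ^ d) ^ (3 / 4 : ℝ) := by positivity
        nlinarith

lemma sum_levelBits_le {d : ℕ} {ε : ℝ} (κ : ℕ) (hε0 : 0 < ε) (hε : ε ≤ 1) :
    ∑ l ∈ Finset.range d, (levelBits d κ ε l : ℝ)
      ≤ perfectHashBits (2 ^ d) + 6 * (ε * 2 ^ d) + (κ * d ^ 2 + d) := by
  calc ∑ l ∈ Finset.range d, (levelBits d κ ε l : ℝ)
      ≤ ∑ l ∈ Finset.range d, (2 ^ l * seedInfo d l + 2 ^ l * levelEps d ε l + (κ * d + 1)) := by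
        refine Finset.sum_le_sum fun l hl => ?_
        have := prefixLen_lt (Finset.mem_range.1 hl) hε0 hε (2 ^ l)
        rw [levelBits]
        push_cast at this ⊢
        linarith
    _ = perfectHashBits (2 ^ d) + ∑ l ∈ Finset.range d, 2 ^ l * levelEps d ε l
          + (κ * d ^ 2 + d) := by
        rw [Finset.sum_add_distrib, Finset.sum_add_distrib, sum_seedInfo, Finset.sum_const,
          Finset.card_range, nsmul_eq_mul]
        ring
    _ ≤ _ := by
        gcongr
        exact sum_levelEps_le hε0.le

/-! ## The lower bound for the space -/

lemma prod_le_mean_pow {n : ℕ} (x : Fin n → ℝ) (hx : ∀ i, 0 ≤ x i) :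
    (n : ℝ) ^ n * ∏ i, x i ≤ (∑ i, x i) ^ n := by
  rcases n.eq_zero_or_pos with rfl | hn
  · simp
  have hn' : (0 : ℝ) < n := by exact_mod_cast hn
  have := Real.geom_mean_le_arith_mean_weighted Finset.univ (fun _ => (1 / n : ℝ)) x
    (fun _ _ => by positivity) (by simp [hn'.ne']) (fun i _ => hx i)
  rw [← Finset.mul_sum, Real.finsetProd_rpow _ _ fun i _ => hx i] at this
  have hP : 0 ≤ ∏ i, x i := Finset.prod_nonneg fun i _ => hx i
  have h2 := pow_le_pow_left₀ (by positivity) this n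
  rw [← Real.rpow_mul_natCast hP, one_div_mul_cancel hn'.ne', Real.rpow_one, mul_pow, one_div,
    inv_pow] at h2
  rwa [← div_eq_inv_mul, le_div_iff₀' (by positivity)] at h2

/-- A function to `n` values is injective on few sets of size `n`. -/
lemma card_injOn_le {U : Type*} [Fintype U] [DecidableEq U] {n : ℕ} (f : U → Fin n) :
    (n : ℝ) ^ n * (((Finset.univ.powersetCard n).filter
      (fun S : Finset U => Set.InjOn f (S : Set U))).card : ℝ) ≤ (Fintype.card U : ℝ) ^ n := by
  classical
  -- An `n`-set on which `f` is injective is a system of representatives of all `n` fibres, so such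
  -- sets number at most the product of the fibre sizes, which is largest for equal fibres.
  have hsub : (Finset.univ.powersetCard n).filter (fun S : Finset U => Set.InjOn f (S : Set U))
      ⊆ (Fintype.piFinset fun i => Finset.univ.filter fun x => f x = i).image
        (fun g => Finset.univ.image g) := by
    intro S hS
    rw [Finset.mem_filter, Finset.mem_powersetCard] at hS
    obtain ⟨⟨-, hcard⟩, hinj⟩ := hS
    have himg : S.image f = Finset.univ := Finset.eq_univ_of_card _ (by
      rw [Finset.card_image_of_injOn hinj, hcard, Fintype.card_fin])
    have hex : ∀ i, ∃ x ∈ S, f x = i := fun i => by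
      have : i ∈ S.image f := himg ▸ Finset.mem_univ i
      simpa using this
    choose g hg hfg using hex
    rw [Finset.mem_image]
    refine ⟨g, by simp [hfg], Finset.eq_of_subset_of_card_le ?_ ?_⟩
    · intro x hx
      obtain ⟨i, -, rfl⟩ := Finset.mem_image.1 hx
      exact hg i
    · rw [Finset.card_image_of_injective _ (Function.LeftInverse.injective hfg), hcard]
      simp
  have hle := (Finset.card_le_card hsub).trans Finset.card_image_le
  rw [Fintype.card_piFinset] at hle
  have hsum : ∑ i, ((Finset.univ.filter fun x => f x = i).card : ℝ) = Fintype.card U := by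
    rw [← Nat.cast_sum, ← Finset.card_eq_sum_card_fiberwise (fun x _ => Finset.mem_univ (f x))]
    rfl
  calc _ ≤ (n : ℝ) ^ n * ∏ i, ((Finset.univ.filter fun x => f x = i).card : ℝ) := by
        gcongr
        exact_mod_cast hle
    _ ≤ _ := by
        rw [← hsum]
        exact prod_le_mean_pow _ fun _ => Nat.cast_nonneg _

/-- A family of functions such that each `n`-subset is mapped bijectively by one of them is
large. -/
lemma le_ncard_perfectHash {U : Type*} [Fintype U] {n : ℕ} {F : Set (U → Fin n)}
    (hF : F.Finite) (h : ∀ S : Finset U, S.card = n → ∃ f ∈ F, Set.InjOn f (S : Set U)) :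
    (n : ℝ) ^ n * ((Fintype.card U).choose n : ℝ) ≤ F.ncard * (Fintype.card U : ℝ) ^ n := by
  classical
  have hsub : (Finset.univ : Finset U).powersetCard n ⊆ hF.toFinset.biUnion fun f =>
      (Finset.univ.powersetCard n).filter (fun S : Finset U => Set.InjOn f (S : Set U)) := by
    intro S hS
    obtain ⟨f, hf, hinj⟩ := h S (Finset.mem_powersetCard.1 hS).2
    rw [Finset.mem_biUnion]
    exact ⟨f, hF.mem_toFinset.2 hf, Finset.mem_filter.2 ⟨hS, hinj⟩⟩
  have hle := (Finset.card_le_card hsub).trans Finset.card_biUnion_le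
  rw [Finset.card_powersetCard, Finset.card_univ] at hle
  calc (n : ℝ) ^ n * ((Fintype.card U).choose n : ℝ)
      ≤ (n : ℝ) ^ n * ∑ f ∈ hF.toFinset, (((Finset.univ.powersetCard n).filter
          (fun S : Finset U => Set.InjOn f (S : Set U))).card : ℝ) := by
        gcongr
        exact_mod_cast hle
    _ ≤ ∑ _f ∈ hF.toFinset, (Fintype.card U : ℝ) ^ n := by
        rw [Finset.mul_sum]
        exact Finset.sum_le_sum fun f _ => card_injOn_le f
    _ = F.ncard * (Fintype.card U : ℝ) ^ n := by
        rw [Finset.sum_const, nsmul_eq_mul, Set.ncard_eq_toFinset_card F hF]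

/-- The quotient is at least `(1 - n/u) ^ n ≥ exp (-2 * n ^ 2 / u)`, and `u ≥ c₀ * n ^ 2`. The
assumption `2 * n ≤ u` makes `1 - x ≥ exp (-2x)` available at `x = n/u`. This bounds the loss from a
finite universe. -/
lemma exp_le_descFactorial_div {u n : ℕ} {c₀ : ℝ} (hc₀ : 0 < c₀) (hn : 0 < n) (h2 : 2 * n ≤ u)
    (hu : c₀ * (n : ℝ) ^ 2 ≤ u) :
    Real.exp (-(2 / c₀)) ≤ (u.descFactorial n : ℝ) / (u : ℝ) ^ n := by
  have hn' : (0 : ℝ) < n := by exact_mod_cast hn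
  have hu' : (0 : ℝ) < u := by exact_mod_cast (by omega : 0 < u)
  have h2' : 2 * (n : ℝ) ≤ u := by exact_mod_cast h2
  have h1 : ((u - n : ℝ)) ^ n ≤ u.descFactorial n := by
    have h3 : ((u - n) ^ n : ℕ) ≤ u.descFactorial n :=
      (Nat.pow_le_pow_left (by omega) n).trans (Nat.pow_sub_le_descFactorial u n)
    have h4 : (((u - n) ^ n : ℕ) : ℝ) ≤ u.descFactorial n := by exact_mod_cast h3
    rwa [Nat.cast_pow, Nat.cast_sub (by omega)] at h4
  have h5 : Real.exp (-(2 * (n / u))) ≤ 1 - n / u := by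
    have hx : (n : ℝ) / u ≤ 1 / 2 := by
      rw [div_le_div_iff₀ hu' (by norm_num)]
      linarith
    have hx0 : (0 : ℝ) ≤ n / u := by positivity
    rw [Real.exp_neg, inv_le_comm₀ (Real.exp_pos _) (by linarith)]
    refine le_trans ?_ (Real.add_one_le_exp _)
    rw [inv_le_iff_one_le_mul₀' (by linarith)]
    nlinarith
  calc Real.exp (-(2 / c₀)) ≤ Real.exp (n * -(2 * (n / u))) := by
        rw [Real.exp_le_exp, mul_neg, neg_le_neg_iff, ← mul_div_assoc, ← mul_div_assoc,
          div_le_div_iff₀ hu' hc₀]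
        nlinarith
    _ ≤ (1 - n / u) ^ n := by
        rw [Real.exp_nat_mul]
        gcongr
    _ = ((u - n : ℝ)) ^ n / (u : ℝ) ^ n := by
        rw [← div_pow, sub_div, div_self hu'.ne']
    _ ≤ _ := by gcongr

/-- Each admissible value of the lower bound is, up to a constant, at least the number of bits that
are necessary for a large universe. -/
lemma perfectHashBits_le_opt {U : Type*} {S : Finset U} {n : ℕ} {c₀ opt : ℝ} (hc₀ : 0 < c₀)
    (hn : 0 < n) (hS : S.card = n) (hopt : IsOptMPHF c₀ U n opt) :
    perfectHashBits n ≤ opt + 2 / c₀ * Real.logb 2 (Real.exp 1) := by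
  classical
  have hlog : 0 ≤ Real.logb 2 (Real.exp 1) :=
    Real.logb_nonneg (by norm_num) (Real.one_le_exp (by norm_num))
  rcases hopt with rfl | ⟨hfin, hu, rfl⟩
  · have := perfectHashBits_le n
    have : 0 ≤ 2 / c₀ * Real.logb 2 (Real.exp 1) := by positivity
    linarith
  have := Fintype.ofFinite U
  set A := {k : ℕ | ∃ F : Set (U → Fin n), F.Finite ∧ F.ncard = k ∧
    ∀ S : Finset U, S.card = n → ∃ f ∈ F, Set.InjOn f (S : Set U)} with hA
  have hne : A.Nonempty := by
    refine ⟨_, Set.univ, Set.finite_univ, rfl, fun S hS => ?_⟩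
    let e := S.equivFinOfCardEq hS
    refine ⟨fun x => if hx : x ∈ S then e ⟨x, hx⟩ else ⟨0, hn⟩, Set.mem_univ _, ?_⟩
    intro x hx y hy hxy
    rw [Finset.mem_coe] at hx hy
    simpa [hx, hy] using hxy
  have hopt : optMPHF U n = Real.logb 2 (sInf A : ℕ) := rfl
  obtain ⟨F, hF, hFk, hFS⟩ := Nat.sInf_mem hne
  have hk1 : (1 : ℝ) ≤ (sInf A : ℕ) := by
    obtain ⟨f, hf, -⟩ := hFS S hS
    rw [← hFk]
    exact_mod_cast (Set.ncard_pos hF).2 ⟨f, hf⟩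
  have hopt0 : 0 ≤ optMPHF U n := by
    rw [hopt]
    exact Real.logb_nonneg (by norm_num) hk1
  have hcard := le_ncard_perfectHash hF hFS
  rw [Nat.card_eq_fintype_card] at hu
  rw [hFk] at hcard
  set u := Fintype.card U
  set k := sInf A
  have hn' : (0 : ℝ) < n := by exact_mod_cast hn
  rcases le_or_gt (2 * n) u with h2 | h2
  · have hu' : (0 : ℝ) < u := by exact_mod_cast (by omega : 0 < u)
    have hd := exp_le_descFactorial_div hc₀ hn h2 hu
    have hfac : (0 : ℝ) < n.factorial := by exact_mod_cast n.factorial_pos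
    have hdf : (u.descFactorial n : ℝ) = n.factorial * u.choose n := by
      exact_mod_cast Nat.descFactorial_eq_factorial_mul_choose u n
    have key : (n : ℝ) ^ n / n.factorial * Real.exp (-(2 / c₀)) ≤ k := by
      calc (n : ℝ) ^ n / n.factorial * Real.exp (-(2 / c₀))
          ≤ (n : ℝ) ^ n / n.factorial * ((u.descFactorial n : ℝ) / (u : ℝ) ^ n) := by gcongr
        _ = (n : ℝ) ^ n * u.choose n / (u : ℝ) ^ n := by
            rw [hdf]
            field_simp
        _ ≤ k := by
            rw [div_le_iff₀ (by positivity)]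
            exact hcard
    have h3 := Real.logb_le_logb_of_le (b := 2) (by norm_num) (by positivity) key
    rw [Real.logb_mul (by positivity) (by positivity), ← hopt] at h3
    have h4 : Real.logb 2 (Real.exp (-(2 / c₀))) = -(2 / c₀ * Real.logb 2 (Real.exp 1)) := by
      rw [Real.logb, Real.logb, Real.log_exp, Real.log_exp]
      ring
    rw [h4] at h3
    rw [perfectHashBits]
    linarith
  -- Here `c₀ * n ^ 2 ≤ u < 2 * n`, so `n` is bounded by a constant, and the trivial bound `n * log₂
  -- e` with a nonnegative optimum suffices.
  · have h3 : (n : ℝ) ≤ 2 / c₀ := by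
      have : (u : ℝ) ≤ 2 * n := by exact_mod_cast h2.le
      rw [le_div_iff₀ hc₀]
      nlinarith
    have := perfectHashBits_le n
    have : n * Real.logb 2 (Real.exp 1) ≤ 2 / c₀ * Real.logb 2 (Real.exp 1) := by gcongr
    linarith

/-! ## Time -/

section Time

variable {d l : ℕ} {ε : ℝ}

lemma levelTime_nonneg (hε : 0 < ε) (hε1 : ε ≤ 1) (hl : l < d) : 0 ≤ levelTime d ε l := by
  have := splitProb_pos hl
  have := levelEps_pos (d := d) (l := l) hε hε1
  rw [levelTime]
  positivity

/-- A geometric sum dominated by the root; the constant 4 works in the induction because `√2 ≥ 4/3`.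
-/
lemma sum_sqrt_le (d : ℕ) :
    ∑ l ∈ Finset.range d, Real.sqrt (2 ^ (d - l)) ≤ 4 * Real.sqrt (2 ^ d) := by
  induction d with
  | zero => simp
  | succ d ih =>
    rw [Finset.sum_range_succ', Nat.sub_zero]
    simp only [Nat.add_sub_add_right]
    rw [pow_succ, Real.sqrt_mul (by positivity)]
    have h2 : 4 / 3 ≤ Real.sqrt 2 := Real.le_sqrt_of_sq_le (by norm_num)
    have := Real.sqrt_nonneg ((2 : ℝ) ^ d)
    nlinarith

lemma natCast_le_two_mul_sqrt (d : ℕ) : (d : ℝ) ≤ 2 * Real.sqrt (2 ^ d) := by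
  have h : d ^ 2 ≤ 4 * 2 ^ d := by
    induction d with
    | zero => norm_num
    | succ d ih =>
      rcases Nat.lt_or_ge d 3 with h | h
      · interval_cases d <;> norm_num
      · rw [pow_succ 2 d]
        nlinarith
  have h' : (d : ℝ) ^ 2 ≤ 2 ^ 2 * 2 ^ d := by exact_mod_cast h
  have h2 := Real.le_sqrt_of_sq_le h'
  rwa [Real.sqrt_mul (by norm_num), Real.sqrt_sq (by norm_num)] at h2

lemma logb_exp_one_le : Real.logb 2 (Real.exp 1) ≤ 2 := by
  rw [Real.logb_le_iff_le_rpow (by norm_num) (Real.exp_pos _)]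
  have := Real.exp_one_lt_d9
  norm_num at this ⊢
  linarith

lemma one_div_levelEps_le (hε : 0 < ε) :
    1 / levelEps d ε l ≤ 1 + 1 / (ε * ((2 : ℝ) ^ (d - l)) ^ (3 / 4 : ℝ)) := by
  have hx : 0 < ε * ((2 : ℝ) ^ (d - l)) ^ (3 / 4 : ℝ) := by positivity
  rw [levelEps]
  rcases min_choice 1 (ε * ((2 : ℝ) ^ (d - l)) ^ (3 / 4 : ℝ)) with h | h <;> rw [h]
  · rw [div_one]
    have := one_div_pos.2 hx
    linarith
  · linarith

/-- The cost of the search on a level. -/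
lemma mul_levelTime_le (hε : 0 < ε) (hε1 : ε ≤ 1) (hl : l < d) :
    (2 ^ (d - l) + 2) * levelTime d ε l
      ≤ 24 * (2 ^ d * Real.sqrt (2 ^ (d - l))
        + 1 / ε * (2 ^ l * ((2 : ℝ) ^ (d - l)) ^ (3 / 4 : ℝ))) + 2 * 2 ^ (d - l) := by
  have hp := splitProb_pos hl
  have he := levelEps_pos (d := d) (l := l) hε hε1
  have hd : (2 : ℝ) ^ d = 2 ^ l * 2 ^ (d - l) := by rw [← pow_add]; congr 1; omega
  rw [levelTime]
  have h1 := one_div_splitProb_le hl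
  have h2 := one_div_levelEps_le (d := d) (l := l) hε
  have hm : (2 : ℝ) ≤ 2 ^ (d - l) := le_self_pow₀ (by norm_num) (by omega)
  rw [Real.sqrt_mul (by norm_num)] at h1
  set m : ℝ := 2 ^ (d - l)
  have hm0 : 0 < m := by linarith
  -- The work per node `m * √m` divided by the `m ^ (3/4)` in `ε_ℓ` leaves `m ^ (3/4)`, which is
  -- what `sum_rpow_le` sums.
  have hq : Real.sqrt m * m = m ^ (3 / 4 : ℝ) * m ^ (3 / 4 : ℝ) := by
    rw [Real.sqrt_eq_rpow, ← Real.rpow_add hm0]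
    nth_rewrite 2 [← Real.rpow_one m]
    rw [← Real.rpow_add hm0]
    norm_num
  set y := m ^ (3 / 4 : ℝ) with hy
  have hy0 : 0 < y := by positivity
  have hs0 := Real.sqrt_nonneg m
  have h3 : 8 / (splitProb (2 ^ (d - l)) * levelEps d ε l)
      ≤ 12 * (Real.sqrt m * (1 + 1 / (ε * y))) := by
    have h4 : Real.sqrt 2 ≤ 3 / 2 := Real.sqrt_le_iff.2 ⟨by norm_num, by norm_num⟩
    calc 8 / (splitProb (2 ^ (d - l)) * levelEps d ε l)
        = 8 * ((1 / splitProb (2 ^ (d - l))) * (1 / levelEps d ε l)) := by field_simp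
      _ ≤ 8 * ((3 / 2 * Real.sqrt m) * (1 + 1 / (ε * y))) := by
          gcongr
          exact h1.trans (by gcongr)
      _ = _ := by ring
  calc (m + 2) * (2 ^ l * (8 / (splitProb (2 ^ (d - l)) * levelEps d ε l)) + 1)
      ≤ (2 * m) * (2 ^ l * (12 * (Real.sqrt m * (1 + 1 / (ε * y)))) + 1) := by
        gcongr
        linarith
    _ = 24 * (2 ^ l * m * Real.sqrt m + 1 / ε * (2 ^ l * ((Real.sqrt m * m) / y))) + 2 * m := by
        field_simp
        ring
    _ = _ := by rw [hq, mul_div_assoc, div_self hy0.ne', mul_one, hd]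

/-- A crude polynomial bound, needed only to choose the step limit. -/
lemma levelTime_le (hε : 1 / 2 ^ d ≤ ε) (hε1 : ε ≤ 1) (hl : l < d) :
    levelTime d ε l ≤ 9 * (2 ^ d) ^ 2 := by
  have hε0 : 0 < ε := lt_of_lt_of_le (by positivity) hε
  have hp := splitProb_pos hl
  have he := levelEps_pos (d := d) (l := l) hε0 hε1
  have hd : (2 : ℝ) ^ d = 2 ^ l * 2 ^ (d - l) := by rw [← pow_add]; congr 1; omega
  have h2 : 1 / levelEps d ε l ≤ 2 ^ d := by
    rw [one_div_le he (by positivity)]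
    exact hε.trans (le_levelEps hε0.le hε1)
  have h1 := one_div_splitProb_le_two_pow hl
  have hn : (1 : ℝ) ≤ 2 ^ d := one_le_pow₀ (by norm_num)
  calc levelTime d ε l
      = 8 * 2 ^ l * ((1 / splitProb (2 ^ (d - l))) * (1 / levelEps d ε l)) + 1 := by
        rw [levelTime]
        field_simp
    _ ≤ 8 * 2 ^ l * (2 ^ (d - l) * 2 ^ d) + 1 := by gcongr
    _ = 8 * (2 ^ d) ^ 2 + 1 := by rw [hd]; ring
    _ ≤ _ := by nlinarith

/-- The expected time of a construction attempt. -/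
lemma sum_time_le (κ : ℕ) (hε : 0 < ε) (hε1 : ε ≤ 1) :
    (2 ^ d + 1) + ∑ l ∈ Finset.range d, ((2 + 2 ^ l + 2 * 2 ^ d + (levelBits d κ ε l : ℝ))
        + (2 ^ (d - l) + 2) * levelTime d ε l)
      ≤ (269 + 4 * κ) * max (((2 : ℝ) ^ d) ^ (3 / 2 : ℝ)) (2 ^ d / ε) := by
  have hn : (1 : ℝ) ≤ 2 ^ d := one_le_pow₀ (by norm_num)
  have hgeom : ∀ d : ℕ, ∑ l ∈ Finset.range d, (2 : ℝ) ^ l ≤ 2 ^ d := fun d => by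
    rw [geom_sum_eq (by norm_num)]
    norm_num
  have hgeom' : ∑ l ∈ Finset.range d, (2 : ℝ) ^ (d - l) ≤ 2 * 2 ^ d := by
    rw [← Finset.sum_range_reflect]
    refine le_trans (le_of_eq ?_) (mul_le_mul_of_nonneg_left (hgeom d) (by norm_num))
    rw [Finset.mul_sum]
    refine Finset.sum_congr rfl fun l hl => ?_
    rw [← pow_succ']
    congr 1
    have := Finset.mem_range.1 hl
    omega
  have hbits := sum_levelBits_le κ hε hε1 (d := d)
  have hph := perfectHashBits_le (2 ^ d)
  have hlog := logb_exp_one_le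
  have hsq := sum_sqrt_le d
  have hrp := sum_rpow_le d
  have hd := natCast_le_two_mul_sqrt d
  have h32 : ((2 : ℝ) ^ d) ^ (3 / 2 : ℝ) = 2 ^ d * Real.sqrt (2 ^ d) := by
    rw [Real.sqrt_eq_rpow, show (3 / 2 : ℝ) = 1 + 1 / 2 by norm_num,
      Real.rpow_add (by positivity), Real.rpow_one]
  have hx : (0 : ℝ) ≤ ((2 : ℝ) ^ d) ^ (3 / 4 : ℝ) := by positivity
  push_cast at hph
  have hcost : ∑ l ∈ Finset.range d, (2 ^ (d - l) + 2) * levelTime d ε l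
      ≤ 24 * (2 ^ d * (4 * Real.sqrt (2 ^ d)) + 1 / ε * (6 * 2 ^ d)) + 2 * (2 * 2 ^ d) := by
    refine (Finset.sum_le_sum fun l hl => mul_levelTime_le hε hε1 (Finset.mem_range.1 hl)).trans ?_
    rw [Finset.sum_add_distrib, ← Finset.mul_sum, ← Finset.mul_sum, Finset.sum_add_distrib,
      ← Finset.mul_sum, ← Finset.mul_sum]
    gcongr
    linarith
  rw [Finset.sum_add_distrib, Finset.sum_add_distrib, Finset.sum_add_distrib,
    Finset.sum_add_distrib, Finset.sum_const, Finset.sum_const, Finset.card_range, nsmul_eq_mul,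
    nsmul_eq_mul]
  have hg := hgeom d
  set n : ℝ := 2 ^ d
  have hs1 : 1 ≤ Real.sqrt n := Real.one_le_sqrt.2 hn
  have hss : Real.sqrt n * Real.sqrt n = n := Real.mul_self_sqrt (by linarith)
  have hM1 : n * Real.sqrt n ≤ max (n ^ (3 / 2 : ℝ)) (n / ε) := by
    rw [← h32]
    exact le_max_left _ _
  have hM2 : 1 / ε * n ≤ max (n ^ (3 / 2 : ℝ)) (n / ε) := by
    rw [one_div_mul_eq_div]
    exact le_max_right _ _
  set M := max (n ^ (3 / 2 : ℝ)) (n / ε)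
  set s := Real.sqrt n
  have hnM : n ≤ M := le_trans (by nlinarith) hM1
  have hdM : (d : ℝ) ≤ 2 * M := by nlinarith
  have hdn : (d : ℝ) * n ≤ 2 * M := by nlinarith
  have hd2 : (d : ℝ) ^ 2 ≤ 4 * M := by nlinarith
  have hκ : (κ : ℝ) * d ^ 2 ≤ κ * (4 * M) := by gcongr
  have hεn : ε * n ≤ M := by nlinarith
  have hln : n * Real.logb 2 (Real.exp 1) ≤ 2 * M := by nlinarith
  linarith

end Time

/-! ## Expectations and tails -/

section Bounds

variable {Ω : Type*} [MeasurableSpace Ω] {P : Measure Ω} [IsProbabilityMeasure P] {U : Type*}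
  {S : Finset U} {h : HashIndex U → Ω → Bool} {d : ℕ} {ε : ℝ}

/-- The probability that an attempt fails. -/
lemma prob_attempt_fails_le_rpow (hm : ∀ k, Measurable (h k))
    (hh : ∀ k, P {ω | h k ω = true} = 1 / 2) (hi : iIndepFun h P) (hd : 1 ≤ d)
    (hS : S.card = 2 ^ d) (hε : ε ≤ 1) (hε1 : 1 / 2 ^ d ≤ ε) (c : ℕ) (a : ℕ) :
    P {ω | (attempt d (wordFactor (c + 7)) (c + 7) ε S (fun k => h k ω) a).ok = false}
      ≤ ENNReal.ofReal (((2 : ℝ) ^ d) ^ (-(c : ℝ))) := by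
  have hε0 : 0 < ε := lt_of_lt_of_le (by positivity) hε1
  refine (prob_attempt_fails_le hm (fun l hl a =>
    lintegral_levelSteps_le (lim := c + 7) (a := a) hm hh hi hS hl hε hε1) a).trans ?_
  have hn : (2 : ℝ) ≤ 2 ^ d := le_self_pow₀ (by norm_num) (by omega)
  have hdn : (d : ℝ) ≤ 2 ^ d := by exact_mod_cast Nat.lt_two_pow_self.le
  -- `d ≤ n` and `9 ≤ 2 ^ 4 ≤ n ^ 4`. With step limit `n ^ (c + 7)`, Markov's inequality leaves the
  -- failure probability `n ^ (-c)`.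
  have hsum : ∑ l ∈ Finset.range d, levelTime d ε l ≤ (2 ^ d) ^ 7 := by
    calc ∑ l ∈ Finset.range d, levelTime d ε l
        ≤ ∑ _l ∈ Finset.range d, 9 * ((2 : ℝ) ^ d) ^ 2 :=
          Finset.sum_le_sum fun l hl => levelTime_le hε1 hε (Finset.mem_range.1 hl)
      _ = d * (9 * ((2 : ℝ) ^ d) ^ 2) := by
          rw [Finset.sum_const, Finset.card_range, nsmul_eq_mul]
      _ ≤ 2 ^ d * ((2 ^ d) ^ 4 * ((2 : ℝ) ^ d) ^ 2) := by
          gcongr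
          have : (2 : ℝ) ^ 4 ≤ (2 ^ d) ^ 4 := by gcongr
          linarith
      _ = _ := by ring
  rw [← ENNReal.ofReal_sum_of_nonneg fun l hl =>
      levelTime_nonneg hε0 hε (Finset.mem_range.1 hl)]
  rw [← ENNReal.ofReal_ofNat, ← ENNReal.ofReal_pow (by norm_num),
    ← ENNReal.ofReal_div_of_pos (by positivity)]
  refine ENNReal.ofReal_le_ofReal ?_
  rw [div_le_iff₀ (by positivity), Real.rpow_neg (by positivity), Real.rpow_natCast, mul_comm _ d,
    pow_mul, pow_add, inv_mul_cancel_left₀ (by positivity)]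
  exact hsum

lemma prob_attempt_fails_le_half (hm : ∀ k, Measurable (h k))
    (hh : ∀ k, P {ω | h k ω = true} = 1 / 2) (hi : iIndepFun h P) (hd : 1 ≤ d)
    (hS : S.card = 2 ^ d) (hε : ε ≤ 1) (hε1 : 1 / 2 ^ d ≤ ε) {c : ℕ} (hc : 1 ≤ c) (a : ℕ) :
    P {ω | (attempt d (wordFactor (c + 7)) (c + 7) ε S (fun k => h k ω) a).ok = false}
      ≤ 2⁻¹ := by
  refine (prob_attempt_fails_le_rpow hm hh hi hd hS hε hε1 c a).trans ?_
  have hn : (2 : ℝ) ≤ 2 ^ d := le_self_pow₀ (by norm_num) (by omega)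
  have : (2 : ℝ≥0∞)⁻¹ = ENNReal.ofReal 2⁻¹ := by
    rw [ENNReal.ofReal_inv_of_pos (by norm_num), ENNReal.ofReal_ofNat]
  rw [this]
  refine ENNReal.ofReal_le_ofReal ?_
  rw [Real.rpow_neg (by positivity), Real.rpow_natCast]
  gcongr
  exact hn.trans (le_self_pow₀ (by linarith) (by omega))

/-- If attempts fail with probability at most one half, then one of them succeeds. -/
lemma ae_exists_ok {κ lim : ℕ} (hm : ∀ k, Measurable (h k)) (hi : iIndepFun h P)
    (hq : ∀ a, P {ω | (attempt d κ lim ε S (fun k => h k ω) a).ok = false} ≤ 2⁻¹) :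
    ∀ᵐ ω ∂P, ∃ a, (attempt d κ lim ε S (fun k => h k ω) a).ok = true := by
  rw [ae_iff]
  refine le_antisymm (ge_of_tendsto' (ENNReal.tendsto_pow_atTop_nhds_zero_of_lt_one
    (ENNReal.inv_lt_one.2 ENNReal.one_lt_two)) fun a => ?_) zero_le
  refine (measure_mono fun ω hω => ?_).trans (prob_failsBefore_le hm hi hq a)
  intro b _
  by_contra hb
  exact hω ⟨b, by simpa using hb⟩

/-- The expected number of restarts. -/
lemma lintegral_restarts_le {κ lim : ℕ} (hm : ∀ k, Measurable (h k)) (hi : iIndepFun h P)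
    (hq : ∀ a, P {ω | (attempt d κ lim ε S (fun k => h k ω) a).ok = false} ≤ 2⁻¹) (b : ℕ) :
    ∫⁻ ω, ((restarts d κ lim ε S (fun k => h k ω) + b : ℕ) : ℝ≥0∞) ∂P ≤ ((b + 1 : ℕ) : ℝ≥0∞) := by
  calc ∫⁻ ω, ((restarts d κ lim ε S (fun k => h k ω) + b : ℕ) : ℝ≥0∞) ∂P
      ≤ ∫⁻ ω, (∑' a : ℕ, (failsBefore d κ lim ε S (a + 1)).indicator 1 (fun k => h k ω))
          + (b : ℝ≥0∞) ∂P := by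
        refine lintegral_mono fun ω => ?_
        rw [Nat.cast_add]
        gcongr
        exact restarts_le
    _ = (∑' a : ℕ, P {ω | (fun k => h k ω) ∈ failsBefore d κ lim ε S (a + 1)}) + b := by
        rw [lintegral_add_right _ measurable_const, lintegral_const, measure_univ, mul_one,
          lintegral_tsum]
        · congr 1
          refine tsum_congr fun a => ?_
          rw [← lintegral_indicator_one (measurableSet_failsBefore hm κ)]
          rfl
        · exact fun a => (measurable_one.indicator
            (measurableSet_failsBefore hm κ (a := a + 1))).aemeasurable
    _ ≤ (∑' a : ℕ, 2⁻¹ ^ (a + 1)) + b := by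
        gcongr with a
        exact prob_failsBefore_le hm hi hq _
    _ = ((b + 1 : ℕ) : ℝ≥0∞) := by
        rw [ENNReal.tsum_geometric_add_one, ENNReal.one_sub_inv_two, inv_inv,
          ENNReal.inv_mul_cancel (by norm_num) (by norm_num), Nat.cast_add, Nat.cast_one, add_comm]

/-- The expected construction time. -/
lemma lintegral_constructionTime_le (hm : ∀ k, Measurable (h k))
    (hh : ∀ k, P {ω | h k ω = true} = 1 / 2) (hi : iIndepFun h P) (hd : 1 ≤ d)
    (hS : S.card = 2 ^ d) (hε : ε ≤ 1) (hε1 : 1 / 2 ^ d ≤ ε) {c : ℕ} (hc : 1 ≤ c) :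
    ∫⁻ ω, constructionTime d (wordFactor (c + 7)) (c + 7) ε S (fun k => h k ω) ∂P
      ≤ ENNReal.ofReal (2 * (269 + 4 * wordFactor (c + 7))
        * max (((2 : ℝ) ^ d) ^ (3 / 2 : ℝ)) (2 ^ d / ε)) := by
  have hε0 : 0 < ε := lt_of_lt_of_le (by positivity) hε1
  simp only [constructionTime_eq]
  refine (lintegral_attempts_le hm hi (fun z => (z.2 : ℝ≥0∞))
    (prob_attempt_fails_le_half hm hh hi hd hS hε hε1 hc) fun a =>
    lintegral_attempt_time_le hm (fun l hl a => lintegral_levelSteps_le hm hh hi hS hl hε hε1) hS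
      hε0 hε a).trans ?_
  rw [ENNReal.one_sub_inv_two, inv_inv, mul_assoc 2, ENNReal.ofReal_mul (by norm_num),
    ENNReal.ofReal_ofNat]
  gcongr
  refine le_trans (le_of_eq ?_) (ENNReal.ofReal_le_ofReal (sum_time_le (wordFactor (c + 7)) hε0 hε))
  have hl0 : ∀ l ∈ Finset.range d, 0 ≤ levelTime d ε l := fun l hl =>
    levelTime_nonneg hε0 hε (Finset.mem_range.1 hl)
  have hterm : ∀ l ∈ Finset.range d, 0 ≤ (2 + 2 ^ l + 2 * 2 ^ d
      + (levelBits d (wordFactor (c + 7)) ε l : ℝ)) + (2 ^ (d - l) + 2) * levelTime d ε l :=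
    fun l hl => by
      have := hl0 l hl
      positivity
  rw [ENNReal.ofReal_add (by positivity) (Finset.sum_nonneg hterm),
    ENNReal.ofReal_sum_of_nonneg hterm]
  congr 1
  · rw [← ENNReal.ofReal_natCast]
    push_cast
    rfl
  · refine Finset.sum_congr rfl fun l hl => ?_
    have := hl0 l hl
    rw [ENNReal.ofReal_add (p := 2 + 2 ^ l + 2 * 2 ^ d + _) (by positivity) (by positivity),
      ENNReal.ofReal_mul (by positivity), ← ENNReal.ofReal_natCast, ← ENNReal.ofReal_natCast]
    push_cast
    rfl

/-- The space, apart from the encoding of the number of restarts. -/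
lemma one_add_sum_levelBits_le {c₀ opt : ℝ} (hc₀ : 0 < c₀) (hd : 1 ≤ d) (hS : S.card = 2 ^ d)
    (hε : ε ≤ 1) (hε1 : 1 / 2 ^ d ≤ ε) (hopt : IsOptMPHF c₀ U (2 ^ d) opt) (κ : ℕ) :
    ((1 + ∑ l ∈ Finset.range d, levelBits d κ ε l + 1 : ℕ) : ℝ)
      ≤ opt + (κ + 9 + 4 / c₀) * (ε * 2 ^ d + d ^ 2) := by
  have hε0 : 0 < ε := lt_of_lt_of_le (by positivity) hε1
  have h1 := sum_levelBits_le κ hε0 hε (d := d)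
  have h2 := perfectHashBits_le_opt hc₀ (by positivity) hS hopt
  -- The assumption `ε ≥ 1/n` lets additive constants, including `4 / c₀` from the lower bound, be
  -- absorbed into `ε * n`.
  have h3 : 1 ≤ ε * 2 ^ d := by rwa [div_le_iff₀ (by positivity)] at hε1
  have h4 : (1 : ℝ) ≤ d := by exact_mod_cast hd
  have h5 : 2 / c₀ * Real.logb 2 (Real.exp 1) ≤ 4 / c₀ := by
    calc 2 / c₀ * Real.logb 2 (Real.exp 1) ≤ 2 / c₀ * 2 := by
          gcongr
          exact logb_exp_one_le
      _ = 4 / c₀ := by ring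
  have h6 : (d : ℝ) ≤ d ^ 2 := by nlinarith
  have h7 : (0 : ℝ) ≤ (κ + 3 + 4 / c₀) * (ε * 2 ^ d - 1) :=
    mul_nonneg (by positivity) (by linarith)
  have h8 : (0 : ℝ) ≤ (9 + 4 / c₀) * d ^ 2 := by positivity
  have h9 : (0 : ℝ) ≤ 4 / c₀ := by positivity
  have h10 : (0 : ℝ) ≤ (6 + 4 / c₀) * (d ^ 2 - 1) := mul_nonneg (by positivity) (by linarith)
  have h11 : (0 : ℝ) ≤ (κ : ℝ) := Nat.cast_nonneg κ
  push_cast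
  linarith

end Bounds

end RecSplit

/-! ### Assembling the theorem -/

theorem mainTheorem4 (c c₀ : ℝ) (hc : 0 < c) (hc₀ : 0 < c₀) :
    ∃ (κ lim : ℕ) (C : ℝ), 0 < C ∧
      ∀ (d n : ℕ) (_ : 1 ≤ d) (_ : n = 2 ^ d) (ε : ℝ) (_ : 1 / (n : ℝ) ≤ ε) (_ : ε ≤ 1)
        (U : Type*) (S : Finset U) (_ : S.card = n)
        (opt : ℝ) (_ : RecSplit.IsOptMPHF c₀ U n opt)
        (Ω : Type*) [MeasurableSpace Ω] (P : Measure Ω) [IsProbabilityMeasure P]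
        (h : RecSplit.HashIndex U → Ω → Bool)
        (_ : ∀ k, Measurable (h k))
        (_ : ∀ k, P {ω | h k ω = true} = 1 / 2)
        (_ : iIndepFun h P),
        let H : Ω → RecSplit.HashIndex U → Bool := fun ω k => h k ω
        let D : Ω → List Bool := fun ω => RecSplit.dataStructure d κ lim ε S (H ω)
        -- the construction terminates almost surely
        (∀ᵐ ω ∂P, ∃ a, (RecSplit.attempt d κ lim ε S (H ω) a).ok = true) ∧
        -- whenever it terminates, the result is a minimal perfect hash function for `S`
        (∀ ω, (∃ a, (RecSplit.attempt d κ lim ε S (H ω) a).ok = true) →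
          Set.BijOn (RecSplit.query d κ ε (H ω) (D ω)) (S : Set U) (Set.Iio n)) ∧
        -- expected construction time
        ∫⁻ ω, RecSplit.constructionTime d κ lim ε S (H ω) ∂P
          ≤ ENNReal.ofReal (C * max ((n : ℝ) ^ (3 / 2 : ℝ)) (n / ε)) ∧
        -- expected space and expected query time
        ∫⁻ ω, ((D ω).length : ENNReal) ∂P
          ≤ ENNReal.ofReal (opt + C * (ε * n + Real.logb 2 n ^ 2)) ∧
        (∀ x : U, ∫⁻ ω, (RecSplit.queryTime d κ ε (H ω) (D ω) x : ENNReal) ∂P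
          ≤ ENNReal.ofReal (C * Real.logb 2 n)) ∧
        -- with high probability no restart is needed and both bounds hold in the worst case
        P {ω | ¬ ((RecSplit.attempt d κ lim ε S (H ω) 0).ok = true ∧
            ((D ω).length : ℝ) ≤ opt + C * (ε * n + Real.logb 2 n ^ 2) ∧
            ∀ x : U, (RecSplit.queryTime d κ ε (H ω) (D ω) x : ℝ) ≤ C * Real.logb 2 n)}
          ≤ ENNReal.ofReal ((n : ℝ) ^ (-c)) := by
  -- An integer exponent of at least `c` gives the tail bound; being at least 1 it also gives
  -- failure probability at most `1/n ≤ 1/2` for each attempt, as the expectations require.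
  obtain ⟨c', hc'c, hc'⟩ : ∃ c' : ℕ, c ≤ c' ∧ 1 ≤ c' :=
    ⟨⌈c⌉₊ + 1, (Nat.le_ceil c).trans (by push_cast; linarith), by omega⟩
  set lim := c' + 7 with hlim
  set κ := RecSplit.wordFactor lim with hκ
  have h4c : 0 < 4 / c₀ := by positivity
  -- The first summand serves the construction time, the second the space; either is ample for the
  -- query time.
  set C : ℝ := 2 * (269 + 4 * κ) + (κ + 9 + 4 / c₀) with hC
  refine ⟨κ, lim, C, by positivity, ?_⟩
  intro d n hd hn ε hε1 hε U S hS opt hopt Ω _ P _ h hm hh hi H D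
  subst hn
  have hκ0 : (0 : ℝ) ≤ κ := Nat.cast_nonneg κ
  push_cast at hε1 ⊢
  have hε0 : 0 < ε := lt_of_lt_of_le (by positivity) hε1
  have hlog : Real.logb 2 ((2 : ℝ) ^ d) = d := by
    rw [Real.logb_pow, Real.logb_self_eq_one (by norm_num), mul_one]
  rw [hlog]
  have hd' : (1 : ℝ) ≤ d := by exact_mod_cast hd
  have hq := RecSplit.prob_attempt_fails_le_half hm hh hi hd hS hε hε1 hc'
  have hspace : ((1 + ∑ l ∈ Finset.range d, RecSplit.levelBits d κ ε l + 1 : ℕ) : ℝ)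
      ≤ opt + C * (ε * 2 ^ d + d ^ 2) := by
    refine (RecSplit.one_add_sum_levelBits_le hc₀ hd hS hε hε1 hopt κ).trans ?_
    gcongr
    rw [hC]
    linarith
  have htime : ((1 + 5 * d + 1 : ℕ) : ℝ) ≤ C * d := by
    push_cast
    rw [hC]
    nlinarith
  have hlen : ∀ ω, (D ω).length ≤ RecSplit.restarts d κ lim ε S (H ω)
      + (1 + ∑ l ∈ Finset.range d, RecSplit.levelBits d κ ε l) := fun ω =>
    (RecSplit.length_dataStructure_le hε0 hε).trans (by omega)
  have hquery : ∀ ω x, RecSplit.queryTime d κ ε (H ω) (D ω) x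
      = RecSplit.restarts d κ lim ε S (H ω) + (1 + 5 * d) := fun ω x =>
    (RecSplit.queryTime_eq x).trans (by omega)
  -- Space and query time have the form restarts plus a deterministic `b` (for space as an upper
  -- bound). The expected number of restarts is at most 1, hence the extra `+ 1` in `hspace` and
  -- `htime`.
  have hexp : ∀ (b : ℕ) (x : ℝ), ((b + 1 : ℕ) : ℝ) ≤ x →
      ∫⁻ ω, ((RecSplit.restarts d κ lim ε S (H ω) + b : ℕ) : ENNReal) ∂P ≤ ENNReal.ofReal x := by
    intro b x hb
    refine (RecSplit.lintegral_restarts_le hm hi hq b).trans ?_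
    rw [← ENNReal.ofReal_natCast]
    exact ENNReal.ofReal_le_ofReal hb
  refine ⟨RecSplit.ae_exists_ok hm hi hq,
    fun ω hω => RecSplit.query_bijOn hε0 hε hS hω, ?_, ?_, ?_, ?_⟩
  · refine (RecSplit.lintegral_constructionTime_le hm hh hi hd hS hε hε1 hc').trans
      (ENNReal.ofReal_le_ofReal ?_)
    gcongr
    rw [hC]
    linarith
  · refine (lintegral_mono fun ω => ?_).trans (hexp _ _ hspace)
    exact Nat.cast_le.2 (hlen ω)
  · intro x
    simp only [hquery]
    exact hexp _ _ htime
  -- Once attempt 0 succeeds, both bounds are deterministic, so the exceptional event is contained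
  -- in its failure.
  · refine (measure_mono (t := {ω | (RecSplit.attempt d κ lim ε S (H ω) 0).ok = false})
      fun ω hω => ?_).trans
      ((RecSplit.prob_attempt_fails_le_rpow hm hh hi hd hS hε hε1 c' 0).trans
        (ENNReal.ofReal_le_ofReal ?_))
    · by_contra hok
      have hok : (RecSplit.attempt d κ lim ε S (H ω) 0).ok = true := by simpa using hok
      have hr := RecSplit.restarts_eq_zero hok
      refine hω ⟨hok, ?_, fun x => ?_⟩
      · refine le_trans ?_ hspace
        have := hlen ω
        rw [hr] at this
        exact_mod_cast (by omega : (D ω).length ≤ _)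
      · refine le_trans ?_ htime
        rw [hquery, hr]
        exact_mod_cast (by omega)
    · gcongr
      · exact one_le_pow₀ (by norm_num)
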